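/- Let $\mathbb{K}$ be a field, and let $\mathfrak{S}_n$ be the symmetric group of $[n]=\{1,\dots,n\}$. **Modules.** An $\mathfrak{S}\times\mathfrak{S}^{op}$-module is a family $X=(X(k,l))_{k,l\ge 0}$ of $\mathbb{K}$-vector spaces such that $X(k,l)$ carries a linear left action of $\mathfrak{S}_l$ and a linear right action of $\mathfrak{S}_k$ which commute; a morphism is a family of linear maps compatible with these actions. **ProPs.** For $\alpha\in\mathfrak{S}_m$, $\beta\in\mathfrak{S}_n$ let $\alpha\otimes\beta\in\mathfrak{S}_{m+n}$ be $\alpha$ on the first $m$ and $\beta$ on the last $n$ elements, and let $c_{m,n}\in\mathfrak{S}_{m+n}$ be $i\mapsto i+n$ for $i\le m$ and $i\mapsto i-m$ for $i>m$. A ProP is an $\mathfrak{S}\times\mathfrak{S}^{op}$-module $P$ with bilinear maps $*:P(k,l)\times P(k',l')\to P(k+k',l+l')$ and $\circ:P(l,m)\times P(k,l)\to P(k,m)$ and elements $I_0\in P(0,0)$, $I_1\in P(1,1)$ such that: $*$ is associative with unit $I_0$; $\circ$ is associative, and $p\circ I_k=p=I_l\circ p$ for $p\in P(k,l)$, where $I_n=I_1^{*n}$;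 $(p*p')\circ(q*q')=(p\circ q)*(p'\circ q')$; $\sigma\cdot(p\circ q)=(\sigma\cdot p)\circ q$, $(p\circ q)\cdot\nu=p\circ(q\cdot\nu)$, $(p\cdot\tau)\circ q=p\circ(\tau\cdot q)$; $(\sigma\cdot p)*(\sigma'\cdot p')=(\sigma\otimes\sigma')\cdot(p*p')$, $(p\cdot\tau)*(p'\cdot\tau')=(p*p')\cdot(\tau\otimes\tau')$; and $c_{l,l'}\cdot(p*p')=(p'*p)\cdot c_{k,k'}$ for $p\in P(k,l)$, $p'\in P(k',l')$. A morphism of ProPs is a morphism of modules compatible with $*$, $\circ$, $I_0$ and $I_1$. **Planar graphs.** A planar graph $G$ with $k$ inputs and $l$ outputs consists of finite sets $V$ (vertices), $E$ (internal edges), $I$ (input edges), $O$ (output edges), $IO$ (input-output edges), $L$ (loops, which have no endpoint), a source map $E\sqcup O\to V$, a target map $E\sqcup I\to V$, bijections $\alpha:I\sqcup IO\to[k]$ and $\beta:O\sqcup IO\to[l]$, and, for each vertex $v$, a total order on the set $I(v)$ of edges with target $v$ and a total order on the set $O(v)$ of edges with source $v$. Put $i(v)=|I(v)|$ and $o(v)=|O(v)|$.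 The graph is cycle-free if it has no loop and there is no path of internal edges of nonzero length from a vertex to itself. Isomorphisms are bijections respecting all these data. For $\sigma\in\mathfrak{S}_l$, $\tau\in\mathfrak{S}_k$, the graph $\sigma\cdot G\cdot\tau$ is $G$ with $\beta,\alpha$ replaced by $\sigma\circ\beta,\ \tau^{-1}\circ\alpha$. The horizontal concatenation $G*G'$ is the disjoint union, with the inputs and outputs of $G'$ numbered after those of $G$; the vertical concatenation $G'\circ G$ is obtained by gluing, for each $i$, the $i$-th output of $G$ to the $i$-th input of $G'$. Let $I_0$ be the empty graph and $I_1$ the graph whose only datum is one input-output edge. **Decorated graphs and $\Gamma^\uparrow(X)$.** Let $X$ be an $\mathfrak{S}\times\mathfrak{S}^{op}$-module. Let $\mathbf{PGr}(X)(k,l)$ be the direct sum over the planar graphs $G$ with $k$ inputs and $l$ outputs of $\bigotimes_{v\in V(G)}X(i(v),o(v))$, isomorphic decorated graphs being identified. The actions, $*$ and $\circ$ extend (bi)linearly to decorated graphs, every vertex keeping its decoration. Let $\mathbf{PGr}^\uparrow(X)(k,l)$ be the subspace spanned by the decorated cycle-free graphs, and let $\mathbf I(k,l)$ be the subspace of $\mathbf{PGr}(X)(k,l)$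 spanned by the elements $$(\sigma\cdot_vG\cdot_v\tau)\otimes\bigotimes_{w\in V(G)}x_w\;-\;G\otimes\Big((\sigma\cdot x_v\cdot\tau)\otimes\bigotimes_{w\ne v}x_w\Big),$$ where $v$ is a vertex of $G$, $\sigma\in\mathfrak{S}_{o(v)}$, $\tau\in\mathfrak{S}_{i(v)}$, and $\sigma\cdot_vG\cdot_v\tau$ is $G$ with only the orders at $v$ changed: the edge in position $j$ of $O(v)$ moves to position $\sigma^{-1}(j)$ and the edge in position $j$ of $I(v)$ moves to position $\tau(j)$. The concatenations, the actions and the units pass to the quotients $$\Gamma^\uparrow(X)(k,l)=\mathbf{PGr}^\uparrow(X)(k,l)\big/\big(\mathbf I(k,l)\cap\mathbf{PGr}^\uparrow(X)(k,l)\big).$$ Let $\iota:X\to\Gamma^\uparrow(X)$ be the module morphism which sends $x\in X(k,l)$ to the class of the graph with one vertex, decorated by $x$, with $k$ input edges and $l$ output edges attached to this vertex and no other edge, the orders at the vertex being given by the numberings of the inputs and of the outputs. **Theorem.** For every $\mathfrak{S}\times\mathfrak{S}^{op}$-module $X$, $\Gamma^\uparrow(X)$ is a ProP, $\iota$ is injective,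 and $\Gamma^\uparrow(X)$ is the free ProP generated by $X$: for every ProP $P$ over $\mathbb{K}$ and every morphism of $\mathfrak{S}\times\mathfrak{S}^{op}$-modules $\varphi:X\to P$ there exists a unique morphism of ProPs $\Phi:\Gamma^\uparrow(X)\to P$ such that $\Phi\circ\iota=\varphi$. -/

import Mathlib

universe u v w

/-! ## Symmetric group conventions -/

/-- The permutation `α ⊗ β` of `[m + n]`: `α` on the first `m` elements, `β` on the last `n`. -/
def permTensor {m n : ℕ} (a : Equiv.Perm (Fin m)) (b : Equiv.Perm (Fin n)) :
    Equiv.Perm (Fin (m + n)) :=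
  finSumFinEquiv.symm.trans ((Equiv.sumCongr a b).trans finSumFinEquiv)

/-- The block permutation `c_{m,n}` of `[m + n]`: `i ↦ i + n` on the first `m` elements and
`i ↦ i - m` on the last `n`. -/
def permBlock (m n : ℕ) : Equiv.Perm (Fin (m + n)) :=
  finAddFlip.trans (finCongr (Nat.add_comm n m))

/-! ## `𝔖 × 𝔖ᵒᵖ`-modules and ProPs -/

/-- An `𝔖 × 𝔖ᵒᵖ`-module: a family of `𝕜`-vector spaces `X(k,l)` with commuting linear actions of
`𝔖_l` on the left and of `𝔖_k` on the right; `lact σ x` is `σ · x` and `ract τ x` is `x · τ`. -/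
structure SymBimodule (𝕜 : Type*) [Field 𝕜] where
  carrier : ℕ → ℕ → Type*
  [addCommGroup : ∀ k l, AddCommGroup (carrier k l)]
  [module : ∀ k l, Module 𝕜 (carrier k l)]
  lact : ∀ {k l : ℕ}, Equiv.Perm (Fin l) → carrier k l →ₗ[𝕜] carrier k l
  ract : ∀ {k l : ℕ}, Equiv.Perm (Fin k) → carrier k l →ₗ[𝕜] carrier k l
  lact_one : ∀ {k l : ℕ} (x : carrier k l), lact 1 x = x
  ract_one : ∀ {k l : ℕ} (x : carrier k l), ract 1 x = x
  lact_mul : ∀ {k l : ℕ} (σ σ' : Equiv.Perm (Fin l)) (x : carrier k l),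
    lact σ (lact σ' x) = lact (σ * σ') x
  ract_mul : ∀ {k l : ℕ} (τ τ' : Equiv.Perm (Fin k)) (x : carrier k l),
    ract τ' (ract τ x) = ract (τ * τ') x
  lact_ract : ∀ {k l : ℕ} (σ : Equiv.Perm (Fin l)) (τ : Equiv.Perm (Fin k)) (x : carrier k l),
    lact σ (ract τ x) = ract τ (lact σ x)

attribute [instance] SymBimodule.addCommGroup SymBimodule.module

namespace SymBimodule

variable {𝕜 : Type*} [Field 𝕜]

/-- Transport along equalities of the two indices. -/
def castIdx (X : SymBimodule 𝕜) {k k' l l' : ℕ} (hk : k = k') (hl : l = l')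
    (x : X.carrier k l) : X.carrier k' l' :=
  hk ▸ hl ▸ x

/-- Morphisms of `𝔖 × 𝔖ᵒᵖ`-modules. -/
@[ext]
structure Hom (X Y : SymBimodule 𝕜) where
  map : ∀ k l : ℕ, X.carrier k l →ₗ[𝕜] Y.carrier k l
  map_lact : ∀ {k l : ℕ} (σ : Equiv.Perm (Fin l)) (x : X.carrier k l),
    map k l (X.lact σ x) = Y.lact σ (map k l x)
  map_ract : ∀ {k l : ℕ} (τ : Equiv.Perm (Fin k)) (x : X.carrier k l),
    map k l (X.ract τ x) = Y.ract τ (map k l x)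

/-- Composition of morphisms of `𝔖 × 𝔖ᵒᵖ`-modules. -/
def Hom.comp {X Y Z : SymBimodule 𝕜} (g : Hom Y Z) (f : Hom X Y) : Hom X Z where
  map k l := (g.map k l).comp (f.map k l)
  map_lact σ x := by simp [f.map_lact, g.map_lact]
  map_ract τ x := by simp [f.map_ract, g.map_ract]

end SymBimodule

/-- The operations of a ProP on an `𝔖 × 𝔖ᵒᵖ`-module, without their laws: the horizontal
concatenation `p * p'` (`hcomp p p'`), the vertical concatenation `p ∘ q` (`vcomp p q`)
and the two units. -/
structure PreProP (𝕜 : Type*) [Field 𝕜] extends SymBimodule 𝕜 where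
  hcomp : ∀ {k l k' l' : ℕ}, carrier k l →ₗ[𝕜] carrier k' l' →ₗ[𝕜] carrier (k + k') (l + l')
  vcomp : ∀ {k l m : ℕ}, carrier l m →ₗ[𝕜] carrier k l →ₗ[𝕜] carrier k m
  unit0 : carrier 0 0
  unit1 : carrier 1 1

namespace PreProP

variable {𝕜 : Type*} [Field 𝕜]

/-- `I_n = I_1 * ⋯ * I_1` (`n` factors), with `I_1^{*0} = I_0`. -/
def unitN (P : PreProP 𝕜) : (n : ℕ) → P.carrier n n
  | 0 => P.unit0
  | n + 1 => P.hcomp (P.unitN n) P.unit1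

/-- The laws of a ProP. -/
structure IsProP (P : PreProP 𝕜) : Prop where
  hcomp_assoc : ∀ {k l k' l' k'' l'' : ℕ} (p : P.carrier k l) (p' : P.carrier k' l')
    (p'' : P.carrier k'' l''),
    P.castIdx (Nat.add_assoc k k' k'') (Nat.add_assoc l l' l'') (P.hcomp (P.hcomp p p') p'') =
      P.hcomp p (P.hcomp p' p'')
  hcomp_unit0 : ∀ {k l : ℕ} (p : P.carrier k l),
    P.castIdx (Nat.add_zero k) (Nat.add_zero l) (P.hcomp p P.unit0) = p
  unit0_hcomp : ∀ {k l : ℕ} (p : P.carrier k l),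
    P.castIdx (Nat.zero_add k) (Nat.zero_add l) (P.hcomp P.unit0 p) = p
  vcomp_assoc : ∀ {k l m n : ℕ} (p : P.carrier m n) (q : P.carrier l m) (r : P.carrier k l),
    P.vcomp p (P.vcomp q r) = P.vcomp (P.vcomp p q) r
  vcomp_unitN : ∀ {k l : ℕ} (p : P.carrier k l), P.vcomp p (P.unitN k) = p
  unitN_vcomp : ∀ {k l : ℕ} (p : P.carrier k l), P.vcomp (P.unitN l) p = p
  hcomp_vcomp_hcomp : ∀ {k k' l l' m m' : ℕ} (p : P.carrier l m) (p' : P.carrier l' m')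
    (q : P.carrier k l) (q' : P.carrier k' l'),
    P.vcomp (P.hcomp p p') (P.hcomp q q') = P.hcomp (P.vcomp p q) (P.vcomp p' q')
  lact_vcomp : ∀ {k l m : ℕ} (σ : Equiv.Perm (Fin m)) (p : P.carrier l m) (q : P.carrier k l),
    P.lact σ (P.vcomp p q) = P.vcomp (P.lact σ p) q
  ract_vcomp : ∀ {k l m : ℕ} (ν : Equiv.Perm (Fin k)) (p : P.carrier l m) (q : P.carrier k l),
    P.ract ν (P.vcomp p q) = P.vcomp p (P.ract ν q)
  vcomp_middle : ∀ {k l m : ℕ} (τ : Equiv.Perm (Fin l)) (p : P.carrier l m) (q : P.carrier k l),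
    P.vcomp (P.ract τ p) q = P.vcomp p (P.lact τ q)
  hcomp_lact : ∀ {k l k' l' : ℕ} (σ : Equiv.Perm (Fin l)) (σ' : Equiv.Perm (Fin l'))
    (p : P.carrier k l) (p' : P.carrier k' l'),
    P.hcomp (P.lact σ p) (P.lact σ' p') = P.lact (permTensor σ σ') (P.hcomp p p')
  hcomp_ract : ∀ {k l k' l' : ℕ} (τ : Equiv.Perm (Fin k)) (τ' : Equiv.Perm (Fin k'))
    (p : P.carrier k l) (p' : P.carrier k' l'),
    P.hcomp (P.ract τ p) (P.ract τ' p') = P.ract (permTensor τ τ') (P.hcomp p p')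
  hcomp_comm : ∀ {k l k' l' : ℕ} (p : P.carrier k l) (p' : P.carrier k' l'),
    P.lact (permBlock l l') (P.hcomp p p') =
      P.ract (permBlock k k')
        (P.castIdx (Nat.add_comm k' k) (Nat.add_comm l' l) (P.hcomp p' p))

end PreProP

/-- A ProP. -/
structure ProP (𝕜 : Type*) [Field 𝕜] extends PreProP 𝕜 where
  isProP : toPreProP.IsProP

/-- Morphisms of ProPs. -/
structure ProP.Hom {𝕜 : Type*} [Field 𝕜] (P Q : ProP 𝕜) extends
    SymBimodule.Hom P.toSymBimodule Q.toSymBimodule where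
  map_hcomp : ∀ {k l k' l' : ℕ} (p : P.carrier k l) (p' : P.carrier k' l'),
    map (k + k') (l + l') (P.hcomp p p') = Q.hcomp (map k l p) (map k' l' p')
  map_vcomp : ∀ {k l m : ℕ} (p : P.carrier l m) (q : P.carrier k l),
    map k m (P.vcomp p q) = Q.vcomp (map l m p) (map k l q)
  map_unit0 : map 0 0 P.unit0 = Q.unit0
  map_unit1 : map 1 1 P.unit1 = Q.unit1

/-! ## Planar graphs -/

/-- A planar graph with `k` inputs and `l` outputs: finite sets of vertices, internal edges, input
edges, output edges, input-output edges and loops (edges without endpoints).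

The target map `E ⊔ I → V` and the total orders on the sets `I(v)` of edges arriving at the
vertices are recorded together by the bijection `tgt`: the edge `e` arrives at `v` and is the
`j`-th edge of `I(v)` when `tgt e = ⟨v, j⟩`; so `inDeg v` is forced to be `i(v) = |I(v)|`.
Likewise `src` records the source map `E ⊔ O → V` with the total orders on the sets `O(v)`, and
`outDeg v` is `o(v) = |O(v)|`. The bijections `inIdx` and `outIdx` are the indexations `α`, `β` of
the inputs and of the outputs. Finiteness of the sets of edges other than loops is automatic. -/
structure PlanarGraph (k l : ℕ) where
  V : Type
  E : Type
  I : Type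
  O : Type
  InOut : Type
  L : Type
  [finite_V : Finite V]
  [finite_L : Finite L]
  inDeg : V → ℕ
  outDeg : V → ℕ
  src : E ⊕ O ≃ Σ v : V, Fin (outDeg v)
  tgt : E ⊕ I ≃ Σ v : V, Fin (inDeg v)
  inIdx : I ⊕ InOut ≃ Fin k
  outIdx : O ⊕ InOut ≃ Fin l

attribute [instance] PlanarGraph.finite_V PlanarGraph.finite_L

/-- `{(a, c) : f(a) = g(c)} ⊔ {(b, c) : f(b) = g(c)} ≃ C` for a bijection `f : A ⊔ B → N`. -/
noncomputable def glueRight {A B C N : Type} (f : A ⊕ B ≃ N) (g : C → N) :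
    ({p : A × C // f (Sum.inl p.1) = g p.2} ⊕ {p : B × C // f (Sum.inr p.1) = g p.2}) ≃ C :=
  Equiv.ofBijective (Sum.elim (fun p => p.1.2) (fun p => p.1.2)) (by
    constructor
    · rintro (⟨⟨a, c⟩, h⟩ | ⟨⟨a, c⟩, h⟩) (⟨⟨a', c'⟩, h'⟩ | ⟨⟨a', c'⟩, h'⟩) hc <;>
        (simp only [Sum.elim_inl, Sum.elim_inr] at hc h h'; subst hc
         have := f.injective (h.trans h'.symm); simp_all)
    · intro c
      obtain ⟨x, hx⟩ := f.surjective (g c)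
      rcases x with a | b
      · exact ⟨Sum.inl ⟨(a, c), hx⟩, rfl⟩
      · exact ⟨Sum.inr ⟨(b, c), hx⟩, rfl⟩)

/-- `{(a, c) : f(a) = g(c)} ⊔ {(a, d) : f(a) = g(d)} ≃ A` for a bijection `g : C ⊔ D → N`. -/
noncomputable def glueLeft {A C D N : Type} (f : A → N) (g : C ⊕ D ≃ N) :
    ({p : A × C // f p.1 = g (Sum.inl p.2)} ⊕ {p : A × D // f p.1 = g (Sum.inr p.2)}) ≃ A :=
  Equiv.ofBijective (Sum.elim (fun p => p.1.1) (fun p => p.1.1)) (by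
    constructor
    · rintro (⟨⟨a, c⟩, h⟩ | ⟨⟨a, c⟩, h⟩) (⟨⟨a', c'⟩, h'⟩ | ⟨⟨a', c'⟩, h'⟩) hc <;>
        (simp only [Sum.elim_inl, Sum.elim_inr] at hc h h'; subst hc
         have := g.injective (h.symm.trans h'); simp_all)
    · intro a
      obtain ⟨x, hx⟩ := g.surjective (f a)
      rcases x with c | d
      · exact ⟨Sum.inl ⟨(a, c), hx.symm⟩, rfl⟩
      · exact ⟨Sum.inr ⟨(a, d), hx.symm⟩, rfl⟩)

/-- Reordering of the summands of a disjoint union. -/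
def shuffleSrc (A A' P B Q : Type) :
    ((A ⊕ A') ⊕ P) ⊕ (B ⊕ Q) ≃ (A ⊕ (P ⊕ Q)) ⊕ (A' ⊕ B) where
  toFun
    | .inl (.inl (.inl a)) => .inl (.inl a)
    | .inl (.inl (.inr a)) => .inr (.inl a)
    | .inl (.inr p) => .inl (.inr (.inl p))
    | .inr (.inl b) => .inr (.inr b)
    | .inr (.inr q) => .inl (.inr (.inr q))
  invFun
    | .inl (.inl a) => .inl (.inl (.inl a))
    | .inr (.inl a) => .inl (.inl (.inr a))
    | .inl (.inr (.inl p)) => .inl (.inr p)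
    | .inr (.inr b) => .inr (.inl b)
    | .inl (.inr (.inr q)) => .inr (.inr q)
  left_inv := by rintro (((a | a) | p) | (b | q)) <;> rfl
  right_inv := by rintro ((a | (p | q)) | (a | b)) <;> rfl

/-- Reordering of the summands of a disjoint union. -/
def shuffleTgt (A A' P B Q : Type) :
    ((A ⊕ A') ⊕ P) ⊕ (B ⊕ Q) ≃ (A ⊕ B) ⊕ (A' ⊕ (P ⊕ Q)) where
  toFun
    | .inl (.inl (.inl a)) => .inl (.inl a)
    | .inl (.inl (.inr a)) => .inr (.inl a)
    | .inl (.inr p) => .inr (.inr (.inl p))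
    | .inr (.inl b) => .inl (.inr b)
    | .inr (.inr q) => .inr (.inr (.inr q))
  invFun
    | .inl (.inl a) => .inl (.inl (.inl a))
    | .inr (.inl a) => .inl (.inl (.inr a))
    | .inr (.inr (.inl p)) => .inl (.inr p)
    | .inl (.inr b) => .inr (.inl b)
    | .inr (.inr (.inr q)) => .inr (.inr q)
  left_inv := by rintro (((a | a) | p) | (b | q)) <;> rfl
  right_inv := by rintro ((a | b) | (a | (p | q))) <;> rfl

namespace PlanarGraph

variable {k l m k' l' : ℕ}

/-- There is an internal edge from `v` to `w`. -/
def Adj (G : PlanarGraph k l) (v w : G.V) : Prop :=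
  ∃ e : G.E, (G.src (Sum.inl e)).1 = v ∧ (G.tgt (Sum.inl e)).1 = w

/-- No loop, and no cycle, i.e. no path of internal edges of nonzero length from a vertex to
itself. -/
def IsCycleFree (G : PlanarGraph k l) : Prop :=
  IsEmpty G.L ∧ ∀ v : G.V, ¬ Relation.TransGen G.Adj v v

/-- `σ · G`: the outputs are indexed by `σ ∘ β`. -/
def lact (σ : Equiv.Perm (Fin l)) (G : PlanarGraph k l) : PlanarGraph k l :=
  { G with outIdx := G.outIdx.trans σ }

/-- `G · τ`: the inputs are indexed by `τ⁻¹ ∘ α`. -/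
def ract (τ : Equiv.Perm (Fin k)) (G : PlanarGraph k l) : PlanarGraph k l :=
  { G with inIdx := G.inIdx.trans τ⁻¹ }

/-- Horizontal concatenation `G * G'`: disjoint union, the inputs and outputs of `G'` being indexed
after those of `G`. -/
def hcomp (G : PlanarGraph k l) (G' : PlanarGraph k' l') : PlanarGraph (k + k') (l + l') where
  V := G.V ⊕ G'.V
  E := G.E ⊕ G'.E
  I := G.I ⊕ G'.I
  O := G.O ⊕ G'.O
  InOut := G.InOut ⊕ G'.InOut
  L := G.L ⊕ G'.L
  inDeg := Sum.elim G.inDeg G'.inDeg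
  outDeg := Sum.elim G.outDeg G'.outDeg
  src := (Equiv.sumSumSumComm G.E G'.E G.O G'.O).trans
    ((Equiv.sumCongr G.src G'.src).trans
      (Equiv.sumSigmaDistrib (fun v => Fin (Sum.elim G.outDeg G'.outDeg v))).symm)
  tgt := (Equiv.sumSumSumComm G.E G'.E G.I G'.I).trans
    ((Equiv.sumCongr G.tgt G'.tgt).trans
      (Equiv.sumSigmaDistrib (fun v => Fin (Sum.elim G.inDeg G'.inDeg v))).symm)
  inIdx := (Equiv.sumSumSumComm G.I G'.I G.InOut G'.InOut).trans
    ((Equiv.sumCongr G.inIdx G'.inIdx).trans finSumFinEquiv)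
  outIdx := (Equiv.sumSumSumComm G.O G'.O G.InOut G'.InOut).trans
    ((Equiv.sumCongr G.outIdx G'.outIdx).trans finSumFinEquiv)

/-- Vertical concatenation `G' ∘ G`: the outputs of `G` are glued to the inputs of `G'` with the same
index. A glued edge is a pair `(f, e)` of an output of `G` and an input of `G'`; it is an internal
edge, an input, an output or an input-output of `G' ∘ G` according to the types of `f` and `e`. -/
noncomputable def vcomp (G' : PlanarGraph l m) (G : PlanarGraph k l) : PlanarGraph k m where
  V := G.V ⊕ G'.V
  E := (G.E ⊕ G'.E) ⊕
    {p : G.O × G'.I // G.outIdx (Sum.inl p.1) = G'.inIdx (Sum.inl p.2)}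
  I := G.I ⊕ {p : G.InOut × G'.I // G.outIdx (Sum.inr p.1) = G'.inIdx (Sum.inl p.2)}
  O := G'.O ⊕ {p : G.O × G'.InOut // G.outIdx (Sum.inl p.1) = G'.inIdx (Sum.inr p.2)}
  InOut := {p : G.InOut × G'.InOut // G.outIdx (Sum.inr p.1) = G'.inIdx (Sum.inr p.2)}
  L := G.L ⊕ G'.L
  inDeg := Sum.elim G.inDeg G'.inDeg
  outDeg := Sum.elim G.outDeg G'.outDeg
  src :=
    -- the glued edges starting at a vertex of `G` are in bijection with `G.O`
    (shuffleSrc G.E G'.E _ G'.O _).trans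
      ((Equiv.sumCongr
        ((Equiv.sumCongr (Equiv.refl G.E)
          (glueLeft (fun f : G.O => G.outIdx (Sum.inl f)) G'.inIdx)).trans G.src) G'.src).trans
        (Equiv.sumSigmaDistrib (fun v => Fin (Sum.elim G.outDeg G'.outDeg v))).symm)
  tgt :=
    -- the glued edges arriving at a vertex of `G'` are in bijection with `G'.I`
    (shuffleTgt G.E G'.E _ G.I _).trans
      ((Equiv.sumCongr G.tgt
        ((Equiv.sumCongr (Equiv.refl G'.E)
          (glueRight G.outIdx (fun e : G'.I => G'.inIdx (Sum.inl e)))).trans G'.tgt)).trans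
        (Equiv.sumSigmaDistrib (fun v => Fin (Sum.elim G.inDeg G'.inDeg v))).symm)
  inIdx := (Equiv.sumAssoc _ _ _).trans
    ((Equiv.sumCongr (Equiv.refl _)
      (glueLeft (fun f : G.InOut => G.outIdx (Sum.inr f)) G'.inIdx)).trans G.inIdx)
  outIdx := (Equiv.sumAssoc _ _ _).trans
    ((Equiv.sumCongr (Equiv.refl _)
      (glueRight G.outIdx (fun e : G'.InOut => G'.inIdx (Sum.inr e)))).trans G'.outIdx)

/-- The graph `σ ·_v G ·_v τ`, in which only the orders at the vertex `v` are changed: the edge in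
position `j` of `O(v)` moves to position `σ⁻¹ j`, and the edge in position `j` of `I(v)` moves to
position `τ j`. -/
noncomputable def reorder (G : PlanarGraph k l) (v : G.V) (σ : Equiv.Perm (Fin (G.outDeg v)))
    (τ : Equiv.Perm (Fin (G.inDeg v))) : PlanarGraph k l :=
  open Classical in
  { G with
    src := G.src.trans (Equiv.sigmaCongrRight
      (Pi.mulSingle (M := fun w => Equiv.Perm (Fin (G.outDeg w))) v σ⁻¹))
    tgt := G.tgt.trans (Equiv.sigmaCongrRight
      (Pi.mulSingle (M := fun w => Equiv.Perm (Fin (G.inDeg w))) v τ)) }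

/-- The empty graph `I_0`. -/
def unit0 : PlanarGraph 0 0 where
  V := Empty
  E := Empty
  I := Empty
  O := Empty
  InOut := Empty
  L := Empty
  inDeg := Empty.elim
  outDeg := Empty.elim
  src := Equiv.equivOfIsEmpty _ _
  tgt := Equiv.equivOfIsEmpty _ _
  inIdx := Equiv.equivOfIsEmpty _ _
  outIdx := Equiv.equivOfIsEmpty _ _

/-- The graph `I_1` with a single input-output edge and nothing else. -/
def unit1 : PlanarGraph 1 1 where
  V := Empty
  E := Empty
  I := Empty
  O := Empty
  InOut := Fin 1
  L := Empty
  inDeg := Empty.elim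
  outDeg := Empty.elim
  src := Equiv.equivOfIsEmpty _ _
  tgt := Equiv.equivOfIsEmpty _ _
  inIdx := Equiv.emptySum _ _
  outIdx := Equiv.emptySum _ _

/-- The graph with one vertex, `k` inputs and `l` outputs attached to it, and no other edge, the
orders at the vertex being given by the indexations. -/
def corolla (k l : ℕ) : PlanarGraph k l where
  V := Unit
  E := Empty
  I := Fin k
  O := Fin l
  InOut := Empty
  L := Empty
  inDeg _ := k
  outDeg _ := l
  src := (Equiv.emptySum _ _).trans (Equiv.uniqueSigma (fun _ : Unit => Fin l)).symm
  tgt := (Equiv.emptySum _ _).trans (Equiv.uniqueSigma (fun _ : Unit => Fin k)).symm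
  inIdx := Equiv.sumEmpty _ _
  outIdx := Equiv.sumEmpty _ _

/-- The inclusion of the positions around the vertices of the first of two sets of vertices. -/
def sigmaInl {V W : Type} (a : V → ℕ) (b : W → ℕ) (s : Σ v, Fin (a v)) :
    Σ v : V ⊕ W, Fin (Sum.elim a b v) :=
  ⟨Sum.inl s.1, s.2⟩

/-- The inclusion of the positions around the vertices of the second of two sets of vertices. -/
def sigmaInr {V W : Type} (a : V → ℕ) (b : W → ℕ) (s : Σ v, Fin (b v)) :
    Σ v : V ⊕ W, Fin (Sum.elim a b v) :=
  ⟨Sum.inr s.1, s.2⟩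

/-- Isomorphisms of planar graphs: bijections compatible with sources, targets, the orders at the
vertices and the indexations of inputs and outputs. -/
structure Iso (G H : PlanarGraph k l) where
  fV : G.V ≃ H.V
  fE : G.E ≃ H.E
  fI : G.I ≃ H.I
  fO : G.O ≃ H.O
  fInOut : G.InOut ≃ H.InOut
  fL : G.L ≃ H.L
  inDeg_eq : ∀ v, G.inDeg v = H.inDeg (fV v)
  outDeg_eq : ∀ v, G.outDeg v = H.outDeg (fV v)
  src_map : ∀ x, H.src (Sum.map fE fO x) =
    ⟨fV (G.src x).1, Fin.cast (outDeg_eq _) (G.src x).2⟩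
  tgt_map : ∀ x, H.tgt (Sum.map fE fI x) =
    ⟨fV (G.tgt x).1, Fin.cast (inDeg_eq _) (G.tgt x).2⟩
  inIdx_map : ∀ x, H.inIdx (Sum.map fI fInOut x) = G.inIdx x
  outIdx_map : ∀ x, H.outIdx (Sum.map fO fInOut x) = G.outIdx x

/-- The identity isomorphism. -/
def Iso.refl (G : PlanarGraph k l) : Iso G G where
  fV := Equiv.refl _
  fE := Equiv.refl _
  fI := Equiv.refl _
  fO := Equiv.refl _
  fInOut := Equiv.refl _
  fL := Equiv.refl _
  inDeg_eq _ := rfl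
  outDeg_eq _ := rfl
  src_map := by rintro (x | x) <;> rfl
  tgt_map := by rintro (x | x) <;> rfl
  inIdx_map := by rintro (x | x) <;> rfl
  outIdx_map := by rintro (x | x) <;> rfl

/-- Horizontal concatenation of isomorphisms. -/
def Iso.hcomp {G H : PlanarGraph k l} {G' H' : PlanarGraph k' l'} (f : Iso G H) (f' : Iso G' H') :
    Iso (G.hcomp G') (H.hcomp H') where
  fV := Equiv.sumCongr f.fV f'.fV
  fE := Equiv.sumCongr f.fE f'.fE
  fI := Equiv.sumCongr f.fI f'.fI
  fO := Equiv.sumCongr f.fO f'.fO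
  fInOut := Equiv.sumCongr f.fInOut f'.fInOut
  fL := Equiv.sumCongr f.fL f'.fL
  inDeg_eq := by rintro (v | v); exacts [f.inDeg_eq v, f'.inDeg_eq v]
  outDeg_eq := by rintro (v | v); exacts [f.outDeg_eq v, f'.outDeg_eq v]
  src_map := by
    rintro ((x | x) | (x | x))
    · exact congrArg (sigmaInl H.outDeg H'.outDeg) (f.src_map (.inl x))
    · exact congrArg (sigmaInr H.outDeg H'.outDeg) (f'.src_map (.inl x))
    · exact congrArg (sigmaInl H.outDeg H'.outDeg) (f.src_map (.inr x))
    · exact congrArg (sigmaInr H.outDeg H'.outDeg) (f'.src_map (.inr x))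
  tgt_map := by
    rintro ((x | x) | (x | x))
    · exact congrArg (sigmaInl H.inDeg H'.inDeg) (f.tgt_map (.inl x))
    · exact congrArg (sigmaInr H.inDeg H'.inDeg) (f'.tgt_map (.inl x))
    · exact congrArg (sigmaInl H.inDeg H'.inDeg) (f.tgt_map (.inr x))
    · exact congrArg (sigmaInr H.inDeg H'.inDeg) (f'.tgt_map (.inr x))
  inIdx_map := by
    rintro ((x | x) | (x | x))
    · exact congrArg (fun s => finSumFinEquiv (.inl s)) (f.inIdx_map (.inl x))
    · exact congrArg (fun s => finSumFinEquiv (.inr s)) (f'.inIdx_map (.inl x))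
    · exact congrArg (fun s => finSumFinEquiv (.inl s)) (f.inIdx_map (.inr x))
    · exact congrArg (fun s => finSumFinEquiv (.inr s)) (f'.inIdx_map (.inr x))
  outIdx_map := by
    rintro ((x | x) | (x | x))
    · exact congrArg (fun s => finSumFinEquiv (.inl s)) (f.outIdx_map (.inl x))
    · exact congrArg (fun s => finSumFinEquiv (.inr s)) (f'.outIdx_map (.inl x))
    · exact congrArg (fun s => finSumFinEquiv (.inl s)) (f.outIdx_map (.inr x))
    · exact congrArg (fun s => finSumFinEquiv (.inr s)) (f'.outIdx_map (.inr x))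

/-- Vertical concatenation of isomorphisms. -/
noncomputable def Iso.vcomp {G' H' : PlanarGraph l m} {G H : PlanarGraph k l} (f' : Iso G' H')
    (f : Iso G H) : Iso (G'.vcomp G) (H'.vcomp H) where
  fV := Equiv.sumCongr f.fV f'.fV
  fE := Equiv.sumCongr (Equiv.sumCongr f.fE f'.fE)
    (Equiv.subtypeEquiv (Equiv.prodCongr f.fO f'.fI) (fun p => by
      rw [← f.outIdx_map, ← f'.inIdx_map]; rfl))
  fI := Equiv.sumCongr f.fI
    (Equiv.subtypeEquiv (Equiv.prodCongr f.fInOut f'.fI) (fun p => by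
      rw [← f.outIdx_map, ← f'.inIdx_map]; rfl))
  fO := Equiv.sumCongr f'.fO
    (Equiv.subtypeEquiv (Equiv.prodCongr f.fO f'.fInOut) (fun p => by
      rw [← f.outIdx_map, ← f'.inIdx_map]; rfl))
  fInOut := Equiv.subtypeEquiv (Equiv.prodCongr f.fInOut f'.fInOut) (fun p => by
      rw [← f.outIdx_map, ← f'.inIdx_map]; rfl)
  fL := Equiv.sumCongr f.fL f'.fL
  inDeg_eq := by rintro (v | v); exacts [f.inDeg_eq v, f'.inDeg_eq v]
  outDeg_eq := by rintro (v | v); exacts [f.outDeg_eq v, f'.outDeg_eq v]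
  src_map := by
    rintro (((x | x) | ⟨⟨x, y⟩, h⟩) | (x | ⟨⟨x, y⟩, h⟩))
    · exact congrArg (sigmaInl H.outDeg H'.outDeg) (f.src_map (.inl x))
    · exact congrArg (sigmaInr H.outDeg H'.outDeg) (f'.src_map (.inl x))
    · exact congrArg (sigmaInl H.outDeg H'.outDeg) (f.src_map (.inr x))
    · exact congrArg (sigmaInr H.outDeg H'.outDeg) (f'.src_map (.inr x))
    · exact congrArg (sigmaInl H.outDeg H'.outDeg) (f.src_map (.inr x))
  tgt_map := by
    rintro (((x | x) | ⟨⟨x, y⟩, h⟩) | (x | ⟨⟨x, y⟩, h⟩))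
    · exact congrArg (sigmaInl H.inDeg H'.inDeg) (f.tgt_map (.inl x))
    · exact congrArg (sigmaInr H.inDeg H'.inDeg) (f'.tgt_map (.inl x))
    · exact congrArg (sigmaInr H.inDeg H'.inDeg) (f'.tgt_map (.inr y))
    · exact congrArg (sigmaInl H.inDeg H'.inDeg) (f.tgt_map (.inr x))
    · exact congrArg (sigmaInr H.inDeg H'.inDeg) (f'.tgt_map (.inr y))
  inIdx_map := by
    rintro ((x | ⟨⟨x, y⟩, h⟩) | ⟨⟨x, y⟩, h⟩)
    · exact f.inIdx_map (.inl x)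
    · exact f.inIdx_map (.inr x)
    · exact f.inIdx_map (.inr x)
  outIdx_map := by
    rintro ((x | ⟨⟨x, y⟩, h⟩) | ⟨⟨x, y⟩, h⟩)
    · exact f'.outIdx_map (.inl x)
    · exact f'.outIdx_map (.inr y)
    · exact f'.outIdx_map (.inr y)

/-- Isomorphisms remain isomorphisms after the left action. -/
def Iso.lact {G H : PlanarGraph k l} (f : Iso G H) (σ : Equiv.Perm (Fin l)) :
    Iso (G.lact σ) (H.lact σ) :=
  { f with outIdx_map := fun x => congrArg σ (f.outIdx_map x) }

/-- Isomorphisms remain isomorphisms after the right action. -/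
def Iso.ract {G H : PlanarGraph k l} (f : Iso G H) (τ : Equiv.Perm (Fin k)) :
    Iso (G.ract τ) (H.ract τ) :=
  { f with inIdx_map := fun x => congrArg (τ⁻¹ : Equiv.Perm (Fin k)) (f.inIdx_map x) }

theorem isCycleFree_lact {G : PlanarGraph k l} (h : G.IsCycleFree) (σ : Equiv.Perm (Fin l)) :
    (G.lact σ).IsCycleFree := h

theorem isCycleFree_ract {G : PlanarGraph k l} (h : G.IsCycleFree) (τ : Equiv.Perm (Fin k)) :
    (G.ract τ).IsCycleFree := h

theorem isCycleFree_of_isEmpty_E {G : PlanarGraph k l} (h : IsEmpty G.L) (h' : IsEmpty G.E) :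
    G.IsCycleFree := by
  refine ⟨h, fun v hv => ?_⟩
  obtain ⟨w', ⟨e, -⟩, -⟩ := Relation.TransGen.head'_iff.1 hv
  exact h'.elim e

/-- If every edge stays in one of the two parts or goes from the first one to the second one, then
a cycle stays in one of the two parts. -/
theorem isCycleFree_of_sum {V W : Type} {r : V → V → Prop} {s : W → W → Prop}
    {t : V ⊕ W → V ⊕ W → Prop} (hr : ∀ v v', t (.inl v) (.inl v') → r v v')
    (hs : ∀ w w', t (.inr w) (.inr w') → s w w') (ht : ∀ w v, ¬ t (.inr w) (.inl v))
    (hr' : ∀ v, ¬ Relation.TransGen r v v) (hs' : ∀ w, ¬ Relation.TransGen s w w) (x : V ⊕ W) :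
    ¬ Relation.TransGen t x x := by
  have key : ∀ x y, Relation.TransGen t x y →
      (∀ v v', x = .inl v → y = .inl v' → Relation.TransGen r v v') ∧
      (∀ w w', x = .inr w → y = .inr w' → Relation.TransGen s w w') ∧
      (∀ w v, x = .inr w → y ≠ .inl v) := by
    intro x y h
    induction h with
    | single h =>
      refine ⟨?_, ?_, ?_⟩
      · rintro v v' rfl rfl; exact .single (hr _ _ h)
      · rintro v v' rfl rfl; exact .single (hs _ _ h)
      · rintro w v rfl rfl; exact ht _ _ h
    | @tail b c _ h ih =>
      obtain ⟨h1, h2, h3⟩ := ih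
      refine ⟨?_, ?_, ?_⟩
      · rintro v v' rfl rfl
        rcases b with b | b
        · exact (h1 _ _ rfl rfl).tail (hr _ _ h)
        · exact (ht _ _ h).elim
      · rintro w w' rfl rfl
        rcases b with b | b
        · exact (h3 _ _ rfl rfl).elim
        · exact (h2 _ _ rfl rfl).tail (hs _ _ h)
      · rintro w v rfl rfl
        rcases b with b | b
        · exact h3 _ _ rfl rfl
        · exact ht _ _ h
  intro h
  rcases x with v | w
  · exact hr' v ((key _ _ h).1 _ _ rfl rfl)
  · exact hs' w ((key _ _ h).2.1 _ _ rfl rfl)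

theorem isCycleFree_hcomp {G : PlanarGraph k l} {G' : PlanarGraph k' l'} (h : G.IsCycleFree)
    (h' : G'.IsCycleFree) : (G.hcomp G').IsCycleFree := by
  have := h.1
  have := h'.1
  refine ⟨inferInstanceAs (IsEmpty (G.L ⊕ G'.L)), fun x => ?_⟩
  refine isCycleFree_of_sum (r := G.Adj) (s := G'.Adj) (V := G.V) (W := G'.V) ?_ ?_ ?_ h.2 h'.2 x
  · rintro v v' ⟨e | e, h1, h2⟩
    · exact ⟨e, Sum.inl.inj h1, Sum.inl.inj h2⟩
    · cases h1
  · rintro v v' ⟨e | e, h1, h2⟩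
    · cases h1
    · exact ⟨e, Sum.inr.inj h1, Sum.inr.inj h2⟩
  · rintro v v' ⟨e | e, h1, h2⟩
    · cases h1
    · cases h2

theorem isCycleFree_vcomp {G' : PlanarGraph l m} {G : PlanarGraph k l} (h' : G'.IsCycleFree)
    (h : G.IsCycleFree) : (G'.vcomp G).IsCycleFree := by
  have := h.1
  have := h'.1
  refine ⟨inferInstanceAs (IsEmpty (G.L ⊕ G'.L)), fun x => ?_⟩
  refine isCycleFree_of_sum (r := G.Adj) (s := G'.Adj) (V := G.V) (W := G'.V) ?_ ?_ ?_ h.2 h'.2 x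
  · rintro v v' ⟨(e | e) | e, h1, h2⟩
    · exact ⟨e, Sum.inl.inj h1, Sum.inl.inj h2⟩
    · cases h1
    · cases h2
  · rintro v v' ⟨(e | e) | e, h1, h2⟩
    · cases h1
    · exact ⟨e, Sum.inr.inj h1, Sum.inr.inj h2⟩
    · cases h1
  · rintro v v' ⟨(e | e) | e, h1, h2⟩
    · cases h1
    · cases h2
    · cases h1

end PlanarGraph

/-! ## Decorated planar graphs -/

/-- A planar graph `G` with `k` inputs and `l` outputs in which every vertex `v` is decorated by an
element of `X(i(v), o(v))`. -/
structure DecGraph {𝕜 : Type*} [Field 𝕜] (X : SymBimodule 𝕜) (k l : ℕ) where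
  graph : PlanarGraph k l
  dec : ∀ v : graph.V, X.carrier (graph.inDeg v) (graph.outDeg v)

namespace DecGraph

variable {𝕜 : Type*} [Field 𝕜] {X : SymBimodule 𝕜} {k l m k' l' : ℕ}

/-- `σ · G`. -/
def lact (σ : Equiv.Perm (Fin l)) (G : DecGraph X k l) : DecGraph X k l :=
  ⟨G.graph.lact σ, G.dec⟩

/-- `G · τ`. -/
def ract (τ : Equiv.Perm (Fin k)) (G : DecGraph X k l) : DecGraph X k l :=
  ⟨G.graph.ract τ, G.dec⟩

/-- The decoration of a disjoint union of two sets of vertices. -/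
def sumDec {V W : Type} {a a' : V → ℕ} {b b' : W → ℕ} (d : ∀ v, X.carrier (a v) (a' v))
    (d' : ∀ w, X.carrier (b w) (b' w)) :
    ∀ v : V ⊕ W, X.carrier (Sum.elim a b v) (Sum.elim a' b' v)
  | .inl v => d v
  | .inr w => d' w

theorem sumDec_update_left {V W : Type} [DecidableEq V] [DecidableEq W] {a a' : V → ℕ}
    {b b' : W → ℕ} (d : ∀ v, X.carrier (a v) (a' v)) (d' : ∀ w, X.carrier (b w) (b' w)) (v : V)
    (x : X.carrier (a v) (a' v)) :
    sumDec (Function.update d v x) d' = Function.update (sumDec d d') (.inl v) x := by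
  have h : ∀ (e : ∀ v, X.carrier (a v) (a' v)), sumDec (X := X) e d' =
      Sum.rec (motive := fun v => X.carrier (Sum.elim a b v) (Sum.elim a' b' v)) e d' := by
    intro e; funext z; rcases z with z | z <;> rfl
  rw [h, h]
  exact Sum.rec_update_left (γ := fun v => X.carrier (Sum.elim a b v) (Sum.elim a' b' v)) d d' v x

theorem sumDec_update_right {V W : Type} [DecidableEq V] [DecidableEq W] {a a' : V → ℕ}
    {b b' : W → ℕ} (d : ∀ v, X.carrier (a v) (a' v)) (d' : ∀ w, X.carrier (b w) (b' w)) (w : W)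
    (x : X.carrier (b w) (b' w)) :
    sumDec d (Function.update d' w x) = Function.update (sumDec d d') (.inr w) x := by
  have h : ∀ (e : ∀ w, X.carrier (b w) (b' w)), sumDec (X := X) d e =
      Sum.rec (motive := fun v => X.carrier (Sum.elim a b v) (Sum.elim a' b' v)) d e := by
    intro e; funext z; rcases z with z | z <;> rfl
  rw [h, h]
  exact Sum.rec_update_right (γ := fun v => X.carrier (Sum.elim a b v) (Sum.elim a' b' v)) d d' w x

/-- Horizontal concatenation; every vertex keeps its decoration. -/
def hcomp (G : DecGraph X k l) (G' : DecGraph X k' l') : DecGraph X (k + k') (l + l') :=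
  ⟨G.graph.hcomp G'.graph, sumDec G.dec G'.dec⟩

/-- Vertical concatenation; every vertex keeps its decoration. -/
noncomputable def vcomp (G' : DecGraph X l m) (G : DecGraph X k l) : DecGraph X k m :=
  ⟨G'.graph.vcomp G.graph, sumDec G.dec G'.dec⟩

/-- Isomorphisms of decorated planar graphs. -/
structure Iso (G H : DecGraph X k l) extends PlanarGraph.Iso G.graph H.graph where
  dec_map : ∀ v, H.dec (fV v) = X.castIdx (inDeg_eq v) (outDeg_eq v) (G.dec v)

end DecGraph

/-- The relations saying that a decorated graph is linear in the decoration of each of its vertices,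
and depends only on its isomorphism class. -/
inductive DecRel {𝕜 : Type*} [Field 𝕜] (X : SymBimodule 𝕜) (k l : ℕ) :
    (DecGraph X k l →₀ 𝕜) → Prop
  | add (G : PlanarGraph k l) [DecidableEq G.V]
      (d : ∀ v : G.V, X.carrier (G.inDeg v) (G.outDeg v)) (v : G.V)
      (x y : X.carrier (G.inDeg v) (G.outDeg v)) :
      DecRel X k l (Finsupp.single ⟨G, Function.update d v (x + y)⟩ 1
        - Finsupp.single ⟨G, Function.update d v x⟩ 1
        - Finsupp.single ⟨G, Function.update d v y⟩ 1)
  | smul (G : PlanarGraph k l) [DecidableEq G.V]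
      (d : ∀ v : G.V, X.carrier (G.inDeg v) (G.outDeg v)) (v : G.V) (c : 𝕜)
      (x : X.carrier (G.inDeg v) (G.outDeg v)) :
      DecRel X k l (Finsupp.single ⟨G, Function.update d v (c • x)⟩ 1
        - c • Finsupp.single ⟨G, Function.update d v x⟩ 1)
  | iso (G H : DecGraph X k l) (f : G.Iso H) :
      DecRel X k l (Finsupp.single G 1 - Finsupp.single H 1)

/-- The space `PGr↻(X)(k,l)`, i.e. the sum over the planar graphs `G` with `k` inputs and `l` outputs
of the tensor products `⨂_v X(i(v), o(v))`, in which isomorphic decorated graphs are identified. It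
is presented by the decorated graphs as generators, subject to linearity in the decoration of each
vertex and to invariance under isomorphisms. -/
abbrev PGr {𝕜 : Type*} [Field 𝕜] (X : SymBimodule 𝕜) (k l : ℕ) : Type _ :=
  (DecGraph X k l →₀ 𝕜) ⧸ Submodule.span 𝕜 {r | DecRel X k l r}

namespace PGr

variable {𝕜 : Type*} [Field 𝕜] {X : SymBimodule 𝕜} {k l m k' l' k'' l'' : ℕ}

/-- The class of a decorated planar graph. -/
noncomputable def mk (G : DecGraph X k l) : PGr X k l :=
  Submodule.Quotient.mk (Finsupp.single G 1)

theorem mk_add (G : PlanarGraph k l) [DecidableEq G.V]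
    (d : ∀ v : G.V, X.carrier (G.inDeg v) (G.outDeg v)) (v : G.V)
    (x y : X.carrier (G.inDeg v) (G.outDeg v)) :
    mk ⟨G, Function.update d v (x + y)⟩ =
      mk ⟨G, Function.update d v x⟩ + mk ⟨G, Function.update d v y⟩ := by
  have := (Submodule.Quotient.mk_eq_zero _).2
    (Submodule.subset_span (R := 𝕜) (s := {r | DecRel X k l r}) (DecRel.add G d v x y))
  rw [Submodule.Quotient.mk_sub, Submodule.Quotient.mk_sub, sub_sub, sub_eq_zero] at this
  exact this

theorem mk_smul (G : PlanarGraph k l) [DecidableEq G.V]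
    (d : ∀ v : G.V, X.carrier (G.inDeg v) (G.outDeg v)) (v : G.V) (c : 𝕜)
    (x : X.carrier (G.inDeg v) (G.outDeg v)) :
    mk ⟨G, Function.update d v (c • x)⟩ = c • mk ⟨G, Function.update d v x⟩ := by
  have := (Submodule.Quotient.mk_eq_zero _).2
    (Submodule.subset_span (R := 𝕜) (s := {r | DecRel X k l r}) (DecRel.smul G d v c x))
  rw [Submodule.Quotient.mk_sub, Submodule.Quotient.mk_smul, sub_eq_zero] at this
  exact this

theorem mk_iso {G H : DecGraph X k l} (f : G.Iso H) : mk G = mk H := by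
  have := (Submodule.Quotient.mk_eq_zero _).2
    (Submodule.subset_span (R := 𝕜) (s := {r | DecRel X k l r}) (DecRel.iso G H f))
  rw [Submodule.Quotient.mk_sub, sub_eq_zero] at this
  exact this

theorem induction_mk {p : PGr X k l → Prop} (h0 : p 0) (hadd : ∀ x y, p x → p y → p (x + y))
    (hmk : ∀ (c : 𝕜) G, p (c • mk G)) (x : PGr X k l) : p x := by
  obtain ⟨x, rfl⟩ := Submodule.Quotient.mk_surjective _ x
  induction x using Finsupp.induction_linear with
  | zero => exact h0
  | add x y hx hy => exact hadd _ _ hx hy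
  | single G c =>
    have := hmk c G
    rwa [mk, ← Submodule.Quotient.mk_smul, Finsupp.smul_single, smul_eq_mul, mul_one] at this

/-- A linear map on `PGr X k l` is given by its values on decorated graphs, which have to be linear
in each decoration and invariant under isomorphisms. -/
structure IsMultilinear {M : Type*} [AddCommGroup M] [Module 𝕜 M] (F : DecGraph X k l → M) :
    Prop where
  map_add : ∀ (G : PlanarGraph k l) [DecidableEq G.V]
    (d : ∀ v : G.V, X.carrier (G.inDeg v) (G.outDeg v)) (v : G.V)
    (x y : X.carrier (G.inDeg v) (G.outDeg v)),
    F ⟨G, Function.update d v (x + y)⟩ =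
      F ⟨G, Function.update d v x⟩ + F ⟨G, Function.update d v y⟩
  map_smul : ∀ (G : PlanarGraph k l) [DecidableEq G.V]
    (d : ∀ v : G.V, X.carrier (G.inDeg v) (G.outDeg v)) (v : G.V) (c : 𝕜)
    (x : X.carrier (G.inDeg v) (G.outDeg v)),
    F ⟨G, Function.update d v (c • x)⟩ = c • F ⟨G, Function.update d v x⟩
  map_iso : ∀ {G H : DecGraph X k l}, G.Iso H → F G = F H

/-- The linear extension of a multilinear and isomorphism-invariant function of decorated graphs. -/
noncomputable def lift {M : Type*} [AddCommGroup M] [Module 𝕜 M] (F : DecGraph X k l → M)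
    (hF : IsMultilinear F) : PGr X k l →ₗ[𝕜] M :=
  Submodule.liftQ _ (Finsupp.linearCombination 𝕜 F) (by
    rw [Submodule.span_le]
    rintro r (⟨G, d, v, x, y⟩ | ⟨G, d, v, c, x⟩ | ⟨G, H, f⟩)
    · simp [hF.map_add]
    · simp [hF.map_smul]
    · simpa [sub_eq_zero] using hF.map_iso f)

@[simp]
theorem lift_mk {M : Type*} [AddCommGroup M] [Module 𝕜 M] (F : DecGraph X k l → M)
    (hF : IsMultilinear F) (G : DecGraph X k l) : lift F hF (mk G) = F G := by
  simp [lift, mk]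

theorem linearMap_ext {M : Type*} [AddCommGroup M] [Module 𝕜 M] {f g : PGr X k l →ₗ[𝕜] M}
    (h : ∀ G, f (mk G) = g (mk G)) : f = g := by
  refine LinearMap.ext fun x => ?_
  induction x using induction_mk with
  | h0 => simp
  | hadd x y hx hy => simp [hx, hy]
  | hmk c G => simp [h]

/-- Criterion for an operation on decorated graphs to be multilinear: changing the decoration of one
vertex of the argument changes linearly the decoration of one vertex of the result. -/
theorem isMultilinear_of_update (F : DecGraph X k l → DecGraph X k' l')
    (h : ∀ (G : PlanarGraph k l) [DecidableEq G.V]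
      (d : ∀ v : G.V, X.carrier (G.inDeg v) (G.outDeg v)) (v : G.V),
      ∃ (H : PlanarGraph k' l') (_ : DecidableEq H.V)
        (e : ∀ v : H.V, X.carrier (H.inDeg v) (H.outDeg v)) (w : H.V)
        (f : X.carrier (G.inDeg v) (G.outDeg v) →ₗ[𝕜] X.carrier (H.inDeg w) (H.outDeg w)),
        ∀ z, F ⟨G, Function.update d v z⟩ = ⟨H, Function.update e w (f z)⟩)
    (h' : ∀ {G H : DecGraph X k l}, G.Iso H → mk (F G) = mk (F H)) :
    IsMultilinear (fun G => mk (F G)) where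
  map_add G _ d v x y := by
    obtain ⟨H, _, e, w, f, hf⟩ := h G d v
    simp only [hf, map_add, mk_add]
  map_smul G _ d v c x := by
    obtain ⟨H, _, e, w, f, hf⟩ := h G d v
    simp only [hf, map_smul, mk_smul]
  map_iso f := h' f

theorem isMultilinear_lact (σ : Equiv.Perm (Fin l)) :
    IsMultilinear (fun G : DecGraph X k l => mk (G.lact σ)) :=
  isMultilinear_of_update _
    (fun G i d v => ⟨G.lact σ, i, d, v, LinearMap.id, fun _ => rfl⟩)
    (fun f => mk_iso ⟨f.toIso.lact σ, f.dec_map⟩)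

theorem isMultilinear_ract (τ : Equiv.Perm (Fin k)) :
    IsMultilinear (fun G : DecGraph X k l => mk (G.ract τ)) :=
  isMultilinear_of_update _
    (fun G i d v => ⟨G.ract τ, i, d, v, LinearMap.id, fun _ => rfl⟩)
    (fun f => mk_iso ⟨f.toIso.ract τ, f.dec_map⟩)

open Classical in
theorem isMultilinear_hcomp_left (G' : DecGraph X k' l') :
    IsMultilinear (fun G : DecGraph X k l => mk (G.hcomp G')) :=
  isMultilinear_of_update _
    (fun G _ d v => by
      refine ⟨G.hcomp G'.graph, instDecidableEqSum, DecGraph.sumDec d G'.dec, .inl v,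
        LinearMap.id, fun z => ?_⟩
      exact congrArg (DecGraph.mk (G.hcomp G'.graph)) (DecGraph.sumDec_update_left d G'.dec v z))
    (fun f => mk_iso ⟨f.toIso.hcomp (PlanarGraph.Iso.refl _), by
      rintro (v | v)
      · exact f.dec_map v
      · rfl⟩)

open Classical in
theorem isMultilinear_hcomp_right (G : DecGraph X k l) :
    IsMultilinear (fun G' : DecGraph X k' l' => mk (G.hcomp G')) :=
  isMultilinear_of_update _
    (fun G' _ d v => by
      refine ⟨G.graph.hcomp G', instDecidableEqSum, DecGraph.sumDec G.dec d, .inr v,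
        LinearMap.id, fun z => ?_⟩
      exact congrArg (DecGraph.mk (G.graph.hcomp G')) (DecGraph.sumDec_update_right G.dec d v z))
    (fun f => mk_iso ⟨(PlanarGraph.Iso.refl _).hcomp f.toIso, by
      rintro (v | v)
      · rfl
      · exact f.dec_map v⟩)

open Classical in
theorem isMultilinear_vcomp_left (G : DecGraph X k l) :
    IsMultilinear (fun G' : DecGraph X l m => mk (G'.vcomp G)) :=
  isMultilinear_of_update _
    (fun G' _ d v => by
      refine ⟨G'.vcomp G.graph, instDecidableEqSum, DecGraph.sumDec G.dec d, .inr v,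
        LinearMap.id, fun z => ?_⟩
      exact congrArg (DecGraph.mk (G'.vcomp G.graph)) (DecGraph.sumDec_update_right G.dec d v z))
    (fun f => mk_iso ⟨f.toIso.vcomp (PlanarGraph.Iso.refl _), by
      rintro (v | v)
      · rfl
      · exact f.dec_map v⟩)

open Classical in
theorem isMultilinear_vcomp_right (G' : DecGraph X l m) :
    IsMultilinear (fun G : DecGraph X k l => mk (G'.vcomp G)) :=
  isMultilinear_of_update _
    (fun G _ d v => by
      refine ⟨G'.graph.vcomp G, instDecidableEqSum, DecGraph.sumDec d G'.dec, .inl v,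
        LinearMap.id, fun z => ?_⟩
      exact congrArg (DecGraph.mk (G'.graph.vcomp G)) (DecGraph.sumDec_update_left d G'.dec v z))
    (fun f => mk_iso ⟨(PlanarGraph.Iso.refl _).vcomp f.toIso, by
      rintro (v | v)
      · exact f.dec_map v
      · rfl⟩)

/-- The bilinear extension of an operation on decorated graphs. -/
noncomputable def lift₂ (op : DecGraph X k l → DecGraph X k' l' → DecGraph X k'' l'')
    (h : ∀ G', IsMultilinear (fun G => mk (op G G')))
    (h' : ∀ G, IsMultilinear (fun G' => mk (op G G'))) :
    PGr X k l →ₗ[𝕜] PGr X k' l' →ₗ[𝕜] PGr X k'' l'' :=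
  lift (fun G => lift (fun G' => mk (op G G')) (h' G))
    { map_add := fun G _ d v x y => linearMap_ext fun G' => by
        simpa using (h G').map_add G d v x y
      map_smul := fun G _ d v c x => linearMap_ext fun G' => by
        simpa using (h G').map_smul G d v c x
      map_iso := fun f => linearMap_ext fun G' => by
        simpa using (h G').map_iso f }

@[simp]
theorem lift₂_mk (op : DecGraph X k l → DecGraph X k' l' → DecGraph X k'' l'')
    (h : ∀ G', IsMultilinear (fun G => mk (op G G')))
    (h' : ∀ G, IsMultilinear (fun G' => mk (op G G'))) (G : DecGraph X k l)
    (G' : DecGraph X k' l') : lift₂ op h h' (mk G) (mk G') = mk (op G G') := by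
  simp [lift₂]

end PGr

namespace PGr

variable {𝕜 : Type*} [Field 𝕜] {X : SymBimodule 𝕜} {k l m k' l' : ℕ}

/-- The left action of `𝔖_l`. -/
noncomputable def lact (σ : Equiv.Perm (Fin l)) : PGr X k l →ₗ[𝕜] PGr X k l :=
  lift _ (isMultilinear_lact σ)

/-- The right action of `𝔖_k`. -/
noncomputable def ract (τ : Equiv.Perm (Fin k)) : PGr X k l →ₗ[𝕜] PGr X k l :=
  lift _ (isMultilinear_ract τ)

/-- Horizontal concatenation. -/
noncomputable def hcomp : PGr X k l →ₗ[𝕜] PGr X k' l' →ₗ[𝕜] PGr X (k + k') (l + l') :=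
  lift₂ DecGraph.hcomp isMultilinear_hcomp_left isMultilinear_hcomp_right

/-- Vertical concatenation. -/
noncomputable def vcomp : PGr X l m →ₗ[𝕜] PGr X k l →ₗ[𝕜] PGr X k m :=
  lift₂ DecGraph.vcomp isMultilinear_vcomp_left isMultilinear_vcomp_right

end PGr

/-- The elements `(σ ·_v G ·_v τ) ⊗ (⨂ x_w) - G ⊗ (⨂_{w ≠ v} x_w ⊗ (σ · x_v · τ))`. -/
inductive PermRel {𝕜 : Type*} [Field 𝕜] (X : SymBimodule 𝕜) (k l : ℕ) : PGr X k l → Prop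
  | intro (G : PlanarGraph k l) [DecidableEq G.V]
      (d : ∀ v : G.V, X.carrier (G.inDeg v) (G.outDeg v)) (v : G.V)
      (σ : Equiv.Perm (Fin (G.outDeg v))) (τ : Equiv.Perm (Fin (G.inDeg v))) :
      PermRel X k l (PGr.mk ⟨G.reorder v σ τ, d⟩
        - PGr.mk ⟨G, Function.update d v (X.lact σ (X.ract τ (d v)))⟩)

/-- The submodule `I(k,l)` of `PGr↻(X)(k,l)` generated by the relations moving permutations through
vertices. These relations are permuted by the actions of `𝔖_k` and `𝔖_l`, so that their linear span
is also the `𝔖_l × 𝔖_k^op`-submodule they generate. -/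
noncomputable def permSubmodule {𝕜 : Type*} [Field 𝕜] (X : SymBimodule 𝕜) (k l : ℕ) :
    Submodule 𝕜 (PGr X k l) :=
  Submodule.span 𝕜 {r | PermRel X k l r}

/-- The subspace `PGr↑(X)(k,l)` of `PGr↻(X)(k,l)` spanned by the decorated planar graphs with no
cycle and no loop. -/
noncomputable def PGrUp {𝕜 : Type*} [Field 𝕜] (X : SymBimodule 𝕜) (k l : ℕ) : Submodule 𝕜 (PGr X k l) :=
  Submodule.span 𝕜 {x | ∃ G : DecGraph X k l, G.graph.IsCycleFree ∧ x = PGr.mk G}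

namespace PGr

variable {𝕜 : Type*} [Field 𝕜] {X : SymBimodule 𝕜} {k l m k' l' : ℕ}

theorem mulSingle_inl {V W : Type} [DecidableEq V] [DecidableEq (V ⊕ W)] {M : V ⊕ W → Type*}
    [∀ i, One (M i)] (v : V) (x : M (.inl v)) (a : V) :
    (Pi.mulSingle (.inl v) x : ∀ i, M i) (.inl a) =
      (Pi.mulSingle v x : ∀ a, M (.inl a)) a := by
  by_cases h : a = v
  · subst h; simp
  · rw [Pi.mulSingle_eq_of_ne h, Pi.mulSingle_eq_of_ne (by simpa using h)]

theorem mulSingle_inr {V W : Type} [DecidableEq W] [DecidableEq (V ⊕ W)] {M : V ⊕ W → Type*}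
    [∀ i, One (M i)] (w : W) (x : M (.inr w)) (a : W) :
    (Pi.mulSingle (.inr w) x : ∀ i, M i) (.inr a) =
      (Pi.mulSingle w x : ∀ a, M (.inr a)) a := by
  by_cases h : a = w
  · subst h; simp
  · rw [Pi.mulSingle_eq_of_ne h, Pi.mulSingle_eq_of_ne (by simpa using h)]

/-- Reordering around a vertex of the first of two sets of vertices. -/
theorem reorder_sum_left {V W S A B : Type} [DecidableEq V] [DecidableEq (V ⊕ W)] {a : V → ℕ} {b : W → ℕ} (s : S ≃ A ⊕ B)
    (e : A ≃ Σ v, Fin (a v)) (e' : B ≃ Σ w, Fin (b w)) (v : V) (σ : Equiv.Perm (Fin (a v))) :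
    s.trans ((Equiv.sumCongr (e.trans (Equiv.sigmaCongrRight
      (Pi.mulSingle (M := fun w => Equiv.Perm (Fin (a w))) v σ))) e').trans
        (Equiv.sumSigmaDistrib (fun w => Fin (Sum.elim a b w))).symm) =
    (s.trans ((Equiv.sumCongr e e').trans
      (Equiv.sumSigmaDistrib (fun w => Fin (Sum.elim a b w))).symm)).trans
      (Equiv.sigmaCongrRight (Pi.mulSingle
        (M := fun w => Equiv.Perm (Fin (Sum.elim a b w))) (.inl v) σ)) := by
  ext1 x
  simp only [Equiv.trans_apply]
  rcases s x with y | y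
  · have := mulSingle_inl (M := fun w => Equiv.Perm (Fin (Sum.elim a b w))) v σ (e y).1
    exact congrArg (fun p : Equiv.Perm (Fin (a (e y).1)) =>
      (⟨.inl (e y).1, p (e y).2⟩ : Σ v, Fin (Sum.elim a b v))) this.symm
  · have : (Pi.mulSingle (M := fun w => Equiv.Perm (Fin (Sum.elim a b w))) (.inl v) σ)
        (.inr (e' y).1) = 1 := Pi.mulSingle_eq_of_ne (by simp) _
    exact congrArg (fun p : Equiv.Perm (Fin (b (e' y).1)) =>
      (⟨.inr (e' y).1, p (e' y).2⟩ : Σ v, Fin (Sum.elim a b v))) this.symm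

/-- Reordering around a vertex of the second of two sets of vertices. -/
theorem reorder_sum_right {V W S A B : Type} [DecidableEq W] [DecidableEq (V ⊕ W)] {a : V → ℕ} {b : W → ℕ} (s : S ≃ A ⊕ B)
    (e : A ≃ Σ v, Fin (a v)) (e' : B ≃ Σ w, Fin (b w)) (w : W) (σ : Equiv.Perm (Fin (b w))) :
    s.trans ((Equiv.sumCongr e (e'.trans (Equiv.sigmaCongrRight
      (Pi.mulSingle (M := fun w => Equiv.Perm (Fin (b w))) w σ)))).trans
        (Equiv.sumSigmaDistrib (fun w => Fin (Sum.elim a b w))).symm) =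
    (s.trans ((Equiv.sumCongr e e').trans
      (Equiv.sumSigmaDistrib (fun w => Fin (Sum.elim a b w))).symm)).trans
      (Equiv.sigmaCongrRight (Pi.mulSingle
        (M := fun w => Equiv.Perm (Fin (Sum.elim a b w))) (.inr w) σ)) := by
  ext1 x
  simp only [Equiv.trans_apply]
  rcases s x with y | y
  · have : (Pi.mulSingle (M := fun w => Equiv.Perm (Fin (Sum.elim a b w))) (.inr w) σ)
        (.inl (e y).1) = 1 := Pi.mulSingle_eq_of_ne (by simp) _
    exact congrArg (fun p : Equiv.Perm (Fin (a (e y).1)) =>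
      (⟨.inl (e y).1, p (e y).2⟩ : Σ v, Fin (Sum.elim a b v))) this.symm
  · have := mulSingle_inr (M := fun w => Equiv.Perm (Fin (Sum.elim a b w))) w σ (e' y).1
    exact congrArg (fun p : Equiv.Perm (Fin (b (e' y).1)) =>
      (⟨.inr (e' y).1, p (e' y).2⟩ : Σ v, Fin (Sum.elim a b v))) this.symm

theorem reorder_hcomp_left (G : PlanarGraph k l)
    (d : ∀ v : G.V, X.carrier (G.inDeg v) (G.outDeg v)) (v : G.V)
    (σ : Equiv.Perm (Fin (G.outDeg v))) (τ : Equiv.Perm (Fin (G.inDeg v)))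
    (G' : DecGraph X k' l') :
    (⟨G.reorder v σ τ, d⟩ : DecGraph X k l).hcomp G' =
      ⟨(G.hcomp G'.graph).reorder (.inl v) σ τ, DecGraph.sumDec d G'.dec⟩ :=
  congrArg₂ (fun s t => (⟨{ G.hcomp G'.graph with src := s, tgt := t }, DecGraph.sumDec d G'.dec⟩ :
    DecGraph X _ _))
    (@reorder_sum_left _ _ _ _ _ (fun a b => Classical.propDecidable (a = b)) (fun a b => Classical.propDecidable (a = b)) _ _ _ _ _ v σ⁻¹)
    (@reorder_sum_left _ _ _ _ _ (fun a b => Classical.propDecidable (a = b)) (fun a b => Classical.propDecidable (a = b)) _ _ _ _ _ v τ)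

theorem reorder_hcomp_right (G : DecGraph X k l) (G' : PlanarGraph k' l')
    (d : ∀ v : G'.V, X.carrier (G'.inDeg v) (G'.outDeg v)) (v : G'.V)
    (σ : Equiv.Perm (Fin (G'.outDeg v))) (τ : Equiv.Perm (Fin (G'.inDeg v))) :
    G.hcomp (⟨G'.reorder v σ τ, d⟩ : DecGraph X k' l') =
      ⟨(G.graph.hcomp G').reorder (.inr v) σ τ, DecGraph.sumDec G.dec d⟩ :=
  congrArg₂ (fun s t => (⟨{ G.graph.hcomp G' with src := s, tgt := t }, DecGraph.sumDec G.dec d⟩ :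
    DecGraph X _ _))
    (@reorder_sum_right _ _ _ _ _ (fun a b => Classical.propDecidable (a = b)) (fun a b => Classical.propDecidable (a = b)) _ _ _ _ _ v σ⁻¹)
    (@reorder_sum_right _ _ _ _ _ (fun a b => Classical.propDecidable (a = b)) (fun a b => Classical.propDecidable (a = b)) _ _ _ _ _ v τ)

theorem reorder_vcomp_left (G' : PlanarGraph l m)
    (d : ∀ v : G'.V, X.carrier (G'.inDeg v) (G'.outDeg v)) (v : G'.V)
    (σ : Equiv.Perm (Fin (G'.outDeg v))) (τ : Equiv.Perm (Fin (G'.inDeg v)))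
    (G : DecGraph X k l) :
    (⟨G'.reorder v σ τ, d⟩ : DecGraph X l m).vcomp G =
      ⟨(G'.vcomp G.graph).reorder (.inr v) σ τ, DecGraph.sumDec G.dec d⟩ :=
  congrArg₂ (fun s t => (⟨{ G'.vcomp G.graph with src := s, tgt := t }, DecGraph.sumDec G.dec d⟩ :
    DecGraph X _ _))
    (@reorder_sum_right _ _ _ _ _ (fun a b => Classical.propDecidable (a = b)) (fun a b => Classical.propDecidable (a = b)) _ _ _ _ _ v σ⁻¹)
    (@reorder_sum_right _ _ _ _ _ (fun a b => Classical.propDecidable (a = b)) (fun a b => Classical.propDecidable (a = b)) _ _ _ _ ((Equiv.sumCongr (Equiv.refl G'.E)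
      (glueRight G.graph.outIdx (fun e : G'.I => G'.inIdx (Sum.inl e)))).trans G'.tgt) v τ)

theorem reorder_vcomp_right (G' : DecGraph X l m) (G : PlanarGraph k l)
    (d : ∀ v : G.V, X.carrier (G.inDeg v) (G.outDeg v)) (v : G.V)
    (σ : Equiv.Perm (Fin (G.outDeg v))) (τ : Equiv.Perm (Fin (G.inDeg v))) :
    G'.vcomp (⟨G.reorder v σ τ, d⟩ : DecGraph X k l) =
      ⟨(G'.graph.vcomp G).reorder (.inl v) σ τ, DecGraph.sumDec d G'.dec⟩ :=
  congrArg₂ (fun s t => (⟨{ G'.graph.vcomp G with src := s, tgt := t }, DecGraph.sumDec d G'.dec⟩ :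
    DecGraph X _ _))
    (@reorder_sum_left _ _ _ _ _ (fun a b => Classical.propDecidable (a = b)) (fun a b => Classical.propDecidable (a = b)) _ _ _ ((Equiv.sumCongr (Equiv.refl G.E)
      (glueLeft (fun f : G.O => G.outIdx (Sum.inl f)) G'.graph.inIdx)).trans G.src) _ v σ⁻¹)
    (@reorder_sum_left _ _ _ _ _ (fun a b => Classical.propDecidable (a = b)) (fun a b => Classical.propDecidable (a = b)) _ _ _ _ _ v τ)

theorem lact_mk (s : Equiv.Perm (Fin l)) (G : DecGraph X k l) : lact s (mk G) = mk (G.lact s) :=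
  lift_mk _ _ _

theorem ract_mk (t : Equiv.Perm (Fin k)) (G : DecGraph X k l) : ract t (mk G) = mk (G.ract t) :=
  lift_mk _ _ _

theorem hcomp_mk (G : DecGraph X k l) (G' : DecGraph X k' l') :
    hcomp (mk G) (mk G') = mk (G.hcomp G') :=
  lift₂_mk _ _ _ _ _

theorem vcomp_mk (G' : DecGraph X l m) (G : DecGraph X k l) :
    vcomp (mk G') (mk G) = mk (G'.vcomp G) :=
  lift₂_mk _ _ _ _ _

theorem reorder_lact (s : Equiv.Perm (Fin l)) (G : PlanarGraph k l) (v : G.V)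
    (σ : Equiv.Perm (Fin (G.outDeg v))) (τ : Equiv.Perm (Fin (G.inDeg v))) :
    (G.reorder v σ τ).lact s = (G.lact s).reorder v σ τ := rfl

theorem reorder_ract (t : Equiv.Perm (Fin k)) (G : PlanarGraph k l) (v : G.V)
    (σ : Equiv.Perm (Fin (G.outDeg v))) (τ : Equiv.Perm (Fin (G.inDeg v))) :
    (G.reorder v σ τ).ract t = (G.ract t).reorder v σ τ := rfl

theorem permRel_lact (s : Equiv.Perm (Fin l)) {r : PGr X k l} (hr : PermRel X k l r) :
    PermRel X k l (lact s r) := by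
  cases hr with
  | @intro G i d v σ τ =>
    have h := @PermRel.intro _ _ X _ _ (G.lact s) i d v σ τ
    rw [map_sub, lact_mk, lact_mk]
    exact h

theorem permRel_ract (t : Equiv.Perm (Fin k)) {r : PGr X k l} (hr : PermRel X k l r) :
    PermRel X k l (ract t r) := by
  cases hr with
  | @intro G i d v σ τ =>
    have h := @PermRel.intro _ _ X _ _ (G.ract t) i d v σ τ
    rw [map_sub, ract_mk, ract_mk]
    exact h

open Classical in
theorem permRel_hcomp_left {r : PGr X k l} (hr : PermRel X k l r) (G' : DecGraph X k' l') :
    PermRel X (k + k') (l + l') (hcomp r (mk G')) := by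
  obtain ⟨G, d, v, σ, τ⟩ := hr
  rw [map_sub, LinearMap.sub_apply, hcomp_mk, hcomp_mk, reorder_hcomp_left]
  simp only [DecGraph.hcomp, DecGraph.sumDec_update_left]
  exact @PermRel.intro _ _ X _ _ (G.hcomp G'.graph) instDecidableEqSum _ (.inl v) σ τ

open Classical in
theorem permRel_hcomp_right (G : DecGraph X k l) {r : PGr X k' l'} (hr : PermRel X k' l' r) :
    PermRel X (k + k') (l + l') (hcomp (mk G) r) := by
  obtain ⟨G', d, v, σ, τ⟩ := hr
  rw [map_sub, hcomp_mk, hcomp_mk, reorder_hcomp_right]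
  simp only [DecGraph.hcomp, DecGraph.sumDec_update_right]
  exact @PermRel.intro _ _ X _ _ (G.graph.hcomp G') instDecidableEqSum _ (.inr v) σ τ

open Classical in
theorem permRel_vcomp_left {r : PGr X l m} (hr : PermRel X l m r) (G : DecGraph X k l) :
    PermRel X k m (vcomp r (mk G)) := by
  obtain ⟨G', d, v, σ, τ⟩ := hr
  rw [map_sub, LinearMap.sub_apply, vcomp_mk, vcomp_mk, reorder_vcomp_left]
  simp only [DecGraph.vcomp, DecGraph.sumDec_update_right]
  exact @PermRel.intro _ _ X _ _ (G'.vcomp G.graph) instDecidableEqSum _ (.inr v) σ τ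

open Classical in
theorem permRel_vcomp_right (G' : DecGraph X l m) {r : PGr X k l} (hr : PermRel X k l r) :
    PermRel X k m (vcomp (mk G') r) := by
  obtain ⟨G, d, v, σ, τ⟩ := hr
  rw [map_sub, vcomp_mk, vcomp_mk, reorder_vcomp_right]
  simp only [DecGraph.vcomp, DecGraph.sumDec_update_left]
  exact @PermRel.intro _ _ X _ _ (G'.graph.vcomp G) instDecidableEqSum _ (.inl v) σ τ

/-- A linear map sending generators to generators preserves the submodules of permutations. -/
theorem map_mem_permSubmodule {f : PGr X k l →ₗ[𝕜] PGr X k' l'}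
    (hf : ∀ r, PermRel X k l r → f r ∈ permSubmodule X k' l') {r : PGr X k l}
    (hr : r ∈ permSubmodule X k l) : f r ∈ permSubmodule X k' l' :=
  (Submodule.span_le (p := (permSubmodule X k' l').comap f)).2 hf hr

theorem hcomp_mem_left {r : PGr X k l} (hr : r ∈ permSubmodule X k l) (x : PGr X k' l') :
    hcomp r x ∈ permSubmodule X (k + k') (l + l') := by
  induction x using induction_mk with
  | h0 => simp
  | hadd x y hx hy => simpa using add_mem hx hy
  | hmk c G' =>
    rw [map_smul]
    exact Submodule.smul_mem _ _ (map_mem_permSubmodule (f := hcomp.flip (mk G'))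
      (fun r hr => Submodule.subset_span (permRel_hcomp_left hr G')) hr)

theorem hcomp_mem_right (x : PGr X k l) {r : PGr X k' l'} (hr : r ∈ permSubmodule X k' l') :
    hcomp x r ∈ permSubmodule X (k + k') (l + l') := by
  induction x using induction_mk with
  | h0 => simp
  | hadd x y hx hy => simpa using add_mem hx hy
  | hmk c G =>
    rw [map_smul]
    exact Submodule.smul_mem _ _ (map_mem_permSubmodule (f := hcomp (mk G))
      (fun r hr => Submodule.subset_span (permRel_hcomp_right G hr)) hr)

theorem vcomp_mem_left {r : PGr X l m} (hr : r ∈ permSubmodule X l m) (x : PGr X k l) :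
    vcomp r x ∈ permSubmodule X k m := by
  induction x using induction_mk with
  | h0 => simp
  | hadd x y hx hy => simpa using add_mem hx hy
  | hmk c G =>
    rw [map_smul]
    exact Submodule.smul_mem _ _ (map_mem_permSubmodule (f := vcomp.flip (mk G))
      (fun r hr => Submodule.subset_span (permRel_vcomp_left hr G)) hr)

theorem vcomp_mem_right (x : PGr X l m) {r : PGr X k l} (hr : r ∈ permSubmodule X k l) :
    vcomp x r ∈ permSubmodule X k m := by
  induction x using induction_mk with
  | h0 => simp
  | hadd x y hx hy => simpa using add_mem hx hy
  | hmk c G' =>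
    rw [map_smul]
    exact Submodule.smul_mem _ _ (map_mem_permSubmodule (f := vcomp (mk G'))
      (fun r hr => Submodule.subset_span (permRel_vcomp_right G' hr)) hr)

theorem mk_mem_up {G : DecGraph X k l} (hG : G.graph.IsCycleFree) : mk G ∈ PGrUp X k l :=
  Submodule.subset_span ⟨G, hG, rfl⟩

theorem lact_mem_up (σ : Equiv.Perm (Fin l)) {x : PGr X k l} (hx : x ∈ PGrUp X k l) :
    lact σ x ∈ PGrUp X k l := by
  refine (Submodule.span_le (p := (PGrUp X k l).comap (lact σ))).2 ?_ hx
  rintro _ ⟨G, hG, rfl⟩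
  simpa [lact_mk] using mk_mem_up (G := G.lact σ) (PlanarGraph.isCycleFree_lact hG σ)

theorem ract_mem_up (τ : Equiv.Perm (Fin k)) {x : PGr X k l} (hx : x ∈ PGrUp X k l) :
    ract τ x ∈ PGrUp X k l := by
  refine (Submodule.span_le (p := (PGrUp X k l).comap (ract τ))).2 ?_ hx
  rintro _ ⟨G, hG, rfl⟩
  simpa [ract_mk] using mk_mem_up (G := G.ract τ) (PlanarGraph.isCycleFree_ract hG τ)

theorem hcomp_mem_up {x : PGr X k l} (hx : x ∈ PGrUp X k l) {y : PGr X k' l'}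
    (hy : y ∈ PGrUp X k' l') : hcomp x y ∈ PGrUp X (k + k') (l + l') := by
  refine (Submodule.span_le (p := (PGrUp X (k + k') (l + l')).comap (hcomp.flip y))).2 ?_ hx
  rintro _ ⟨G, hG, rfl⟩
  refine (Submodule.span_le (p := (PGrUp X (k + k') (l + l')).comap (hcomp (mk G)))).2 ?_ hy
  rintro _ ⟨G', hG', rfl⟩
  simpa [hcomp] using mk_mem_up (G := G.hcomp G') (PlanarGraph.isCycleFree_hcomp hG hG')

theorem vcomp_mem_up {x : PGr X l m} (hx : x ∈ PGrUp X l m) {y : PGr X k l}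
    (hy : y ∈ PGrUp X k l) : vcomp x y ∈ PGrUp X k m := by
  refine (Submodule.span_le (p := (PGrUp X k m).comap (vcomp.flip y))).2 ?_ hx
  rintro _ ⟨G, hG, rfl⟩
  refine (Submodule.span_le (p := (PGrUp X k m).comap (vcomp (mk G)))).2 ?_ hy
  rintro _ ⟨G', hG', rfl⟩
  simpa [vcomp] using mk_mem_up (G := G.vcomp G') (PlanarGraph.isCycleFree_vcomp hG hG')

theorem lact_one (x : PGr X k l) : lact 1 x = x :=
  DFunLike.congr_fun (linearMap_ext (f := lact 1) (g := LinearMap.id)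
    fun G => by simp [lact]; rfl) x

theorem ract_one (x : PGr X k l) : ract 1 x = x :=
  DFunLike.congr_fun (linearMap_ext (f := ract 1) (g := LinearMap.id)
    fun G => by simp [ract]; rfl) x

theorem lact_mul (σ σ' : Equiv.Perm (Fin l)) (x : PGr X k l) :
    lact σ (lact σ' x) = lact (σ * σ') x :=
  DFunLike.congr_fun (linearMap_ext (f := (lact σ).comp (lact σ')) (g := lact (σ * σ'))
    fun G => by simp [lact]; rfl) x

theorem ract_mul (τ τ' : Equiv.Perm (Fin k)) (x : PGr X k l) :
    ract τ' (ract τ x) = ract (τ * τ') x :=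
  DFunLike.congr_fun (linearMap_ext (f := (ract τ').comp (ract τ)) (g := ract (τ * τ'))
    fun G => by simp [ract]; rfl) x

theorem lact_ract (σ : Equiv.Perm (Fin l)) (τ : Equiv.Perm (Fin k)) (x : PGr X k l) :
    lact σ (ract τ x) = ract τ (lact σ x) :=
  DFunLike.congr_fun (linearMap_ext (f := (lact σ).comp (ract τ)) (g := (ract τ).comp (lact σ))
    fun G => by simp [lact, ract]; rfl) x

end PGr

/-! ## The ProP `Γ↑(X)` -/

/-- `Γ↑(X)(k,l) = PGr↑(X)(k,l) / (I(k,l) ∩ PGr↑(X)(k,l))`. -/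
abbrev GammaUpSpace {𝕜 : Type*} [Field 𝕜] (X : SymBimodule 𝕜) (k l : ℕ) : Type _ :=
  PGrUp X k l ⧸ (permSubmodule X k l).submoduleOf (PGrUp X k l)

/-- The linear map induced on subquotients by a linear map. -/
def subquotMap {𝕜 A B : Type*} [Field 𝕜] [AddCommGroup A] [Module 𝕜 A] [AddCommGroup B] [Module 𝕜 B]
    (S R : Submodule 𝕜 A) (S' R' : Submodule 𝕜 B) (f : A →ₗ[𝕜] B)
    (hS : ∀ x ∈ S, f x ∈ S') (hR : ∀ x ∈ R, f x ∈ R') :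
    (S ⧸ R.submoduleOf S) →ₗ[𝕜] (S' ⧸ R'.submoduleOf S') :=
  Submodule.mapQ _ _ (f.restrict hS) (fun _ hx => hR _ hx)

/-- The bilinear map induced on subquotients by a bilinear map. -/
def subquotMap₂ {𝕜 A B C : Type*} [Field 𝕜] [AddCommGroup A] [Module 𝕜 A] [AddCommGroup B]
    [Module 𝕜 B] [AddCommGroup C] [Module 𝕜 C] (S R : Submodule 𝕜 A) (S' R' : Submodule 𝕜 B)
    (S'' R'' : Submodule 𝕜 C) (f : A →ₗ[𝕜] B →ₗ[𝕜] C)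
    (hS : ∀ x ∈ S, ∀ y ∈ S', f x y ∈ S'') (hR : ∀ x ∈ R, ∀ y, f x y ∈ R'')
    (hR' : ∀ x, ∀ y ∈ R', f x y ∈ R'') :
    (S ⧸ R.submoduleOf S) →ₗ[𝕜] (S' ⧸ R'.submoduleOf S') →ₗ[𝕜] (S'' ⧸ R''.submoduleOf S'') :=
  Submodule.liftQ _
    { toFun := fun x => subquotMap S' R' S'' R'' (f x.1) (hS x.1 x.2) (hR' x.1)
      map_add' := fun x x' => Submodule.linearMap_qext _ <| LinearMap.ext fun y =>
        congrArg (Submodule.Quotient.mk (p := R''.submoduleOf S''))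
          (Subtype.ext (by simp [LinearMap.restrict_apply]))
      map_smul' := fun c x => Submodule.linearMap_qext _ <| LinearMap.ext fun y =>
        congrArg (Submodule.Quotient.mk (p := R''.submoduleOf S''))
          (Subtype.ext (by simp [LinearMap.restrict_apply])) }
    (fun x hx => Submodule.linearMap_qext _ <| LinearMap.ext fun y =>
      (Submodule.Quotient.mk_eq_zero _).2 (hR x hx y))

namespace GammaUpSpace

variable {𝕜 : Type*} [Field 𝕜] {X : SymBimodule 𝕜} {k l m k' l' : ℕ}

/-- The class in `Γ↑(X)` of a decorated planar graph with no cycle and no loop. -/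
noncomputable def mk (G : DecGraph X k l) (hG : G.graph.IsCycleFree) : GammaUpSpace X k l :=
  Submodule.Quotient.mk ⟨PGr.mk G, PGr.mk_mem_up hG⟩

/-- The left action of `𝔖_l`. -/
noncomputable def lact (σ : Equiv.Perm (Fin l)) : GammaUpSpace X k l →ₗ[𝕜] GammaUpSpace X k l :=
  subquotMap _ _ _ _ (PGr.lact σ) (fun _ => PGr.lact_mem_up σ)
    (fun _ => PGr.map_mem_permSubmodule fun _ hr => Submodule.subset_span (PGr.permRel_lact σ hr))

/-- The right action of `𝔖_k`. -/
noncomputable def ract (τ : Equiv.Perm (Fin k)) : GammaUpSpace X k l →ₗ[𝕜] GammaUpSpace X k l :=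
  subquotMap _ _ _ _ (PGr.ract τ) (fun _ => PGr.ract_mem_up τ)
    (fun _ => PGr.map_mem_permSubmodule fun _ hr => Submodule.subset_span (PGr.permRel_ract τ hr))

/-- Horizontal concatenation. -/
noncomputable def hcomp :
    GammaUpSpace X k l →ₗ[𝕜] GammaUpSpace X k' l' →ₗ[𝕜] GammaUpSpace X (k + k') (l + l') :=
  subquotMap₂ _ _ _ _ _ _ PGr.hcomp (fun _ hx _ hy => PGr.hcomp_mem_up hx hy)
    (fun _ hr x => PGr.hcomp_mem_left hr x) (fun x _ hr => PGr.hcomp_mem_right x hr)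

/-- Vertical concatenation. -/
noncomputable def vcomp :
    GammaUpSpace X l m →ₗ[𝕜] GammaUpSpace X k l →ₗ[𝕜] GammaUpSpace X k m :=
  subquotMap₂ _ _ _ _ _ _ PGr.vcomp (fun _ hx _ hy => PGr.vcomp_mem_up hx hy)
    (fun _ hr x => PGr.vcomp_mem_left hr x) (fun x _ hr => PGr.vcomp_mem_right x hr)

theorem mk_eq_mk {G H : DecGraph X k l} {hG : G.graph.IsCycleFree} {hH : H.graph.IsCycleFree}
    (h : PGr.mk G = PGr.mk H) : mk G hG = mk H hH :=
  congrArg Submodule.Quotient.mk (Subtype.ext h)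

theorem lact_mk (σ : Equiv.Perm (Fin l)) (G : DecGraph X k l) (hG : G.graph.IsCycleFree) :
    lact σ (mk G hG) = mk (G.lact σ) hG :=
  congrArg Submodule.Quotient.mk (Subtype.ext (PGr.lact_mk σ G))

theorem ract_mk (τ : Equiv.Perm (Fin k)) (G : DecGraph X k l) (hG : G.graph.IsCycleFree) :
    ract τ (mk G hG) = mk (G.ract τ) hG :=
  congrArg Submodule.Quotient.mk (Subtype.ext (PGr.ract_mk τ G))

end GammaUpSpace

/-- `Γ↑(X)`: its actions, its two concatenations, and its units, which are the empty graph and the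
graph with a single input-output edge. -/
noncomputable def GammaUp {𝕜 : Type u} [Field 𝕜] (X : SymBimodule.{u, v} 𝕜) :
    PreProP.{u, max 1 u v} 𝕜 where
  carrier := GammaUpSpace X
  addCommGroup := fun k l => inferInstanceAs (AddCommGroup (GammaUpSpace X k l))
  module := fun k l => inferInstanceAs (Module 𝕜 (GammaUpSpace X k l))
  lact := GammaUpSpace.lact
  ract := GammaUpSpace.ract
  lact_one x := by
    obtain ⟨x, rfl⟩ := Submodule.Quotient.mk_surjective _ x
    exact congrArg Submodule.Quotient.mk (Subtype.ext (PGr.lact_one _))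
  ract_one x := by
    obtain ⟨x, rfl⟩ := Submodule.Quotient.mk_surjective _ x
    exact congrArg Submodule.Quotient.mk (Subtype.ext (PGr.ract_one _))
  lact_mul σ σ' x := by
    obtain ⟨x, rfl⟩ := Submodule.Quotient.mk_surjective _ x
    exact congrArg Submodule.Quotient.mk (Subtype.ext (PGr.lact_mul _ _ _))
  ract_mul τ τ' x := by
    obtain ⟨x, rfl⟩ := Submodule.Quotient.mk_surjective _ x
    exact congrArg Submodule.Quotient.mk (Subtype.ext (PGr.ract_mul _ _ _))
  lact_ract σ τ x := by
    obtain ⟨x, rfl⟩ := Submodule.Quotient.mk_surjective _ x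
    exact congrArg Submodule.Quotient.mk (Subtype.ext (PGr.lact_ract _ _ _))
  hcomp := GammaUpSpace.hcomp
  vcomp := GammaUpSpace.vcomp
  unit0 := GammaUpSpace.mk ⟨PlanarGraph.unit0, fun v => Empty.elim v⟩
    (PlanarGraph.isCycleFree_of_isEmpty_E (inferInstanceAs (IsEmpty Empty))
      (inferInstanceAs (IsEmpty Empty)))
  unit1 := GammaUpSpace.mk ⟨PlanarGraph.unit1, fun v => Empty.elim v⟩
    (PlanarGraph.isCycleFree_of_isEmpty_E (inferInstanceAs (IsEmpty Empty))
      (inferInstanceAs (IsEmpty Empty)))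

namespace PlanarGraph

theorem isCycleFree_corolla (k l : ℕ) : (corolla k l).IsCycleFree :=
  isCycleFree_of_isEmpty_E (inferInstanceAs (IsEmpty Empty)) (inferInstanceAs (IsEmpty Empty))

theorem mulSingle_unit [DecidableEq Unit] {n : ℕ} (σ : Equiv.Perm (Fin n)) (x : Fin n) :
    (⟨(), (Pi.mulSingle () σ : Unit → Equiv.Perm (Fin n)) () x⟩ : Σ _ : Unit, Fin n) =
      ⟨(), σ x⟩ := by
  rw [Pi.mulSingle_eq_same]

/-- Permuting the positions around the vertex of a corolla is the same as permuting the outputs. -/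
noncomputable def corollaIsoLact (k l : ℕ) (σ : Equiv.Perm (Fin l)) :
    Iso ((corolla k l).reorder () σ 1) ((corolla k l).lact σ) where
  fV := Equiv.refl Unit
  fE := Equiv.refl Empty
  fI := Equiv.refl (Fin k)
  fO := (σ⁻¹ : Equiv.Perm (Fin l))
  fInOut := Equiv.refl Empty
  fL := Equiv.refl Empty
  inDeg_eq _ := rfl
  outDeg_eq _ := rfl
  src_map := by
    rintro (x | x)
    · exact Empty.elim x
    · exact (@mulSingle_unit (fun a b => Classical.propDecidable (a = b)) l σ⁻¹ x).symm
  tgt_map := by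
    rintro (x | x)
    · exact Empty.elim x
    · exact (@mulSingle_unit (fun a b => Classical.propDecidable (a = b)) k 1 x).symm
  inIdx_map := by
    rintro (x | x)
    · rfl
    · exact Empty.elim x
  outIdx_map := by
    rintro (x | x)
    · exact σ.apply_symm_apply x
    · exact Empty.elim x

/-- Permuting the positions around the vertex of a corolla is the same as permuting the inputs. -/
noncomputable def corollaIsoRact (k l : ℕ) (τ : Equiv.Perm (Fin k)) :
    Iso ((corolla k l).reorder () 1 τ) ((corolla k l).ract τ) where
  fV := Equiv.refl Unit
  fE := Equiv.refl Empty
  fI := (τ : Equiv.Perm (Fin k))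
  fO := Equiv.refl (Fin l)
  fInOut := Equiv.refl Empty
  fL := Equiv.refl Empty
  inDeg_eq _ := rfl
  outDeg_eq _ := rfl
  src_map := by
    rintro (x | x)
    · exact Empty.elim x
    · exact ((congrArg (fun p => (⟨(), p⟩ : Σ _ : Unit, Fin l)) (congrFun (congrArg DFunLike.coe
        (inv_one (G := Equiv.Perm (Fin l)))) x)).symm.trans
        (@mulSingle_unit (fun a b => Classical.propDecidable (a = b)) l 1⁻¹ x).symm)
  tgt_map := by
    rintro (x | x)
    · exact Empty.elim x
    · exact (@mulSingle_unit (fun a b => Classical.propDecidable (a = b)) k τ x).symm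
  inIdx_map := by
    rintro (x | x)
    · exact τ.symm_apply_apply x
    · exact Empty.elim x
  outIdx_map := by
    rintro (x | x)
    · rfl
    · exact Empty.elim x

end PlanarGraph

namespace GammaUpSpace

variable {𝕜 : Type*} [Field 𝕜] {X : SymBimodule 𝕜} {k l : ℕ}

/-- The class of the corolla decorated by `x`. -/
noncomputable def corolla (x : X.carrier k l) : GammaUpSpace X k l :=
  mk ⟨PlanarGraph.corolla k l, fun _ => x⟩ (PlanarGraph.isCycleFree_corolla k l)

theorem update_corolla [DecidableEq (PlanarGraph.corolla k l).V] (x z : X.carrier k l) :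
    (⟨PlanarGraph.corolla k l, Function.update
      (β := fun v => X.carrier ((PlanarGraph.corolla k l).inDeg v)
        ((PlanarGraph.corolla k l).outDeg v)) (fun _ => x) () z⟩ : DecGraph X k l) =
      ⟨PlanarGraph.corolla k l, fun _ => z⟩ :=
  congrArg (DecGraph.mk (PlanarGraph.corolla k l)) (funext fun _ => Function.update_self _ _ _)

theorem corolla_add (x y : X.carrier k l) : corolla (x + y) = corolla x + corolla y := by
  have h := @PGr.mk_add _ _ X _ _ (PlanarGraph.corolla k l) (inferInstanceAs (DecidableEq Unit))
    (fun _ => x) () x y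
  have e := @update_corolla _ _ X k l (inferInstanceAs (DecidableEq Unit)) x
  exact congrArg Submodule.Quotient.mk (Subtype.ext ((congrArg PGr.mk (e _)).symm.trans
    (h.trans (congrArg₂ (· + ·) (congrArg PGr.mk (e x)) (congrArg PGr.mk (e y))))))

theorem corolla_smul (c : 𝕜) (x : X.carrier k l) : corolla (c • x) = c • corolla x := by
  have h := @PGr.mk_smul _ _ X _ _ (PlanarGraph.corolla k l) (inferInstanceAs (DecidableEq Unit))
    (fun _ => x) () c x
  have e := @update_corolla _ _ X k l (inferInstanceAs (DecidableEq Unit)) x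
  exact congrArg Submodule.Quotient.mk (Subtype.ext ((congrArg PGr.mk (e _)).symm.trans
    (h.trans (congrArg (c • ·) (congrArg PGr.mk (e x))))))

/-- The relation moving permutations through the vertex of a corolla. -/
theorem corolla_perm (σ : Equiv.Perm (Fin l)) (τ : Equiv.Perm (Fin k)) (x : X.carrier k l)
    (h : ((PlanarGraph.corolla k l).reorder () σ τ).IsCycleFree) :
    mk ⟨(PlanarGraph.corolla k l).reorder () σ τ, fun _ => x⟩ h =
      corolla (X.lact σ (X.ract τ x)) := by
  have h := @PermRel.intro _ _ X _ _ (PlanarGraph.corolla k l) (inferInstanceAs (DecidableEq Unit))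
    (fun _ => x) () σ τ
  have e := @update_corolla _ _ X k l (inferInstanceAs (DecidableEq Unit)) x
  exact (Submodule.Quotient.eq _).2 (Submodule.subset_span
    ((congrArg (fun G => PermRel X k l (PGr.mk _ - PGr.mk G)) (e _)).mp h))

theorem corolla_lact (σ : Equiv.Perm (Fin l)) (x : X.carrier k l) :
    corolla (X.lact σ x) = lact σ (corolla x) := by
  have h := corolla_perm σ 1 x (PlanarGraph.isCycleFree_corolla k l)
  rw [X.ract_one] at h
  rw [← h, corolla, lact_mk]
  exact mk_eq_mk (PGr.mk_iso ⟨PlanarGraph.corollaIsoLact k l σ, fun _ => rfl⟩)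

theorem corolla_ract (τ : Equiv.Perm (Fin k)) (x : X.carrier k l) :
    corolla (X.ract τ x) = ract τ (corolla x) := by
  have h := corolla_perm 1 τ x (PlanarGraph.isCycleFree_corolla k l)
  rw [X.lact_one] at h
  rw [← h, corolla, ract_mk]
  exact mk_eq_mk (PGr.mk_iso ⟨PlanarGraph.corollaIsoRact k l τ, fun _ => rfl⟩)

end GammaUpSpace

/-- The map `X → Γ↑(X)` sending `x ∈ X(k,l)` to the graph with one vertex, `k` inputs and `l` outputs,
whose vertex is decorated by `x`. -/
noncomputable def iota {𝕜 : Type*} [Field 𝕜] (X : SymBimodule 𝕜) :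
    X.Hom (GammaUp X).toSymBimodule where
  map _ _ :=
    { toFun := GammaUpSpace.corolla
      map_add' := GammaUpSpace.corolla_add
      map_smul' := GammaUpSpace.corolla_smul }
  map_lact := GammaUpSpace.corolla_lact
  map_ract := GammaUpSpace.corolla_ract

/-! A cycle-free graph decorated by elements of a ProP `P` has a value in `P`: take its vertices in
an order compatible with the edges, start from the identity on the global inputs, and for each
vertex compose with its decoration tensored with the identity of the edges which it does not
consume. The theorem rests on the existence of this value and its independence of the order.
Existence is `Reach.exists_of_isInitial`: by acyclicity, a nonempty set of vertices closed under
predecessors contains a vertex with no successor in it, which can be applied last. Independence is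
`Reach.unique`, a diamond argument by induction on the number of vertices applied: two different
last vertices consume disjoint sets of edges, so they can be applied in either order to a common
smaller state, and the two orders agree by the interchange law in the form `comp_tensor_comm`.

To avoid renumbering edges at every stage, elements of a ProP are labelled by arbitrary finite sets
(`Comp`, `label`, `relabel`). Transports and block permutations then turn into the canonical
bijections between disjoint unions. A graph is encoded by the bijection `origin` from the ends of
its edges to their beginnings; by `exists_iso_of_origin` this bijection determines the graph up to
isomorphism, given the vertices and the loops. The ProP laws for graphs are thus verified by tracing
edges backwards. They hold for all graphs, with or without cycles, and pass to the subquotient.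

The evaluation respects concatenations because one wiring can be evaluated inside another
(`Reach.map`). It is linear in each decoration because every vertex is applied exactly once
(`Reach.exists_linear`), and it is compatible with permutations around vertices because `φ` is
equivariant. One point is delicate: an element of `I ∩ PGr↑` may be a combination of relations
involving graphs with cycles. The evaluation is therefore extended by `0` to those graphs. It then
kills all of `I`, since reordering the edges at a vertex does not affect cycles.

For the uniqueness of the morphism, the value of `G` in `Γ↑(X)` itself, with respect to `ι`, is the
class of `G` (`isValue_mk`): the partial results are the classes of initial subgraphs of `G`. A
morphism of ProPs sends values to values, so its effect on the class of `G` is determined by its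
restriction along `ι`.

For the injectivity of `ι`, the function `corollaValue` reads off the decoration of a corolla, up to
permutations, and vanishes on the other graphs; its linear extension is a left inverse of `ι`. -/

/-! ## Relabelling the inputs and outputs along bijections -/

namespace SymBimodule

variable {𝕜 : Type*} [Field 𝕜] {k l k' l' k'' l'' : ℕ}

/-- The action of pairs of bijections, `e` on the inputs and `f` on the outputs; it extends the
actions of the symmetric groups and the transport along equalities of indices. -/
def gact (Y : SymBimodule 𝕜) (e : Fin k ≃ Fin k') (f : Fin l ≃ Fin l') :
    Y.carrier k l →ₗ[𝕜] Y.carrier k' l' := by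
  -- A bijection between `Fin k` and `Fin k'` forces `k = k'`, so that `e` and `f` become
  -- permutations.
  have hk : k = k' := Fin.equiv_iff_eq.1 ⟨e⟩
  have hl : l = l' := Fin.equiv_iff_eq.1 ⟨f⟩
  subst hk hl
  -- The inverse turns the right action into a left one, which makes `gact` covariant in both
  -- bijections.
  exact (Y.ract (e⁻¹ : Equiv.Perm (Fin k))).comp (Y.lact f)

variable (Y : SymBimodule 𝕜)

/-- The equalities used in `gact` are here of the form `k = k`, and the transport along them reduces
by proof irrelevance. -/
theorem gact_perm (e : Equiv.Perm (Fin k)) (f : Equiv.Perm (Fin l)) (x : Y.carrier k l) :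
    Y.gact e f x = Y.ract e⁻¹ (Y.lact f x) := rfl

@[simp]
theorem gact_refl (x : Y.carrier k l) : Y.gact (Equiv.refl _) (Equiv.refl _) x = x := by
  have h : Y.gact (1 : Equiv.Perm (Fin k)) (1 : Equiv.Perm (Fin l)) x = x := by
    rw [gact_perm, inv_one, Y.ract_one, Y.lact_one]
  exact h

@[simp]
theorem gact_gact (e : Fin k ≃ Fin k') (f : Fin l ≃ Fin l') (e' : Fin k' ≃ Fin k'')
    (f' : Fin l' ≃ Fin l'') (x : Y.carrier k l) :
    Y.gact e' f' (Y.gact e f x) = Y.gact (e.trans e') (f.trans f') x := by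
  obtain rfl : k = k' := Fin.equiv_iff_eq.1 ⟨e⟩
  obtain rfl : l = l' := Fin.equiv_iff_eq.1 ⟨f⟩
  obtain rfl : k = k'' := Fin.equiv_iff_eq.1 ⟨e'⟩
  obtain rfl : l = l'' := Fin.equiv_iff_eq.1 ⟨f'⟩
  have h : Y.gact e' f' (Y.gact e f x) = Y.gact (e' * e : Equiv.Perm (Fin k))
      (f' * f : Equiv.Perm (Fin l)) x := by
    simp only [gact_perm, Y.lact_ract, Y.lact_mul, Y.ract_mul, mul_inv_rev]
  exact h

theorem gact_eq_self {e : Fin k ≃ Fin k} {f : Fin l ≃ Fin l} (he : ∀ i, e i = i)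
    (hf : ∀ i, f i = i) (x : Y.carrier k l) : Y.gact e f x = x := by
  obtain rfl : e = Equiv.refl _ := Equiv.ext he
  obtain rfl : f = Equiv.refl _ := Equiv.ext hf
  exact Y.gact_refl x

/-- Transports and both actions become instances of a single operation, whose composites are
computed by `gact_gact`. -/
theorem castIdx_eq_gact (hk : k = k') (hl : l = l') (x : Y.carrier k l) :
    Y.castIdx hk hl x = Y.gact (finCongr hk) (finCongr hl) x := by
  subst hk hl
  exact (Y.gact_refl x).symm

theorem lact_eq_gact (f : Equiv.Perm (Fin l)) (x : Y.carrier k l) :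
    Y.lact f x = Y.gact (Equiv.refl _) f x := by
  have h : Y.gact (1 : Equiv.Perm (Fin k)) f x = Y.lact f x := by
    rw [gact_perm, inv_one, Y.ract_one]
  exact h.symm

theorem ract_eq_gact (e : Equiv.Perm (Fin k)) (x : Y.carrier k l) :
    Y.ract e x = Y.gact e.symm (Equiv.refl _) x := by
  have h : Y.gact (e⁻¹ : Equiv.Perm (Fin k)) (1 : Equiv.Perm (Fin l)) x = Y.ract e x := by
    rw [gact_perm, inv_inv, Y.lact_one]
  exact h.symm

theorem Hom.map_gact {Y Z : SymBimodule 𝕜} (φ : Hom Y Z) (e : Fin k ≃ Fin k') (f : Fin l ≃ Fin l')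
    (x : Y.carrier k l) : φ.map k' l' (Y.gact e f x) = Z.gact e f (φ.map k l x) := by
  obtain rfl : k = k' := Fin.equiv_iff_eq.1 ⟨e⟩
  obtain rfl : l = l' := Fin.equiv_iff_eq.1 ⟨f⟩
  rw [gact_perm, gact_perm, φ.map_ract, φ.map_lact]

/-- The component of a module attached to finite sets of inputs and of outputs. -/
abbrev Comp (A B : Type) : Type _ := Y.carrier (Nat.card A) (Nat.card B)

variable {A B C A' B' C' A'' B'' : Type} [Finite A] [Finite B] [Finite C] [Finite A'] [Finite B']
  [Finite C'] [Finite A''] [Finite B'']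

/-- Labelling the inputs and the outputs of an element by finite sets. -/
noncomputable def label (a : Fin k ≃ A) (b : Fin l ≃ B) : Y.carrier k l →ₗ[𝕜] Y.Comp A B :=
  Y.gact (a.trans (Finite.equivFin A)) (b.trans (Finite.equivFin B))

/-- Changing the labels of the inputs and of the outputs. -/
noncomputable def relabel (a : A ≃ A') (b : B ≃ B') : Y.Comp A B →ₗ[𝕜] Y.Comp A' B' :=
  Y.label ((Finite.equivFin A).symm.trans a) ((Finite.equivFin B).symm.trans b)

variable {Y}

-- The enumerations chosen by `Finite.equivFin` cancel, so nothing depends on them.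
@[simp]
theorem relabel_label (a : Fin k ≃ A) (b : Fin l ≃ B) (a' : A ≃ A') (b' : B ≃ B')
    (x : Y.carrier k l) :
    Y.relabel a' b' (Y.label a b x) = Y.label (a.trans a') (b.trans b') x := by
  simp only [relabel, label, gact_gact]
  congr 2 <;> (ext; simp)

@[simp]
theorem label_gact (e : Fin k ≃ Fin k') (f : Fin l ≃ Fin l') (a : Fin k' ≃ A) (b : Fin l' ≃ B)
    (x : Y.carrier k l) : Y.label a b (Y.gact e f x) = Y.label (e.trans a) (f.trans b) x := by
  simp only [label, gact_gact]
  rfl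

/-- Identities in `Comp` can therefore be checked on labelled elements, for which `relabel`,
`tensor` and `comp` are computed from the labels. -/
theorem exists_label (x : Y.Comp A B) : ∃ y : Y.carrier (Nat.card A) (Nat.card B),
    Y.label (Finite.equivFin A).symm (Finite.equivFin B).symm y = x :=
  ⟨x, by simp [label]⟩

theorem label_injective (a : Fin k ≃ A) (b : Fin l ≃ B) : Function.Injective (Y.label a b) := by
  refine Function.LeftInverse.injective (g := Y.gact (a.trans (Finite.equivFin A)).symm
    (b.trans (Finite.equivFin B)).symm) fun x => ?_
  rw [label, gact_gact]
  exact Y.gact_eq_self (by simp) (by simp) x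

/-- Elements can be labelled by given bijections. -/
theorem label_surjective (a : Fin k ≃ A) (b : Fin l ≃ B) : Function.Surjective (Y.label a b) := by
  refine Function.RightInverse.surjective (g := Y.gact (a.trans (Finite.equivFin A)).symm
    (b.trans (Finite.equivFin B)).symm) fun x => ?_
  rw [label, gact_gact]
  exact Y.gact_eq_self (by simp) (by simp) x

@[simp]
theorem relabel_relabel (a : A ≃ A') (b : B ≃ B') (a' : A' ≃ A'') (b' : B' ≃ B'')
    (x : Y.Comp A B) :
    Y.relabel a' b' (Y.relabel a b x) = Y.relabel (a.trans a') (b.trans b') x := by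
  obtain ⟨x, rfl⟩ := exists_label x
  simp [Equiv.trans_assoc]

@[simp]
theorem relabel_refl (x : Y.Comp A B) : Y.relabel (Equiv.refl A) (Equiv.refl B) x = x := by
  obtain ⟨x, rfl⟩ := exists_label x
  simp

end SymBimodule

/-! ### Calculus of operations labelled by finite sets -/

namespace ProP

open SymBimodule

variable {𝕜 : Type*} [Field 𝕜] {k l m k' l' k₁ l₁ m₁ k₁' l₁' k'' l'' : ℕ} (P : ProP 𝕜)

/-- The bijection between `[m + n]` and a disjoint union given by two bijections. -/
def sumLabel {A B : Type*} (a : Fin k ≃ A) (b : Fin l ≃ B) : Fin (k + l) ≃ A ⊕ B :=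
  finSumFinEquiv.symm.trans (Equiv.sumCongr a b)

theorem sumLabel_assoc {A B C : Type*} (a : Fin k ≃ A) (b : Fin l ≃ B) (c : Fin m ≃ C) :
    (sumLabel (sumLabel a b) c).trans (Equiv.sumAssoc A B C) =
      (finCongr (Nat.add_assoc k l m)).trans (sumLabel a (sumLabel b c)) := by
  -- The inverse bijections start from disjoint unions, where a case distinction computes them.
  apply Equiv.symm_bijective.injective
  ext x
  rcases x with x | x | x <;> simp [sumLabel, Nat.add_assoc]

theorem sumLabel_empty {A B : Type*} [IsEmpty B] (a : Fin k ≃ A) (b : Fin 0 ≃ B) :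
    (sumLabel a b).trans (Equiv.sumEmpty A B) = (finCongr (Nat.add_zero k)).trans a := by
  apply Equiv.symm_bijective.injective
  ext x
  simp [sumLabel]
  rfl

theorem hcomp_gact (e : Fin k ≃ Fin k₁) (f : Fin l ≃ Fin l₁) (e' : Fin k' ≃ Fin k₁')
    (f' : Fin l' ≃ Fin l₁') (p : P.carrier k l) (p' : P.carrier k' l') :
    P.hcomp (P.gact e f p) (P.gact e' f' p') =
      P.gact ((sumLabel e e').trans finSumFinEquiv) ((sumLabel f f').trans finSumFinEquiv)
        (P.hcomp p p') := by
  obtain rfl : k = k₁ := Fin.equiv_iff_eq.1 ⟨e⟩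
  obtain rfl : l = l₁ := Fin.equiv_iff_eq.1 ⟨f⟩
  obtain rfl : k' = k₁' := Fin.equiv_iff_eq.1 ⟨e'⟩
  obtain rfl : l' = l₁' := Fin.equiv_iff_eq.1 ⟨f'⟩
  rw [gact_perm, gact_perm, P.isProP.hcomp_ract, P.isProP.hcomp_lact]
  rfl

/-- The action of `f` on the outputs of `q` and its inverse on the inputs of `p` meet in the middle
and cancel, by `vcomp_middle`. -/
theorem vcomp_gact (e : Fin k ≃ Fin k₁) (f : Fin l ≃ Fin l₁) (g : Fin m ≃ Fin m₁)
    (p : P.carrier l m) (q : P.carrier k l) :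
    P.vcomp (P.gact f g p) (P.gact e f q) = P.gact e g (P.vcomp p q) := by
  obtain rfl : k = k₁ := Fin.equiv_iff_eq.1 ⟨e⟩
  obtain rfl : l = l₁ := Fin.equiv_iff_eq.1 ⟨f⟩
  obtain rfl : m = m₁ := Fin.equiv_iff_eq.1 ⟨g⟩
  rw [gact_perm, gact_perm, gact_perm, ← P.isProP.ract_vcomp, P.isProP.vcomp_middle, P.lact_mul,
    inv_mul_cancel, P.lact_one, P.isProP.lact_vcomp]

theorem hcomp_comm_gact (p : P.carrier k l) (p' : P.carrier k' l') :
    P.gact finAddFlip finAddFlip (P.hcomp p p') = P.hcomp p' p := by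
  -- These bijections make the left side a flip on both indices, while on the right the transport,
  -- the block permutation and the flip compose to the identity.
  have h := congrArg (fun x => P.gact finAddFlip (finCongr (Nat.add_comm l l')) x)
    (P.isProP.hcomp_comm p p')
  simp only [lact_eq_gact, ract_eq_gact, castIdx_eq_gact, gact_gact] at h
  convert h using 1
  · congr 1
  · rw [eq_comm]
    convert P.gact_refl _ using 3 <;>
    · ext x
      simp [permBlock]

/-- From `e · I = I ∘ (e · I) = (I · e) ∘ I = I · e` it follows that simultaneous renumbering of
inputs and outputs fixes the identity. -/
theorem unitN_gact (e : Fin k ≃ Fin l) : P.gact e e (P.unitN k) = P.unitN l := by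
  obtain rfl : k = l := Fin.equiv_iff_eq.1 ⟨e⟩
  have h : P.lact e (P.unitN k) = P.ract e (P.unitN k) := by
    rw [← P.isProP.unitN_vcomp (P.lact e (P.unitN k)), ← P.isProP.vcomp_middle,
      P.isProP.vcomp_unitN]
  rw [gact_perm, h, P.ract_mul, mul_inv_cancel, P.ract_one]

theorem hcomp_unitN (m n : ℕ) : P.hcomp (P.unitN m) (P.unitN n) = P.unitN (m + n) := by
  induction n with
  -- The transports in the unit and associativity laws are trivial here, because `m + 0` and `m + (n
  -- + 1)` reduce.
  | zero => exact P.isProP.hcomp_unit0 (P.unitN m)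
  | succ n ih =>
    have h := P.isProP.hcomp_assoc (P.unitN m) (P.unitN n) P.unit1
    rw [ih] at h
    exact h.symm

variable {A B C A' B' C' A'' B'' : Type}

/-- Horizontal concatenation of labelled elements. -/
noncomputable def tensor [Finite A] [Finite B] [Finite A'] [Finite B'] (p : P.Comp A B)
    (p' : P.Comp A' B') : P.Comp (A ⊕ A') (B ⊕ B') :=
  P.label (sumLabel (Finite.equivFin A).symm (Finite.equivFin A').symm)
    (sumLabel (Finite.equivFin B).symm (Finite.equivFin B').symm) (P.hcomp p p')

/-- Vertical concatenation of labelled elements. -/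
noncomputable def comp (p : P.Comp B C) (q : P.Comp A B) : P.Comp A C := P.vcomp p q

variable (A) in
/-- The identity labelled by a finite set. -/
noncomputable def idt : P.Comp A A := P.unitN (Nat.card A)

variable {P}

theorem comp_assoc {D : Type} (p : P.Comp C D) (q : P.Comp B C) (r : P.Comp A B) :
    P.comp p (P.comp q r) = P.comp (P.comp p q) r :=
  P.isProP.vcomp_assoc _ _ _

@[simp]
theorem comp_idt (p : P.Comp A B) : P.comp p (P.idt A) = p := P.isProP.vcomp_unitN p

@[simp]
theorem idt_comp (p : P.Comp A B) : P.comp (P.idt B) p = p := P.isProP.unitN_vcomp p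

variable [Finite A] [Finite B] [Finite C] [Finite A'] [Finite B'] [Finite C'] [Finite A'']
  [Finite B'']

theorem tensor_label (a : Fin k ≃ A) (b : Fin l ≃ B) (a' : Fin k' ≃ A') (b' : Fin l' ≃ B')
    (p : P.carrier k l) (p' : P.carrier k' l') :
    P.tensor (P.label a b p) (P.label a' b' p') =
      P.label (sumLabel a a') (sumLabel b b') (P.hcomp p p') := by
  rw [tensor, label.eq_1 _ a, label.eq_1 _ a', hcomp_gact, label_gact]
  congr 2 <;> (ext x; rcases h : finSumFinEquiv.symm x with y | y <;> simp [sumLabel, h])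

theorem comp_label (a : Fin k ≃ A) (b : Fin l ≃ B) (c : Fin m ≃ C)
    (p : P.carrier l m) (q : P.carrier k l) :
    P.comp (P.label b c p) (P.label a b q) = P.label a c (P.vcomp p q) :=
  P.vcomp_gact _ _ _ _ _

theorem label_unitN (a : Fin k ≃ A) : P.label a a (P.unitN k) = P.idt A :=
  P.unitN_gact _

theorem relabel_idt (a : A ≃ A') : P.relabel a a (P.idt A) = P.idt A' := by
  rw [← label_unitN (Finite.equivFin A).symm, relabel_label, label_unitN]

theorem tensor_relabel (a : A ≃ A'') (b : B ≃ B'') {A₁ B₁ : Type} [Finite A₁] [Finite B₁]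
    (a' : A' ≃ A₁) (b' : B' ≃ B₁) (p : P.Comp A B) (p' : P.Comp A' B') :
    P.tensor (P.relabel a b p) (P.relabel a' b' p') =
      P.relabel (Equiv.sumCongr a a') (Equiv.sumCongr b b') (P.tensor p p') := by
  obtain ⟨p, rfl⟩ := exists_label p
  obtain ⟨p', rfl⟩ := exists_label p'
  simp only [relabel_label, tensor_label]
  congr 2 <;> (ext x; rcases h : finSumFinEquiv.symm x with y | y <;> simp [sumLabel, h])

theorem comp_relabel (a : A ≃ A') (b : B ≃ B') (c : C ≃ C') (p : P.Comp B C) (q : P.Comp A B) :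
    P.comp (P.relabel b c p) (P.relabel a b q) = P.relabel a c (P.comp p q) := by
  obtain ⟨p, rfl⟩ := exists_label p
  obtain ⟨q, rfl⟩ := exists_label q
  simp only [relabel_label, comp_label]

theorem tensor_idt : P.tensor (P.idt A) (P.idt B) = P.idt (A ⊕ B) := by
  rw [← label_unitN (Finite.equivFin A).symm, ← label_unitN (Finite.equivFin B).symm, tensor_label,
    hcomp_unitN, label_unitN]

theorem comp_tensor (p : P.Comp B C) (p' : P.Comp B' C') (q : P.Comp A B) (q' : P.Comp A' B') :
    P.comp (P.tensor p p') (P.tensor q q') = P.tensor (P.comp p q) (P.comp p' q') := by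
  rw [tensor, tensor, comp_label, P.isProP.hcomp_vcomp_hcomp]
  rfl

theorem tensor_comm (p : P.Comp A B) (p' : P.Comp A' B') :
    P.relabel (Equiv.sumComm _ _) (Equiv.sumComm _ _) (P.tensor p p') = P.tensor p' p := by
  obtain ⟨p, rfl⟩ := exists_label p
  obtain ⟨p', rfl⟩ := exists_label p'
  rw [tensor_label, tensor_label, ← hcomp_comm_gact, label_gact, relabel_label]
  congr 2 <;>
  · ext x
    obtain ⟨y, rfl⟩ := finSumFinEquiv.surjective x
    rcases y with y | y <;> simp [sumLabel]

/-- The transport along `Nat.add_assoc` is absorbed by the associativity bijection of disjoint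
unions, through `sumLabel_assoc`. -/
theorem tensor_assoc (p : P.Comp A B) (p' : P.Comp A' B') (p'' : P.Comp A'' B'') :
    P.relabel (Equiv.sumAssoc _ _ _) (Equiv.sumAssoc _ _ _) (P.tensor (P.tensor p p') p'') =
      P.tensor p (P.tensor p' p'') := by
  obtain ⟨p, rfl⟩ := exists_label p
  obtain ⟨p', rfl⟩ := exists_label p'
  obtain ⟨p'', rfl⟩ := exists_label p''
  rw [tensor_label, tensor_label, tensor_label, tensor_label, ← P.isProP.hcomp_assoc,
    castIdx_eq_gact, label_gact, relabel_label, sumLabel_assoc, sumLabel_assoc]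

theorem tensor_idt_empty [IsEmpty C] (p : P.Comp A B) :
    P.relabel (Equiv.sumEmpty A C) (Equiv.sumEmpty B C) (P.tensor p (P.idt C)) = p := by
  obtain ⟨p, rfl⟩ := exists_label p
  -- The empty set `C` can be enumerated by `Fin 0`, and `unitN 0` is `I_0`.
  have : P.idt C = P.label (Equiv.equivOfIsEmpty (Fin 0) C) (Equiv.equivOfIsEmpty (Fin 0) C)
      P.unit0 := (label_unitN (P := P) (k := 0) _).symm
  rw [this, tensor_label, relabel_label, sumLabel_empty, sumLabel_empty, ← label_gact,
    ← castIdx_eq_gact, P.isProP.hcomp_unit0]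

end ProP

/-! ## Evaluation of wirings in a ProP -/

/-- Exchange of the first two summands of a triple disjoint union. -/
def sumLeftComm (A B C : Type*) : A ⊕ (B ⊕ C) ≃ B ⊕ (A ⊕ C) :=
  (Equiv.sumAssoc A B C).symm.trans
    ((Equiv.sumCongr (Equiv.sumComm A B) (Equiv.refl C)).trans (Equiv.sumAssoc B A C))

theorem sumLeftComm_trans (A B C : Type*) :
    (sumLeftComm A B C).trans (sumLeftComm B A C) = Equiv.refl _ := by
  ext x; rcases x with x | x | x <;> rfl

/-- A bijection fixing the elements of the first summand. -/
theorem exists_sumCongr {A R R' : Type*} (h : A ⊕ R ≃ A ⊕ R') (ha : ∀ a, h (.inl a) = .inl a) :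
    ∃ r : R ≃ R', h = Equiv.sumCongr (Equiv.refl A) r := by
  have ha' : ∀ a, h.symm (.inl a) = .inl a := fun a => by rw [← ha a, h.symm_apply_apply]
  have h1 : ∀ r, ∃ r', h (.inr r) = .inr r' := by
    intro r
    rcases hr : h (.inr r) with a | r'
    · have := congrArg h.symm hr
      rw [h.symm_apply_apply, ha'] at this
      cases this
    · exact ⟨r', rfl⟩
  have h2 : ∀ r', ∃ r, h.symm (.inr r') = .inr r := by
    intro r
    rcases hr : h.symm (.inr r) with a | r'
    · have := congrArg h hr
      rw [h.apply_symm_apply, ha] at this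
      cases this
    · exact ⟨r', rfl⟩
  choose f hf using h1
  choose g hg using h2
  refine ⟨⟨f, g, fun r => ?_, fun r => ?_⟩, ?_⟩
  · have := hg (f r)
    rw [← hf, h.symm_apply_apply] at this
    exact (Sum.inr.inj this).symm
  · have := hf (g r)
    rw [← hg, h.apply_symm_apply] at this
    exact (Sum.inr.inj this).symm
  · ext x
    rcases x with a | r
    · simp [ha]
    · simp [hf]

/-- The complement of an injection. -/
theorem exists_equiv_sum {A C : Type} [Finite C] (g : A → C) (hg : Function.Injective g) :
    ∃ (R : Type) (_ : Finite R) (f : C ≃ A ⊕ R), ∀ a, f (g a) = .inl a := by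
  classical
  refine ⟨{x // x ∉ Set.range g}, inferInstance, (Equiv.Set.sumCompl (Set.range g)).symm.trans
    (Equiv.sumCongr (Equiv.ofInjective g hg).symm (Equiv.refl _)), fun a => ?_⟩
  have h : (Equiv.Set.sumCompl (Set.range g)).symm (g a) = Sum.inl ⟨g a, a, rfl⟩ :=
    (Equiv.symm_apply_eq _).2 rfl
  rw [Equiv.trans_apply, h]
  exact congrArg Sum.inl (Equiv.ofInjective_symm_apply hg a)

/-- Two injections with the same range differ by a bijection. -/
theorem exists_equiv_of_range_eq {C C' S : Type*} {c : C → S} {c' : C' → S}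
    (hc : Function.Injective c) (hc' : Function.Injective c') (h : Set.range c = Set.range c') :
    ∃ f : C ≃ C', ∀ z, c' (f z) = c z := by
  refine ⟨(Equiv.ofInjective c hc).trans ((Equiv.setCongr h).trans
    (Equiv.ofInjective c' hc').symm), fun z => ?_⟩
  simp [Equiv.apply_ofInjective_symm]

/-- A bijection compatible with injections is unique. -/
theorem equiv_eq_of_injective {S C C' : Type*} {c : C → S} {c' : C' → S} {f g : C ≃ C'}
    (hc' : Function.Injective c') (hf : ∀ z, c' (f z) = c z) (hg : ∀ z, c' (g z) = c z) : f = g :=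
  Equiv.ext fun z => hc' ((hf z).trans (hg z).symm)

namespace ProP

open SymBimodule

variable {𝕜 : Type*} [Field 𝕜] {P : ProP 𝕜}

/-- A consequence of associativity and commutativity, in the form needed to bring a chosen group of
edges to the front. -/
theorem tensor_leftComm {A B C A' B' C' : Type} [Finite A] [Finite B] [Finite C] [Finite A']
    [Finite B'] [Finite C'] (p : P.Comp A A') (q : P.Comp B B') (r : P.Comp C C') :
    P.relabel (sumLeftComm A B C) (sumLeftComm A' B' C') (P.tensor p (P.tensor q r)) =
      P.tensor q (P.tensor p r) := by
  rw [← tensor_assoc, ← tensor_assoc, ← tensor_comm p q]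
  conv_rhs => rw [← P.relabel_refl r, tensor_relabel]
  rw [relabel_relabel, relabel_relabel]
  congr 2 <;> (ext x; rcases x with (x | x) | x <;> rfl)

/-- An operation applied to edges brought to the front may be applied in place, the exchange being
performed afterwards. -/
theorem comp_tensor_leftComm {K A A' B R : Type} [Finite K] [Finite A] [Finite A'] [Finite B]
    [Finite R] (y : P.Comp A A') (z : P.Comp K (B ⊕ (A ⊕ R))) :
    P.comp (P.tensor y (P.idt (B ⊕ R))) (P.relabel (Equiv.refl K) (sumLeftComm B A R) z) =
      P.relabel (Equiv.refl K) (sumLeftComm B A' R)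
        (P.comp (P.tensor (P.idt B) (P.tensor y (P.idt R))) z) := by
  rw [← tensor_idt, ← tensor_leftComm (P.idt B), comp_relabel]

/-- Two operations acting on disjoint sets of outputs commute. -/
theorem comp_tensor_comm {K A A' B B' R : Type} [Finite K] [Finite A] [Finite A'] [Finite B]
    [Finite B'] [Finite R] (x : P.Comp A B) (y : P.Comp A' B') (p : P.Comp K (A ⊕ (A' ⊕ R))) :
    P.comp (P.tensor y (P.idt (B ⊕ R))) (P.relabel (Equiv.refl K) (sumLeftComm B A' R)
        (P.comp (P.tensor x (P.idt (A' ⊕ R))) p)) =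
      P.relabel (Equiv.refl K) (sumLeftComm B B' R)
        (P.comp (P.tensor x (P.idt (B' ⊕ R))) (P.relabel (Equiv.refl K) (sumLeftComm B' A R)
          (P.comp (P.tensor y (P.idt (A ⊕ R))) (P.relabel (Equiv.refl K) (sumLeftComm A A' R) p)))) := by
  -- Up to the same relabelling, both sides become the composite of `x ⊗ (y ⊗ id)` with `p`, by the
  -- interchange law.
  rw [comp_tensor_leftComm (B := B), comp_tensor_leftComm (B := A), relabel_relabel, sumLeftComm_trans,
    Equiv.refl_trans, relabel_refl, comp_assoc, comp_assoc, comp_tensor, comp_tensor, comp_idt,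
    idt_comp, idt_comp, comp_idt]

variable {K V : Type} [Finite K] {In Out : V → Type} [∀ v, Finite (In v)] [∀ v, Finite (Out v)]

/-- The vertices of a wiring have sets `In v` and `Out v` of inputs and outputs, and `e` sends every
input of a vertex to the output of a vertex, or to the global input, to which it is connected.
`Reach e x D C c p` means that `p` is obtained by applying successively the operations `x v` for the
vertices `v` in `D`; its outputs are labelled by `C`, where `c` tells which edges they represent. -/
inductive Reach (e : (Σ v, In v) → (Σ v, Out v) ⊕ K) (x : ∀ v, P.Comp (In v) (Out v)) :
    Set V → ∀ (C : Type) [Finite C], (C → (Σ v, Out v) ⊕ K) → P.Comp K C → Prop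
  | base : Reach e x ∅ K Sum.inr (P.idt K)
  | relabel {D : Set V} {C C' : Type} [Finite C] [Finite C'] {c : C → (Σ v, Out v) ⊕ K}
      {c' : C' → (Σ v, Out v) ⊕ K} {p : P.Comp K C} (f : C ≃ C') (hf : ∀ z, c' (f z) = c z)
      (h : Reach e x D C c p) : Reach e x D C' c' (P.relabel (Equiv.refl K) f p)
  -- By `hc`, the edges entering `v` come first and in the right order, and those labelled by `R`
  -- are not touched. Since `v ∉ D`, no vertex is applied twice.
  | step {D : Set V} {v : V} {R : Type} [Finite R] {c : In v ⊕ R → (Σ v, Out v) ⊕ K}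
      {p : P.Comp K (In v ⊕ R)} (hv : v ∉ D) (hc : ∀ i, c (.inl i) = e ⟨v, i⟩)
      (h : Reach e x D (In v ⊕ R) c p) :
      Reach e x (insert v D) (Out v ⊕ R) (Sum.elim (fun o => .inl ⟨v, o⟩) (fun r => c (.inr r)))
        (P.comp (P.tensor (x v) (P.idt R)) p)

/-- The set `D` of vertices contains all the predecessors of its elements. -/
def IsInitial (e : (Σ v, In v) → (Σ v, Out v) ⊕ K) (D : Set V) : Prop :=
  ∀ t a, t.1 ∈ D → e t = .inl a → a.1 ∈ D

/-- The edge `s` starts in `D` or is a global input, and does not end in `D`. -/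
def IsCut (e : (Σ v, In v) → (Σ v, Out v) ⊕ K) (D : Set V) (s : (Σ v, Out v) ⊕ K) : Prop :=
  (∀ a, s = .inl a → a.1 ∈ D) ∧ ∀ t, e t = s → t.1 ∉ D

/-- The vertex `v` is connected to the vertex `u`. -/
def WireAdj (e : (Σ v, In v) → (Σ v, Out v) ⊕ K) (v u : V) : Prop :=
  ∃ i o, e ⟨u, i⟩ = .inl ⟨v, o⟩

variable {e : (Σ v, In v) → (Σ v, Out v) ⊕ K} {x : ∀ v, P.Comp (In v) (Out v)} {D : Set V}
  {C : Type} [Finite C] {c : C → (Σ v, Out v) ⊕ K} {p : P.Comp K C}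

namespace Reach

/-- A state is governed by `D` alone: its labels list, without repetition, the edges leaving `D`.
The three properties are proved together because adding a vertex uses all of them: an output of `v`
is new and unconsumed by initiality, and an edge kept aside is not consumed by `v` by injectivity.
-/
theorem invariants (h : Reach e x D C c p) :
    Function.Injective c ∧ (∀ s, s ∈ Set.range c ↔ IsCut e D s) ∧ IsInitial e D := by
  induction h with
  | base =>
    refine ⟨Sum.inr_injective, fun s => ⟨?_, ?_⟩, fun t a h => h.elim⟩
    · rintro ⟨a, rfl⟩
      exact ⟨by simp, by simp⟩
    · rintro ⟨h, -⟩
      rcases s with a | a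
      · exact (h a rfl).elim
      · exact ⟨a, rfl⟩
  | @relabel D C C' _ _ c c' p f hf h ih =>
    have hc : c' = c ∘ f.symm := by
      funext z
      rw [Function.comp_apply, ← hf, f.apply_symm_apply]
    refine ⟨?_, ?_, ih.2.2⟩
    · rw [hc]
      exact ih.1.comp f.symm.injective
    · intro s
      rw [hc, f.symm.surjective.range_comp]
      exact ih.2.1 s
  | @step D v R _ c p hv hc h ih =>
    obtain ⟨hinj, hcut, hD⟩ := ih
    have hcut' : ∀ z, IsCut e D (c z) := fun z => (hcut _).1 ⟨z, rfl⟩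
    refine ⟨?_, fun s => ⟨?_, ?_⟩, ?_⟩
    · rintro (o | r) (o' | r') hz
      · simpa using hz
      · exact (hv ((hcut' (.inr r')).1 _ hz.symm)).elim
      · exact (hv ((hcut' (.inr r)).1 _ hz)).elim
      · exact congrArg _ (Sum.inr.inj (hinj hz))
    · rintro ⟨o | r, rfl⟩
      · refine ⟨fun a ha => ?_, fun t ht htD => ?_⟩
        · obtain rfl := Sum.inl.inj ha
          exact Set.mem_insert _ _
        · rcases htD with h1 | h1
          · obtain ⟨u, i⟩ := t
            obtain rfl : u = v := h1
            exact hv ((hcut' (.inl i)).1 _ ((hc i).trans ht))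
          · exact hv (hD t _ h1 ht)
      · refine ⟨fun a ha => Set.mem_insert_of_mem _ ((hcut' (.inr r)).1 a ha), fun t ht htD => ?_⟩
        rcases htD with h1 | h1
        · obtain ⟨u, i⟩ := t
          obtain rfl : u = v := h1
          rw [← hc] at ht
          cases hinj ht
        · exact (hcut' (.inr r)).2 t ht h1
    · rintro ⟨h1, h2⟩
      -- An edge of the new cut either starts at `v`, or belongs to the old cut and does not end at
      -- `v`.
      by_cases hs : ∃ o, s = .inl ⟨v, o⟩
      · obtain ⟨o, rfl⟩ := hs
        exact ⟨.inl o, rfl⟩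
      · have : IsCut e D s := by
          refine ⟨fun a ha => ?_, fun t ht htD => h2 t ht (Set.mem_insert_of_mem _ htD)⟩
          rcases h1 a ha with h3 | h3
          · obtain ⟨u, o⟩ := a
            obtain rfl : u = v := h3
            exact (hs ⟨o, ha⟩).elim
          · exact h3
        obtain ⟨z | z, rfl⟩ := (hcut s).2 this
        · exact (h2 ⟨v, z⟩ (hc z).symm (Set.mem_insert _ _)).elim
        · exact ⟨.inr z, rfl⟩
    · rintro ⟨u, i⟩ a ht ha
      rcases ht with h1 | h1
      · obtain rfl : u = v := h1
        exact Set.mem_insert_of_mem _ ((hcut' (.inl i)).1 a ((hc i).trans ha))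
      · exact Set.mem_insert_of_mem _ (hD _ a h1 ha)

/-- The last operation applied. -/
theorem cases' (h : Reach e x D C c p) :
    (D = ∅ ∧ ∃ f : K ≃ C, (∀ z, c (f z) = .inr z) ∧ p = P.relabel (Equiv.refl K) f (P.idt K)) ∨
    ∃ (D₁ : Set V) (v : V) (R : Type) (_ : Finite R) (c₁ : In v ⊕ R → (Σ v, Out v) ⊕ K)
      (p₁ : P.Comp K (In v ⊕ R)) (f : Out v ⊕ R ≃ C), v ∉ D₁ ∧ D = insert v D₁ ∧
      (∀ i, c₁ (.inl i) = e ⟨v, i⟩) ∧ Reach e x D₁ (In v ⊕ R) c₁ p₁ ∧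
      (∀ z, c (f z) = Sum.elim (fun o => .inl ⟨v, o⟩) (fun r => c₁ (.inr r)) z) ∧
      p = P.relabel (Equiv.refl K) f (P.comp (P.tensor (x v) (P.idt R)) p₁) := by
  induction h with
  | base => exact .inl ⟨rfl, Equiv.refl K, fun _ => rfl, (P.relabel_refl _).symm⟩
  | @relabel D C C' _ _ c c' p f hf h ih =>
    rcases ih with ⟨hD, g, hg, hp⟩ | ⟨D₁, v, R, _, c₁, p₁, g, hv, hD, hc, h₁, hg, hp⟩
    · refine .inl ⟨hD, g.trans f, fun z => (hf _).trans (hg z), ?_⟩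
      rw [hp, relabel_relabel]; rfl
    · refine .inr ⟨D₁, v, R, inferInstance, c₁, p₁, g.trans f, hv, hD, hc, h₁,
        fun z => (hf _).trans (hg z), ?_⟩
      rw [hp, relabel_relabel]; rfl
  | @step D v R _ c p hv hc h ih =>
    exact .inr ⟨D, v, R, inferInstance, c, p, Equiv.refl _, hv, rfl, hc, h, fun _ => rfl,
      (P.relabel_refl _).symm⟩

/-- A vertex outside `D` whose predecessors are in `D` can be made the next one. -/
theorem exists_split {A : Type} (h : Reach e x D C c p) (g : A → (Σ v, Out v) ⊕ K)
    (hg : Function.Injective g) (hcut : ∀ a, IsCut e D (g a)) :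
    ∃ (R : Type) (_ : Finite R) (_ : Finite A) (c' : A ⊕ R → (Σ v, Out v) ⊕ K)
      (p' : P.Comp K (A ⊕ R)), (∀ a, c' (.inl a) = g a) ∧ Reach e x D (A ⊕ R) c' p' := by
  choose g' hg' using fun a => (h.invariants.2.1 _).2 (hcut a)
  have hinj : Function.Injective g' := fun a b hab => hg (by rw [← hg', ← hg', hab])
  obtain ⟨R, _, f, hf⟩ := exists_equiv_sum g' hinj
  have := Finite.of_injective g' hinj
  refine ⟨R, inferInstance, this, c ∘ f.symm, _, fun a => ?_, h.relabel f fun z => ?_⟩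
  · rw [Function.comp_apply, ← hf, f.symm_apply_apply, hg']
  · rw [Function.comp_apply, f.symm_apply_apply]

/-- Induction on the size of `D`: a vertex of `D` without successors in `D` is removed, which leaves
an initial set, and is then applied last. -/
theorem exists_of_isInitial [Finite V] (he : Function.Injective e)
    (hac : ∀ v, ¬ Relation.TransGen (WireAdj e) v v) (hD : IsInitial e D) :
    ∃ (C : Type) (_ : Finite C) (c : C → (Σ v, Out v) ⊕ K) (p : P.Comp K C),
      Reach e x D C c p := by
  -- The relation is reversed, so that a minimal element of `D` is a vertex from which no path leads
  -- to a vertex of `D`.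
  have wf : WellFounded (Function.swap (Relation.TransGen (WireAdj e))) := by
    have : Std.Irrefl (Function.swap (Relation.TransGen (WireAdj e))) := ⟨hac⟩
    exact Finite.wellFounded_of_trans_of_irrefl _
  induction hn : D.ncard generalizing D with
  | zero =>
    obtain rfl : D = ∅ := (Set.ncard_eq_zero D.toFinite).1 hn
    exact ⟨K, inferInstance, _, _, base⟩
  | succ n ih =>
    have hne : D.Nonempty := by
      rw [← Set.ncard_pos D.toFinite]; omega
    obtain ⟨v, hv, hmax⟩ := wf.has_min D hne
    have hD' : IsInitial e (D \ {v}) := by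
      rintro t ⟨u, o⟩ ht ha
      refine ⟨hD t _ ht.1 ha, fun hu => hmax t.1 ht.1 (.single ⟨t.2, ?_⟩)⟩
      obtain rfl : u = v := hu
      exact ⟨o, ha⟩
    obtain ⟨C, _, c, p, h⟩ := ih hD' (by rw [Set.ncard_sdiff_singleton_of_mem hv]; omega)
    -- The edges entering `v` are available: they start in `D` by initiality, not at `v` by
    -- acyclicity, and no other vertex consumes them since `e` is injective.
    have hcut : ∀ i, IsCut e (D \ {v}) (e ⟨v, i⟩) := by
      refine fun i => ⟨fun ⟨u, o⟩ ha => ⟨hD _ _ hv ha, fun hu => ?_⟩, fun t ht => ?_⟩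
      · obtain rfl : u = v := hu
        exact hac u (.single ⟨i, o, ha⟩)
      · rw [he ht]
        simp
    obtain ⟨R, _, _, c', p', hc', h'⟩ := h.exists_split (fun i => e ⟨v, i⟩)
      (fun i i' hi => by simpa using he hi) hcut
    have := h'.step (v := v) (by simp) hc'
    rw [Set.insert_sdiff_self_of_mem hv] at this
    exact ⟨_, inferInstance, _, _, this⟩

/-- Both sets of labels enumerate the cut of `D` without repetition. -/
theorem exists_equiv {C' : Type} [Finite C'] {c' : C' → (Σ v, Out v) ⊕ K} {p' : P.Comp K C'}
    (h : Reach e x D C c p) (h' : Reach e x D C' c' p') : ∃ f : C ≃ C', ∀ z, c' (f z) = c z :=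
  exists_equiv_of_range_eq h.invariants.1 h'.invariants.1
    (Set.ext fun s => (h.invariants.2.1 s).trans (h'.invariants.2.1 s).symm)

/-- If the element reached at `D` is unique, then the operation of a vertex `v` can be applied in
only one way. -/
theorem step_unique {v : V} {R R' : Type} [Finite R] [Finite R'] {c : In v ⊕ R → (Σ v, Out v) ⊕ K}
    {c' : In v ⊕ R' → (Σ v, Out v) ⊕ K} {p : P.Comp K (In v ⊕ R)} {p' : P.Comp K (In v ⊕ R')}
    (hc : ∀ i, c (.inl i) = e ⟨v, i⟩) (hc' : ∀ i, c' (.inl i) = e ⟨v, i⟩)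
    (h : Reach e x D _ c p) (h' : Reach e x D _ c' p')
    (hD : ∀ f : In v ⊕ R ≃ In v ⊕ R', (∀ z, c' (f z) = c z) →
      p' = P.relabel (Equiv.refl K) f p) :
    ∃ g : Out v ⊕ R ≃ Out v ⊕ R',
      (∀ z, Sum.elim (fun o => .inl ⟨v, o⟩) (fun r => c' (.inr r)) (g z) =
        Sum.elim (fun o => .inl (⟨v, o⟩ : Σ v, Out v)) (fun r => c (.inr r)) z) ∧
      P.comp (P.tensor (x v) (P.idt R')) p' =
        P.relabel (Equiv.refl K) g (P.comp (P.tensor (x v) (P.idt R)) p) := by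
  obtain ⟨f, hf⟩ := h.exists_equiv h'
  -- The bijection between the two states fixes the inputs of `v`, since `c'` is injective; only the
  -- edges kept aside are permuted, and this commutes with applying `x v`.
  obtain ⟨r, rfl⟩ := exists_sumCongr f fun i => h'.invariants.1
    ((hf _).trans ((hc i).trans (hc' i).symm))
  refine ⟨Equiv.sumCongr (Equiv.refl _) r, ?_, ?_⟩
  · rintro (o | z)
    · rfl
    · exact hf (.inr z)
  · rw [hD _ hf, ← relabel_idt r, ← comp_relabel (Equiv.refl K)
      (Equiv.sumCongr (Equiv.refl (In v)) r), ← tensor_relabel, relabel_refl]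

/-- A diamond argument, by strong induction on the size of `D`. If both histories end with the same
vertex, `step_unique` applies. If they end with `v ≠ v'`, a state at `D` without both vertices is
extended by `v` and by `v'`; each extension is compared with one history by the induction
hypothesis, and `comp_tensor_comm` closes the diamond. -/
theorem unique [Finite V] (he : Function.Injective e)
    (hac : ∀ v, ¬ Relation.TransGen (WireAdj e) v v) {C' : Type} [Finite C']
    {c' : C' → (Σ v, Out v) ⊕ K} {p' : P.Comp K C'} (h : Reach e x D C c p)
    (h' : Reach e x D C' c' p') (f : C ≃ C') (hf : ∀ z, c' (f z) = c z) :
    p' = P.relabel (Equiv.refl K) f p := by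
  induction hn : D.ncard using Nat.strong_induction_on generalizing D C C' with
  | _ n ih =>
  have hi := h.invariants
  have hi' := h'.invariants
  rcases h.cases' with ⟨rfl, g, hg, rfl⟩ | ⟨D₁, v, R, _, c₁, p₁, g, hv, rfl, hc₁, h₁, hg, rfl⟩
  · rcases h'.cases' with ⟨-, g', hg', rfl⟩ | ⟨D₁', v', R', _, c₁', p₁', g', hv', hD, _⟩
    · have : g' = g.trans f := equiv_eq_of_injective (c := .inr) hi'.1 hg'
        fun z => (hf _).trans (hg z)
      rw [this, relabel_relabel]
      rfl
    · exact ((Set.insert_nonempty v' D₁').ne_empty hD.symm).elim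
  · rcases h'.cases' with ⟨hD, _⟩ | ⟨D₁', v', R', _, c₁', p₁', g', hv', hD, hc₁', h₁', hg', rfl⟩
    · exact ((Set.insert_nonempty v D₁).ne_empty hD).elim
    have hcard : D₁.ncard < n := by
      rw [← hn, Set.ncard_insert_of_notMem hv D₁.toFinite]; omega
    have hcard' : D₁'.ncard < n := by
      rw [← hn, hD, Set.ncard_insert_of_notMem hv' D₁'.toFinite]; omega
    by_cases hvv : v = v'
    · subst hvv
      obtain rfl : D₁ = D₁' := by
        rw [← Set.insert_sdiff_self_of_notMem hv, hD, Set.insert_sdiff_self_of_notMem hv']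
      obtain ⟨k, hk, hk'⟩ := step_unique hc₁ hc₁' h₁ h₁'
        (fun f hf => ih _ hcard h₁ h₁' f hf rfl)
      have : k.trans g' = g.trans f := equiv_eq_of_injective
          (c := Sum.elim (fun o => .inl (⟨v, o⟩ : Σ v, Out v)) (fun r => c₁ (.inr r))) hi'.1
          (fun z => (hg' _).trans (hk z)) (fun z => (hf _).trans (hg z))
      rw [hk', relabel_relabel, relabel_relabel, this]
    · have hvD : v ∈ D₁' := by
        have := hD ▸ Set.mem_insert v D₁
        exact this.resolve_left hvv
      have hvD' : v' ∈ D₁ := by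
        have := hD.symm ▸ Set.mem_insert v' D₁'
        exact this.resolve_left (Ne.symm hvv)
      have hD₁ := h₁.invariants
      have hD₁' := h₁'.invariants
      -- This is `D` with `v` and `v'` removed, an initial set because `D₁` and `D₁'` are both
      -- initial.
      let D₀ := D₁ ∩ D₁'
      have e₁ : insert v' D₀ = D₁ := by
        ext u
        have := Set.ext_iff.1 hD u
        simp only [Set.mem_insert_iff, D₀, Set.mem_inter_iff] at this ⊢
        by_cases h1 : u = v
        · subst h1; simp [hv, hvv]
        · by_cases h2 : u = v'
          · subst h2; simp [hvD']
          · simp [h1, h2] at this ⊢; tauto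
      have e₁' : insert v D₀ = D₁' := by
        ext u
        have := Set.ext_iff.1 hD u
        simp only [Set.mem_insert_iff, D₀, Set.mem_inter_iff] at this ⊢
        by_cases h1 : u = v'
        · subst h1; simp [hv', Ne.symm hvv]
        · by_cases h2 : u = v
          · subst h2; simp [hvD]
          · simp [h1, h2] at this ⊢; tauto
      have hD₀ : IsInitial e D₀ := fun t a ht ha =>
        ⟨hD₁.2.2 t a ht.1 ha, hD₁'.2.2 t a ht.2 ha⟩
      obtain ⟨C₀, _, c₀, p₀, h₀⟩ := exists_of_isInitial (x := x) he hac hD₀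
      have hcut : ∀ i, IsCut e D₀ (e ⟨v, i⟩) := fun i =>
        ⟨fun a ha => ⟨((hD₁.2.1 _).1 ⟨_, hc₁ i⟩).1 a ha, hD₁'.2.2 _ a hvD ha⟩,
          fun t ht ht' => hv (by rw [he ht] at ht'; exact ht'.1)⟩
      have hcut' : ∀ i, IsCut e D₀ (e ⟨v', i⟩) := fun i =>
        ⟨fun a ha => ⟨hD₁.2.2 _ a hvD' ha, ((hD₁'.2.1 _).1 ⟨_, hc₁' i⟩).1 a ha⟩,
          fun t ht ht' => hv' (by rw [he ht] at ht'; exact ht'.2)⟩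
      -- The inputs of `v` and of `v'` are all available at `D₀` and are distinct edges, so they can
      -- be brought to the front together.
      obtain ⟨R₀, _, _, d, q, hd, hq⟩ := h₀.exists_split
        (Sum.elim (fun i : In v => e ⟨v, i⟩) (fun i : In v' => e ⟨v', i⟩))
        (by
          rintro (i | i) (i' | i') hii
          · simpa using he hii
          · exact (hvv (congrArg Sigma.fst (he hii))).elim
          · exact (hvv (congrArg Sigma.fst (he hii)).symm).elim
          · simpa using he hii)
        (by rintro (i | i); exacts [hcut i, hcut' i])
      have k₁ := hq.relabel (Equiv.sumAssoc _ _ _) (c' := d ∘ (Equiv.sumAssoc _ _ _).symm)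
        fun z => by rw [Function.comp_apply, Equiv.symm_apply_apply]
      have k₂ := k₁.relabel (sumLeftComm _ _ _)
        (c' := d ∘ (Equiv.sumAssoc _ _ _).symm ∘ (sumLeftComm _ _ _).symm)
        fun z => by simp only [Function.comp_apply, Equiv.symm_apply_apply]
      -- From the state at `D₀`, applying `v` reaches `D₁'` and applying `v'` reaches `D₁`; the
      -- inputs of the other vertex remain among the edges kept aside.
      have k₃ := k₁.step (v := v) (fun h => hv h.1) (fun i => hd (.inl i))
      have k₄ := k₂.step (v := v') (fun h => hv' h.2) (fun i => hd (.inr i))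
      rw [e₁'] at k₃
      rw [e₁] at k₄
      have k₅ := k₃.relabel (sumLeftComm _ _ _)
        (c' := Sum.elim (fun i => e ⟨v', i⟩) (Sum.elim (fun o => .inl ⟨v, o⟩)
          (fun r => d (.inr r)))) (by rintro (z | z | z); exacts [rfl, (hd (.inr z)).symm, rfl])
      have k₆ := k₄.relabel (sumLeftComm _ _ _)
        (c' := Sum.elim (fun i => e ⟨v, i⟩) (Sum.elim (fun o => .inl ⟨v', o⟩)
          (fun r => d (.inr r)))) (by rintro (z | z | z); exacts [rfl, (hd (.inl z)).symm, rfl])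
      -- The induction hypothesis at `D₁` identifies the first history with the one through `D₀` and
      -- `v'`; the next comparison does the same for the second history at `D₁'`.
      obtain ⟨a, ha, ha'⟩ := step_unique hc₁ (fun i => rfl) h₁ k₆
        (fun f hf => ih _ hcard h₁ k₆ f hf rfl)
      obtain ⟨b, hb, hb'⟩ := step_unique (fun i => rfl) hc₁' k₅ h₁'
        (fun f hf => ih _ hcard' k₅ h₁' f hf rfl)
      rw [hb', comp_tensor_comm, ha']
      simp only [relabel_relabel, Equiv.refl_trans]
      -- Both bijections respect the edges represented by the labels, so they agree by injectivity
      -- of `c'`.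
      have : (((a.trans (sumLeftComm _ _ _)).trans b).trans g') = g.trans f := by
        refine equiv_eq_of_injective
          (c := Sum.elim (fun o => .inl (⟨v, o⟩ : Σ v, Out v)) (fun r => c₁ (.inr r))) hi'.1
          (fun z => (hg' _).trans ((hb _).trans ?_)) (fun z => (hf _).trans (hg z))
        rw [← ha, Equiv.trans_apply]
        rcases a z with w | w | w <;> rfl
      rw [this]

/-- A wiring embedded into another one: after a state at which its inputs and a set `R` of other
edges are available, all of its operations can be applied, the edges in `R` being kept aside. -/
theorem map {V' K' R : Type} [Finite K'] [Finite R] {In' Out' : V' → Type}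
    [∀ v, Finite (In' v)] [∀ v, Finite (Out' v)] {e' : (Σ v, In' v) → (Σ v, Out' v) ⊕ K'}
    {x' : ∀ v, P.Comp (In' v) (Out' v)} (j : V → V') (hj : Function.Injective j)
    (a : ∀ v, In v ≃ In' (j v)) (b : ∀ v, Out v ≃ Out' (j v))
    (hx : ∀ v, x' (j v) = P.relabel (a v) (b v) (x v))
    (κ : K → (Σ v, Out' v) ⊕ K') (r : R → (Σ v, Out' v) ⊕ K')
    (he : ∀ v i, e' ⟨j v, a v i⟩ =
      Sum.elim (fun s : Σ v, Out v => .inl ⟨j s.1, b s.1 s.2⟩) κ (e ⟨v, i⟩))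
    {D₀ : Set V'} (hD₀ : ∀ v, j v ∉ D₀) {q : P.Comp K' (K ⊕ R)}
    (hq : Reach e' x' D₀ (K ⊕ R) (Sum.elim κ r) q) (h : Reach e x D C c p) :
    Reach e' x' (D₀ ∪ j '' D) (C ⊕ R)
      (Sum.elim (fun z => Sum.elim (fun s : Σ v, Out v => .inl ⟨j s.1, b s.1 s.2⟩) κ (c z)) r)
      (P.comp (P.tensor p (P.idt R)) q) := by
  induction h with
  | base =>
    rw [tensor_idt, idt_comp, Set.image_empty, Set.union_empty]
    exact hq
  | @relabel D C C' _ _ c c' p f hf h ih =>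
    have := ih.relabel (Equiv.sumCongr f (Equiv.refl R))
      (c' := Sum.elim (fun z =>
        Sum.elim (fun s : Σ v, Out v => .inl ⟨j s.1, b s.1 s.2⟩) κ (c' z)) r)
      (by
        rintro (z | z)
        · exact congrArg _ (hf z)
        · rfl)
    have h1 : P.tensor (P.relabel (Equiv.refl K) f p) (P.idt R) =
        P.relabel (Equiv.refl _) (Equiv.sumCongr f (Equiv.refl R)) (P.tensor p (P.idt R)) := by
      conv_lhs => rw [← relabel_refl (P.idt R), tensor_relabel, Equiv.sumCongr_refl]
    rw [← comp_relabel (Equiv.refl K') (Equiv.refl _), relabel_refl, ← h1] at this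
    exact this
  | @step D v S _ c p hv hc h ih =>
    have hv' : j v ∉ D₀ ∪ j '' D := by
      rintro (h1 | ⟨u, hu, huv⟩)
      · exact hD₀ v h1
      · exact hv (hj huv ▸ hu)
    -- `E` moves `S` to the edges kept aside and identifies the inputs of `v` with those of `j v`,
    -- so that the step at `j v` can be taken in the larger wiring; `E'` does the corresponding move
    -- for the outputs.
    let E := (Equiv.sumAssoc (In v) S R).trans (Equiv.sumCongr (a v) (Equiv.refl (S ⊕ R)))
    let E' := (Equiv.sumAssoc (Out v) S R).trans (Equiv.sumCongr (b v) (Equiv.refl (S ⊕ R)))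
    let ψ : (Σ v, Out v) ⊕ K → (Σ v, Out' v) ⊕ K' :=
      Sum.elim (fun s : Σ v, Out v => .inl ⟨j s.1, b s.1 s.2⟩) κ
    have h1 := ih.relabel E
      (c' := Sum.elim (fun i => e' ⟨j v, i⟩) (Sum.elim (fun s => ψ (c (.inr s))) r))
      (by
        rintro ((i | s) | s)
        · exact (he v i).trans (congrArg ψ (hc i).symm)
        · rfl
        · rfl)
    have h2 := (h1.step hv' (fun i => rfl)).relabel E'.symm
      (c' := Sum.elim (fun z => ψ (Sum.elim (fun o => .inl (⟨v, o⟩ : Σ v, Out v))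
        (fun r => c (.inr r)) z)) r)
      (by
        intro z
        obtain ⟨z, rfl⟩ := E'.surjective z
        rw [Equiv.symm_apply_apply]
        rcases z with (z | z) | z <;> rfl)
    have h3 : P.tensor (x' (j v)) (P.idt (S ⊕ R)) =
        P.relabel E E' (P.tensor (P.tensor (x v) (P.idt S)) (P.idt R)) := by
      rw [← relabel_relabel, tensor_assoc, tensor_idt, ← tensor_relabel, hx, relabel_refl]
    rw [h3, comp_relabel, relabel_relabel, Equiv.self_trans_symm, Equiv.refl_trans, relabel_refl,
      comp_assoc, comp_tensor, comp_idt] at h2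
    rw [Set.image_insert_eq, Set.union_insert]
    exact h2

/-- The case of `map` in which no edge is kept aside. -/
theorem map' {V' K' : Type} [Finite K'] {In' Out' : V' → Type}
    [∀ v, Finite (In' v)] [∀ v, Finite (Out' v)] {e' : (Σ v, In' v) → (Σ v, Out' v) ⊕ K'}
    {x' : ∀ v, P.Comp (In' v) (Out' v)} (j : V → V') (hj : Function.Injective j)
    (a : ∀ v, In v ≃ In' (j v)) (b : ∀ v, Out v ≃ Out' (j v))
    (hx : ∀ v, x' (j v) = P.relabel (a v) (b v) (x v))
    (κ : K → (Σ v, Out' v) ⊕ K')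
    (he : ∀ v i, e' ⟨j v, a v i⟩ =
      Sum.elim (fun s : Σ v, Out v => .inl ⟨j s.1, b s.1 s.2⟩) κ (e ⟨v, i⟩))
    {D₀ : Set V'} (hD₀ : ∀ v, j v ∉ D₀) {q : P.Comp K' K}
    (hq : Reach e' x' D₀ K κ q) (h : Reach e x D C c p) :
    Reach e' x' (D₀ ∪ j '' D) C
      (fun z => Sum.elim (fun s : Σ v, Out v => .inl ⟨j s.1, b s.1 s.2⟩) κ (c z))
      (P.comp p q) := by
  -- The set of edges kept aside is taken empty, and the empty summand is removed at the end.
  have h1 := map j hj a b hx κ (Empty.elim : Empty → _) he hD₀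
    (hq.relabel (Equiv.sumEmpty K Empty).symm (by simp)) h
  have h2 := h1.relabel (Equiv.sumEmpty C Empty)
    (c' := fun z => Sum.elim (fun s : Σ v, Out v => .inl ⟨j s.1, b s.1 s.2⟩) κ (c z))
    (by rintro (z | z); exacts [rfl, z.elim])
  rw [← comp_relabel _ (Equiv.sumEmpty K Empty), tensor_idt_empty, relabel_relabel,
    Equiv.symm_trans_self, Equiv.refl_trans, relabel_refl] at h2
  exact h2

/-- Applying an operation depends linearly on this operation. -/
noncomputable def stepLinear {A B R : Type} [Finite A] [Finite B] [Finite R]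
    (p : P.Comp K (A ⊕ R)) : P.Comp A B →ₗ[𝕜] P.Comp K (B ⊕ R) where
  toFun z := P.comp (P.tensor z (P.idt R)) p
  map_add' z z' := by simp [comp, tensor]
  map_smul' a z := by simp [comp, tensor]

/-- The element reached depends linearly on the operation attached to each vertex. -/
theorem exists_linear [DecidableEq V] (v : V) (h : Reach e x D C c p) :
    (v ∉ D ∧ ∀ z, Reach e (Function.update x v z) D C c p) ∨
      (v ∈ D ∧ ∃ Λ : P.Comp (In v) (Out v) →ₗ[𝕜] P.Comp K C,
        ∀ z, Reach e (Function.update x v z) D C c (Λ z)) := by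
  induction h with
  | base => exact .inl ⟨fun h => h, fun z => base⟩
  | @relabel D C C' _ _ c c' p f hf h ih =>
    rcases ih with ⟨hv, h⟩ | ⟨hv, Λ, hΛ⟩
    · exact .inl ⟨hv, fun z => (h z).relabel f hf⟩
    · exact .inr ⟨hv, (P.relabel (Equiv.refl K) f).comp Λ, fun z => (hΛ z).relabel f hf⟩
  | @step D u R _ c p hu hc h ih =>
    rcases ih with ⟨hv, h⟩ | ⟨hv, Λ, hΛ⟩
    · by_cases huv : u = v
      · subst huv
        refine .inr ⟨Set.mem_insert _ _, stepLinear p, fun z => ?_⟩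
        have := (h z).step hu hc
        rw [Function.update_self] at this
        exact this
      · refine .inl ⟨fun h => h.elim (fun h => huv h.symm) hv, fun z => ?_⟩
        have := (h z).step hu hc
        rw [Function.update_of_ne huv] at this
        exact this
    · have huv : u ≠ v := by
        rintro rfl
        exact hu hv
      refine .inr ⟨Set.mem_insert_of_mem _ hv,
        (P.vcomp (P.tensor (x u) (P.idt R))).comp Λ, fun z => ?_⟩
      have := (hΛ z).step hu hc
      rw [Function.update_of_ne huv] at this
      exact this

end Reach

end ProP

/-! ## The wiring of a planar graph -/

namespace PlanarGraph

variable {k l m k' l' n : ℕ}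

/-- The bijection sending the end of each edge, which is an input of a vertex or a global output, to
its beginning, which is an output of a vertex or a global input. -/
def origin (G : PlanarGraph k l) :
    (Σ v, Fin (G.inDeg v)) ⊕ Fin l ≃ (Σ v, Fin (G.outDeg v)) ⊕ Fin k :=
  -- Edges other than loops are listed by their ends as `(E ⊕ I) ⊕ (O ⊕ InOut)` and by their
  -- beginnings as `(E ⊕ O) ⊕ (I ⊕ InOut)`; exchanging `I` and `O` passes from one list to the
  -- other.
  (Equiv.sumCongr G.tgt G.outIdx).symm.trans
    ((Equiv.sumSumSumComm G.E G.I G.O G.InOut).trans (Equiv.sumCongr G.src G.inIdx))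

variable (G : PlanarGraph k l)

@[simp]
theorem origin_tgt_inl (e : G.E) : G.origin (.inl (G.tgt (.inl e))) = .inl (G.src (.inl e)) := by
  simp [origin]

@[simp]
theorem origin_tgt_inr (i : G.I) : G.origin (.inl (G.tgt (.inr i))) = .inr (G.inIdx (.inl i)) := by
  simp [origin]

@[simp]
theorem origin_outIdx_inl (o : G.O) :
    G.origin (.inr (G.outIdx (.inl o))) = .inl (G.src (.inr o)) := by
  simp [origin]

@[simp]
theorem origin_outIdx_inr (p : G.InOut) :
    G.origin (.inr (G.outIdx (.inr p))) = .inr (G.inIdx (.inr p)) := by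
  simp [origin]

/-- The beginnings of edges of `G`, as beginnings of edges of `G * G'`. -/
def hcompInl (G' : PlanarGraph k' l') (s : (Σ v, Fin (G.outDeg v)) ⊕ Fin k) :
    (Σ v, Fin ((G.hcomp G').outDeg v)) ⊕ Fin (k + k') :=
  Sum.map (sigmaInl G.outDeg G'.outDeg) (Fin.castAdd k') s

/-- The beginnings of edges of `G'`, as beginnings of edges of `G * G'`. -/
def hcompInr (G' : PlanarGraph k' l') (s : (Σ v, Fin (G'.outDeg v)) ⊕ Fin k') :
    (Σ v, Fin ((G.hcomp G').outDeg v)) ⊕ Fin (k + k') :=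
  Sum.map (sigmaInr G.outDeg G'.outDeg) (Fin.natAdd k) s

/-- The beginnings of edges of `G`, as beginnings of edges of `G' ∘ G`. -/
def vcompInl (G' : PlanarGraph l m) (s : (Σ v, Fin (G.outDeg v)) ⊕ Fin k) :
    (Σ v, Fin ((G'.vcomp G).outDeg v)) ⊕ Fin k :=
  Sum.map (sigmaInl G.outDeg G'.outDeg) id s

/-- The beginnings of edges of `G'`, as beginnings of edges of `G' ∘ G`. -/
def vcompInr (G' : PlanarGraph l m) (s : (Σ v, Fin (G'.outDeg v)) ⊕ Fin l) :
    (Σ v, Fin ((G'.vcomp G).outDeg v)) ⊕ Fin k :=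
  Sum.elim (fun a => .inl (sigmaInr G.outDeg G'.outDeg a))
    (fun i => G.vcompInl G' (G.origin (.inr i))) s

/-! ### Tracing edges in a horizontal concatenation -/

section hcomp

variable (G' : PlanarGraph k' l')

theorem origin_hcomp_inl (t : Σ v, Fin (G.inDeg v)) :
    (G.hcomp G').origin (.inl ⟨.inl t.1, t.2⟩) = G.hcompInl G' (G.origin (.inl t)) := by
  obtain ⟨x | x, rfl⟩ := G.tgt.surjective t
  · rw [origin_tgt_inl]
    exact (G.hcomp G').origin_tgt_inl (.inl x)
  · rw [origin_tgt_inr]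
    exact (G.hcomp G').origin_tgt_inr (.inl x)

theorem origin_hcomp_inr (t : Σ v, Fin (G'.inDeg v)) :
    (G.hcomp G').origin (.inl ⟨.inr t.1, t.2⟩) = G.hcompInr G' (G'.origin (.inl t)) := by
  obtain ⟨x | x, rfl⟩ := G'.tgt.surjective t
  · rw [origin_tgt_inl]
    exact (G.hcomp G').origin_tgt_inl (.inr x)
  · rw [origin_tgt_inr]
    exact (G.hcomp G').origin_tgt_inr (.inr x)

theorem origin_hcomp_castAdd (o : Fin l) :
    (G.hcomp G').origin (.inr (Fin.castAdd l' o)) = G.hcompInl G' (G.origin (.inr o)) := by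
  obtain ⟨x | x, rfl⟩ := G.outIdx.surjective o
  · rw [origin_outIdx_inl]
    exact (G.hcomp G').origin_outIdx_inl (.inl x)
  · rw [origin_outIdx_inr]
    exact (G.hcomp G').origin_outIdx_inr (.inl x)

theorem origin_hcomp_natAdd (o : Fin l') :
    (G.hcomp G').origin (.inr (Fin.natAdd l o)) = G.hcompInr G' (G'.origin (.inr o)) := by
  obtain ⟨x | x, rfl⟩ := G'.outIdx.surjective o
  · rw [origin_outIdx_inl]
    exact (G.hcomp G').origin_outIdx_inl (.inr x)
  · rw [origin_outIdx_inr]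
    exact (G.hcomp G').origin_outIdx_inr (.inr x)

end hcomp

/-! ### Tracing edges in a vertical concatenation -/

section vcomp

variable (G' : PlanarGraph l m)

theorem origin_vcomp_inl (t : Σ v, Fin (G.inDeg v)) :
    (G'.vcomp G).origin (.inl ⟨.inl t.1, t.2⟩) = G.vcompInl G' (G.origin (.inl t)) := by
  obtain ⟨x | x, rfl⟩ := G.tgt.surjective t
  · rw [origin_tgt_inl]
    exact (G'.vcomp G).origin_tgt_inl (.inl (.inl x))
  · rw [origin_tgt_inr]
    exact (G'.vcomp G).origin_tgt_inr (.inl x)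

theorem origin_vcomp_inr (t : Σ v, Fin (G'.inDeg v)) :
    (G'.vcomp G).origin (.inl ⟨.inr t.1, t.2⟩) = G.vcompInr G' (G'.origin (.inl t)) := by
  obtain ⟨x | x, rfl⟩ := G'.tgt.surjective t
  · rw [origin_tgt_inl]
    exact (G'.vcomp G).origin_tgt_inl (.inl (.inr x))
  · rw [origin_tgt_inr, vcompInr, Sum.elim_inr]
    -- The input of `G'` is glued to an output of `G`, so its beginning has to be looked for in `G`:
    -- at a vertex if that output leaves a vertex, at a global input if it is an input-output edge.
    obtain ⟨y | y, hy⟩ := G.outIdx.surjective (G'.inIdx (.inl x))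
    · rw [← hy, origin_outIdx_inl]
      exact (G'.vcomp G).origin_tgt_inl (.inr ⟨(y, x), hy⟩)
    · rw [← hy, origin_outIdx_inr]
      exact (G'.vcomp G).origin_tgt_inr (.inr ⟨(y, x), hy⟩)

theorem origin_vcomp_out (o : Fin m) :
    (G'.vcomp G).origin (.inr o) = G.vcompInr G' (G'.origin (.inr o)) := by
  obtain ⟨x | x, rfl⟩ := G'.outIdx.surjective o
  · rw [origin_outIdx_inl]
    exact (G'.vcomp G).origin_outIdx_inl (.inl x)
  · rw [origin_outIdx_inr, vcompInr, Sum.elim_inr]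
    obtain ⟨y | y, hy⟩ := G.outIdx.surjective (G'.inIdx (.inr x))
    · rw [← hy, origin_outIdx_inl]
      exact (G'.vcomp G).origin_outIdx_inl (.inr ⟨(y, x), hy⟩)
    · rw [← hy, origin_outIdx_inr]
      exact (G'.vcomp G).origin_outIdx_inr ⟨(y, x), hy⟩

end vcomp

theorem origin_lact (σ : Equiv.Perm (Fin l)) (t : (Σ v, Fin (G.inDeg v)) ⊕ Fin l) :
    (G.lact σ).origin (Sum.map id σ t) = G.origin t := by
  rcases t with t | o
  · obtain ⟨x | x, rfl⟩ := G.tgt.surjective t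
    · exact ((G.lact σ).origin_tgt_inl x).trans (G.origin_tgt_inl x).symm
    · exact ((G.lact σ).origin_tgt_inr x).trans (G.origin_tgt_inr x).symm
  · obtain ⟨x | x, rfl⟩ := G.outIdx.surjective o
    · exact ((G.lact σ).origin_outIdx_inl x).trans (G.origin_outIdx_inl x).symm
    · exact ((G.lact σ).origin_outIdx_inr x).trans (G.origin_outIdx_inr x).symm

theorem origin_ract (τ : Equiv.Perm (Fin k)) (t : (Σ v, Fin (G.inDeg v)) ⊕ Fin l) :
    (G.ract τ).origin t = Sum.map id τ.symm (G.origin t) := by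
  rcases t with t | o
  · obtain ⟨x | x, rfl⟩ := G.tgt.surjective t
    · exact ((G.ract τ).origin_tgt_inl x).trans
        (congrArg (Sum.map id τ.symm) (G.origin_tgt_inl x)).symm
    · exact ((G.ract τ).origin_tgt_inr x).trans
        (congrArg (Sum.map id τ.symm) (G.origin_tgt_inr x)).symm
  · obtain ⟨x | x, rfl⟩ := G.outIdx.surjective o
    · exact ((G.ract τ).origin_outIdx_inl x).trans
        (congrArg (Sum.map id τ.symm) (G.origin_outIdx_inl x)).symm
    · exact ((G.ract τ).origin_outIdx_inr x).trans
        (congrArg (Sum.map id τ.symm) (G.origin_outIdx_inr x)).symm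

/-- Changing the orders at a vertex changes the positions of the edges. -/
theorem origin_reorder [DecidableEq G.V] (v : G.V) (σ : Equiv.Perm (Fin (G.outDeg v)))
    (τ : Equiv.Perm (Fin (G.inDeg v))) (t : (Σ v, Fin (G.inDeg v)) ⊕ Fin l) :
    (G.reorder v σ τ).origin (Sum.map (Equiv.sigmaCongrRight
      (Pi.mulSingle (M := fun w => Equiv.Perm (Fin (G.inDeg w))) v τ)) id t) =
    Sum.map (Equiv.sigmaCongrRight
      (Pi.mulSingle (M := fun w => Equiv.Perm (Fin (G.outDeg w))) v σ⁻¹)) id (G.origin t) := by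
  -- `reorder` is built with classical decidability, with which the given instance has to be
  -- identified.
  have hd : ∀ a b, (‹DecidableEq G.V› a b) = Classical.propDecidable (a = b) :=
    fun a b => Subsingleton.elim _ _
  obtain rfl : ‹DecidableEq G.V› = fun a b => Classical.propDecidable (a = b) := by
    funext a b; exact hd a b
  rcases t with t | o
  · obtain ⟨x | x, rfl⟩ := G.tgt.surjective t
    · rw [origin_tgt_inl]
      exact (G.reorder v σ τ).origin_tgt_inl x
    · rw [origin_tgt_inr]
      exact (G.reorder v σ τ).origin_tgt_inr x
  · obtain ⟨x | x, rfl⟩ := G.outIdx.surjective o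
    · rw [origin_outIdx_inl]
      exact (G.reorder v σ τ).origin_outIdx_inl x
    · rw [origin_outIdx_inr]
      exact (G.reorder v σ τ).origin_outIdx_inr x

theorem Iso.origin_map {G H : PlanarGraph k l} (f : Iso G H)
    (t : (Σ v, Fin (G.inDeg v)) ⊕ Fin l) :
    H.origin (Sum.map (Equiv.sigmaCongr f.fV fun v => finCongr (f.inDeg_eq v)) id t) =
      Sum.map (Equiv.sigmaCongr f.fV fun v => finCongr (f.outDeg_eq v)) id (G.origin t) := by
  rcases t with t | o
  · obtain ⟨x | x, rfl⟩ := G.tgt.surjective t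
    · rw [origin_tgt_inl]
      have h1 := f.tgt_map (.inl x)
      have h2 := f.src_map (.inl x)
      exact (congrArg (fun z => H.origin (.inl z)) h1.symm).trans
        ((H.origin_tgt_inl _).trans (congrArg Sum.inl h2))
    · rw [origin_tgt_inr]
      have h1 := f.tgt_map (.inr x)
      have h2 := f.inIdx_map (.inl x)
      exact (congrArg (fun z => H.origin (.inl z)) h1.symm).trans
        ((H.origin_tgt_inr _).trans (congrArg Sum.inr h2))
  · obtain ⟨x | x, rfl⟩ := G.outIdx.surjective o
    · rw [origin_outIdx_inl]
      have h1 := f.outIdx_map (.inl x)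
      have h2 := f.src_map (.inr x)
      exact (congrArg (fun z => H.origin (.inr z)) h1.symm).trans
        ((H.origin_outIdx_inl _).trans (congrArg Sum.inl h2))
    · rw [origin_outIdx_inr]
      have h1 := f.outIdx_map (.inr x)
      have h2 := f.inIdx_map (.inr x)
      exact (congrArg (fun z => H.origin (.inr z)) h1.symm).trans
        ((H.origin_outIdx_inr _).trans (congrArg Sum.inr h2))

/-! ### Reconstruction of a planar graph from its bijection `origin` -/

section ofOrigin

variable {G} {H : PlanarGraph k l} (σ : (Σ v, Fin (G.outDeg v)) ≃ Σ v, Fin (H.outDeg v))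
  (τ : (Σ v, Fin (G.inDeg v)) ≃ Σ v, Fin (H.inDeg v))

/-- The kind of an edge can be read from `origin`: an internal edge is one which ends at a vertex
and begins at a vertex. Bijections intertwining the two origins therefore respect this kind; the
same argument handles the three other kinds. -/
theorem exists_edge_E (h : ∀ t, H.origin (Sum.map τ id t) = Sum.map σ id (G.origin t)) (x : G.E) :
    ∃ y : H.E, H.tgt (.inl y) = τ (G.tgt (.inl x)) ∧ H.src (.inl y) = σ (G.src (.inl x)) := by
  have h1 := h (.inl (G.tgt (.inl x)))
  obtain ⟨y | y, hy⟩ := H.tgt.surjective (τ (G.tgt (.inl x)))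
  · refine ⟨y, hy, ?_⟩
    rw [Sum.map_inl, ← hy] at h1
    simpa using h1
  · rw [Sum.map_inl, ← hy] at h1
    simp at h1

theorem exists_edge_I (h : ∀ t, H.origin (Sum.map τ id t) = Sum.map σ id (G.origin t)) (x : G.I) :
    ∃ y : H.I, H.tgt (.inr y) = τ (G.tgt (.inr x)) ∧ H.inIdx (.inl y) = G.inIdx (.inl x) := by
  have h1 := h (.inl (G.tgt (.inr x)))
  obtain ⟨y | y, hy⟩ := H.tgt.surjective (τ (G.tgt (.inr x)))
  · rw [Sum.map_inl, ← hy] at h1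
    simp at h1
  · refine ⟨y, hy, ?_⟩
    rw [Sum.map_inl, ← hy] at h1
    simpa using h1

theorem exists_edge_O (h : ∀ t, H.origin (Sum.map τ id t) = Sum.map σ id (G.origin t)) (x : G.O) :
    ∃ y : H.O, H.outIdx (.inl y) = G.outIdx (.inl x) ∧ H.src (.inr y) = σ (G.src (.inr x)) := by
  have h1 := h (.inr (G.outIdx (.inl x)))
  rw [origin_outIdx_inl, Sum.map_inr, id, Sum.map_inl] at h1
  obtain ⟨y | y, hy⟩ := H.outIdx.surjective (G.outIdx (.inl x))
  · refine ⟨y, hy, ?_⟩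
    rw [← hy] at h1
    simpa using h1
  · rw [← hy] at h1
    simp at h1

theorem exists_edge_InOut (h : ∀ t, H.origin (Sum.map τ id t) = Sum.map σ id (G.origin t))
    (x : G.InOut) :
    ∃ y : H.InOut, H.outIdx (.inr y) = G.outIdx (.inr x) ∧
      H.inIdx (.inr y) = G.inIdx (.inr x) := by
  have h1 := h (.inr (G.outIdx (.inr x)))
  rw [origin_outIdx_inr, Sum.map_inr, id, Sum.map_inr, id] at h1
  obtain ⟨y | y, hy⟩ := H.outIdx.surjective (G.outIdx (.inr x))
  · rw [← hy] at h1
    simp at h1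
  · refine ⟨y, hy, ?_⟩
    rw [← hy] at h1
    simpa using h1

/-- A planar graph is determined up to isomorphism by its vertices, its loops and the bijection
`origin`. -/
theorem exists_iso_of_origin (fV : G.V ≃ H.V) (fL : G.L ≃ H.L)
    (hin : ∀ v, G.inDeg v = H.inDeg (fV v)) (hout : ∀ v, G.outDeg v = H.outDeg (fV v))
    (h : ∀ t, H.origin (Sum.map (Equiv.sigmaCongr fV fun v => finCongr (hin v)) id t) =
      Sum.map (Equiv.sigmaCongr fV fun v => finCongr (hout v)) id (G.origin t)) :
    ∃ f : Iso G H, f.fV = fV := by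
  set τ : (Σ v, Fin (G.inDeg v)) ≃ Σ v, Fin (H.inDeg v) :=
    Equiv.sigmaCongr fV fun v => finCongr (hin v) with hτ
  set σ : (Σ v, Fin (G.outDeg v)) ≃ Σ v, Fin (H.outDeg v) :=
    Equiv.sigmaCongr fV fun v => finCongr (hout v) with hσ
  -- With the hypothesis stated for the inverse bijections too, the same lemmas produce the inverse
  -- maps on edges.
  have h' : ∀ t, G.origin (Sum.map τ.symm id t) = Sum.map σ.symm id (H.origin t) := by
    intro t
    have := h (Sum.map τ.symm id t)
    rw [Sum.map_map, Equiv.self_comp_symm, Function.id_comp, Sum.map_id_id, id] at this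
    rw [this, Sum.map_map, Equiv.symm_comp_self, Function.id_comp, Sum.map_id_id, id]
  choose fE hE hE' using exists_edge_E σ τ h
  choose fI hI hI' using exists_edge_I σ τ h
  choose fO hO hO' using exists_edge_O σ τ h
  choose fN hN hN' using exists_edge_InOut σ τ h
  choose gE kE kE' using exists_edge_E σ.symm τ.symm h'
  choose gI kI kI' using exists_edge_I σ.symm τ.symm h'
  choose gO kO kO' using exists_edge_O σ.symm τ.symm h'
  choose gN kN kN' using exists_edge_InOut σ.symm τ.symm h'
  refine ⟨{
    fV := fV
    fE := ⟨fE, gE, fun x => ?_, fun x => ?_⟩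
    fI := ⟨fI, gI, fun x => ?_, fun x => ?_⟩
    fO := ⟨fO, gO, fun x => ?_, fun x => ?_⟩
    fInOut := ⟨fN, gN, fun x => ?_, fun x => ?_⟩
    fL := fL
    inDeg_eq := hin
    outDeg_eq := hout
    src_map := ?_
    tgt_map := ?_
    inIdx_map := ?_
    outIdx_map := ?_ }, rfl⟩
  · exact Sum.inl_injective (G.tgt.injective (by rw [kE, hE, τ.symm_apply_apply]))
  · exact Sum.inl_injective (H.tgt.injective (by rw [hE, kE, τ.apply_symm_apply]))
  · exact Sum.inr_injective (G.tgt.injective (by rw [kI, hI, τ.symm_apply_apply]))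
  · exact Sum.inr_injective (H.tgt.injective (by rw [hI, kI, τ.apply_symm_apply]))
  · exact Sum.inl_injective (G.outIdx.injective (by rw [kO, hO]))
  · exact Sum.inl_injective (H.outIdx.injective (by rw [hO, kO]))
  · exact Sum.inr_injective (G.outIdx.injective (by rw [kN, hN]))
  · exact Sum.inr_injective (H.outIdx.injective (by rw [hN, kN]))
  · rintro (x | x)
    exacts [hE' x, hO' x]
  · rintro (x | x)
    exacts [hE x, hI x]
  · rintro (x | x)
    exacts [hI' x, hN' x]
  · rintro (x | x)
    exacts [hO x, hN x]

end ofOrigin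

/-- The adjacency of vertices in terms of `origin`. -/
theorem adj_iff {v u : G.V} :
    G.Adj v u ↔ ProP.WireAdj (In := fun v => Fin (G.inDeg v)) (Out := fun v => Fin (G.outDeg v))
      (fun t => G.origin (.inl t)) v u := by
  constructor
  · rintro ⟨e, rfl, rfl⟩
    exact ⟨_, _, G.origin_tgt_inl e⟩
  · rintro ⟨i, o, h⟩
    replace h : G.origin (.inl ⟨u, i⟩) = .inl ⟨v, o⟩ := h
    obtain ⟨x | x, hx⟩ := G.tgt.surjective ⟨u, i⟩
    · rw [← hx, origin_tgt_inl] at h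
      exact ⟨x, congrArg Sigma.fst (Sum.inl.inj h), congrArg Sigma.fst hx⟩
    · rw [← hx, origin_tgt_inr] at h
      cases h

end PlanarGraph

namespace PGr

variable {𝕜 : Type*} [Field 𝕜] {X : SymBimodule 𝕜} {k l : ℕ}

/-- The class of a decorated graph is determined by its vertices, its loops, its decorations and the
bijection `origin`. -/
theorem mk_eq_of_origin {G H : DecGraph X k l} (fV : G.graph.V ≃ H.graph.V)
    (fL : G.graph.L ≃ H.graph.L) (hin : ∀ v, G.graph.inDeg v = H.graph.inDeg (fV v))
    (hout : ∀ v, G.graph.outDeg v = H.graph.outDeg (fV v))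
    (h : ∀ t, H.graph.origin (Sum.map (Equiv.sigmaCongr fV fun v => finCongr (hin v)) id t) =
      Sum.map (Equiv.sigmaCongr fV fun v => finCongr (hout v)) id (G.graph.origin t))
    (hdec : ∀ v, H.dec (fV v) = X.castIdx (hin v) (hout v) (G.dec v)) : mk G = mk H := by
  obtain ⟨f, rfl⟩ := PlanarGraph.exists_iso_of_origin fV fL hin hout h
  exact mk_iso ⟨f, hdec⟩

end PGr

/-! ## The laws of a ProP for decorated graphs -/

theorem permBlock_castAdd {m n : ℕ} (i : Fin m) :
    permBlock m n (Fin.castAdd n i) = Fin.cast (Nat.add_comm n m) (Fin.natAdd n i) := by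
  simp [permBlock]

theorem permBlock_natAdd {m n : ℕ} (i : Fin n) :
    permBlock m n (Fin.natAdd m i) = Fin.cast (Nat.add_comm n m) (Fin.castAdd m i) := by
  simp [permBlock]

/-- The map on ends of edges induced by a bijection between vertices preserving the degrees. -/
def mapEnds {V W : Type} {a : V → ℕ} {b : W → ℕ} {f : V ≃ W} (h : ∀ v, a v = b (f v)) {m n : ℕ}
    (g : Fin m → Fin n) : (Σ v, Fin (a v)) ⊕ Fin m → (Σ w, Fin (b w)) ⊕ Fin n :=
  Sum.map (Equiv.sigmaCongr f fun v => finCongr (h v)) g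

namespace DecGraph

variable {𝕜 : Type*} [Field 𝕜]

/-- The graph with `n` input-output edges and no other edge. -/
def unitN (X : SymBimodule 𝕜) : (n : ℕ) → DecGraph X n n
  | 0 => ⟨PlanarGraph.unit0, fun v => Empty.elim v⟩
  | n + 1 => (unitN X n).hcomp ⟨PlanarGraph.unit1, fun v => Empty.elim v⟩

variable (X : SymBimodule 𝕜)

instance isEmpty_unitN_V (n : ℕ) : IsEmpty (unitN X n).graph.V := by
  induction n with
  | zero => exact inferInstanceAs (IsEmpty Empty)
  | succ n ih => exact inferInstanceAs (IsEmpty ((unitN X n).graph.V ⊕ Empty))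

instance isEmpty_unitN_L (n : ℕ) : IsEmpty (unitN X n).graph.L := by
  induction n with
  | zero => exact inferInstanceAs (IsEmpty Empty)
  | succ n ih => exact inferInstanceAs (IsEmpty ((unitN X n).graph.L ⊕ Empty))

theorem isCycleFree_unitN (n : ℕ) : (unitN X n).graph.IsCycleFree :=
  ⟨isEmpty_unitN_L X n, fun v => isEmptyElim v⟩

/-- The vertical unit laws use only this, together with the absence of vertices and loops. -/
theorem origin_unitN (n : ℕ) (i : Fin n) : (unitN X n).graph.origin (.inr i) = .inr i := by
  induction n with
  | zero => exact i.elim0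
  | succ n ih =>
    obtain ⟨x | x, rfl⟩ := finSumFinEquiv.surjective i
    · refine (PlanarGraph.origin_hcomp_castAdd _ _ x).trans ?_
      rw [ih]
      rfl
    · refine (PlanarGraph.origin_hcomp_natAdd _ PlanarGraph.unit1 x).trans ?_
      rcases h : PlanarGraph.unit1.origin (.inr x) with s | y
      · exact Empty.elim s.1
      · rw [Subsingleton.elim y x]
        rfl

end DecGraph

namespace PGr

variable {𝕜 : Type*} [Field 𝕜] {X : SymBimodule 𝕜} {k l m n k' l' m' k'' l'' : ℕ}

/-- Transport along equalities of the two indices. -/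
noncomputable def cast (hk : k = k') (hl : l = l') : PGr X k l →ₗ[𝕜] PGr X k' l' := by
  subst hk hl
  exact LinearMap.id

/-- The transport affects only the global inputs and outputs, through `Fin.cast`. -/
theorem cast_mk_eq_of_origin (hk : k = k') (hl : l = l') {G : DecGraph X k l}
    {H : DecGraph X k' l'} (fV : G.graph.V ≃ H.graph.V)
    (fL : G.graph.L ≃ H.graph.L) (hin : ∀ v, G.graph.inDeg v = H.graph.inDeg (fV v))
    (hout : ∀ v, G.graph.outDeg v = H.graph.outDeg (fV v))
    (h : ∀ t, H.graph.origin
        (mapEnds hin (Fin.cast hl) t) = mapEnds hout (Fin.cast hk) (G.graph.origin t))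
    (hdec : ∀ v, H.dec (fV v) = X.castIdx (hin v) (hout v) (G.dec v)) :
    cast hk hl (mk G) = mk H := by
  subst hk hl
  exact mk_eq_of_origin fV fL hin hout h hdec

open PlanarGraph

/-- As for most of the laws on graphs, it suffices to compare the two origins at every end of an
edge, that is at the inputs of the vertices of each factor and at the global outputs; the formulas
for `origin` of a concatenation trace the edge into the factors. -/
theorem cast_mk_hcomp_assoc (G : DecGraph X k l) (G' : DecGraph X k' l') (G'' : DecGraph X k'' l'') :
    cast (Nat.add_assoc k k' k'') (Nat.add_assoc l l' l'') (mk ((G.hcomp G').hcomp G'')) =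
      mk (G.hcomp (G'.hcomp G'')) := by
  have e₁ (a b c : ℕ) (i : Fin a) : Fin.cast (Nat.add_assoc a b c)
    (Fin.castAdd c (Fin.castAdd b i)) = Fin.castAdd (b + c) i := rfl
  have e₂ (a b c : ℕ) (i : Fin b) : Fin.cast (Nat.add_assoc a b c)
    (Fin.castAdd c (Fin.natAdd a i)) = Fin.natAdd a (Fin.castAdd c i) := rfl
  -- Unlike the two preceding equalities, this one is not definitional and needs the associativity
  -- of addition.
  have e₃ (a b c : ℕ) (i : Fin c) : Fin.cast (Nat.add_assoc a b c)
    (Fin.natAdd (a + b) i) = Fin.natAdd a (Fin.natAdd b i) := Fin.ext (Nat.add_assoc _ _ _)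
  refine cast_mk_eq_of_origin _ _ (Equiv.sumAssoc _ _ _) (Equiv.sumAssoc _ _ _)
    (by rintro ((v | v) | v) <;> rfl) (by rintro ((v | v) | v) <;> rfl) ?_
    (by rintro ((v | v) | v) <;> rfl)
  rintro (⟨(v | v) | v, i⟩ | o)
  · refine (origin_hcomp_inl G.graph (G'.hcomp G'').graph ⟨v, i⟩).trans (.trans ?_ (congrArg _
      ((origin_hcomp_inl (G.hcomp G').graph G''.graph ⟨.inl v, i⟩).trans (congrArg _
      (origin_hcomp_inl G.graph G'.graph ⟨v, i⟩))).symm))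
    rcases G.graph.origin (.inl ⟨v, i⟩) with s | s <;> rfl
  · refine ((origin_hcomp_inr G.graph (G'.hcomp G'').graph ⟨.inl v, i⟩).trans (congrArg _
      (origin_hcomp_inl G'.graph G''.graph ⟨v, i⟩))).trans (.trans ?_ (congrArg _
      ((origin_hcomp_inl (G.hcomp G').graph G''.graph ⟨.inr v, i⟩).trans (congrArg _
      (origin_hcomp_inr G.graph G'.graph ⟨v, i⟩))).symm))
    rcases G'.graph.origin (.inl ⟨v, i⟩) with s | s <;> rfl
  · refine ((origin_hcomp_inr G.graph (G'.hcomp G'').graph ⟨.inr v, i⟩).trans (congrArg _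
      (origin_hcomp_inr G'.graph G''.graph ⟨v, i⟩))).trans (.trans ?_ (congrArg _
      (origin_hcomp_inr (G.hcomp G').graph G''.graph ⟨v, i⟩).symm))
    rcases G''.graph.origin (.inl ⟨v, i⟩) with s | s
    · rfl
    · exact congrArg Sum.inr (e₃ k k' k'' s).symm
  · obtain ⟨x | x, rfl⟩ := finSumFinEquiv.surjective o
    · obtain ⟨x | x, rfl⟩ := finSumFinEquiv.surjective x
      · refine (origin_hcomp_castAdd G.graph (G'.hcomp G'').graph x).trans (.trans ?_ (congrArg _
          ((origin_hcomp_castAdd (G.hcomp G').graph G''.graph _).trans (congrArg _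
          (origin_hcomp_castAdd G.graph G'.graph x))).symm))
        rcases G.graph.origin (.inr x) with s | s <;> rfl
      · refine ((origin_hcomp_natAdd G.graph (G'.hcomp G'').graph (Fin.castAdd _ x)).trans (congrArg _
          (origin_hcomp_castAdd G'.graph G''.graph x))).trans (.trans ?_ (congrArg _
          ((origin_hcomp_castAdd (G.hcomp G').graph G''.graph _).trans (congrArg _
          (origin_hcomp_natAdd G.graph G'.graph x))).symm))
        rcases G'.graph.origin (.inr x) with s | s <;> rfl
    · refine ((congrArg (fun i => (G.hcomp (G'.hcomp G'')).graph.origin (.inr i))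
          (e₃ l l' l'' x)).trans ((origin_hcomp_natAdd G.graph (G'.hcomp G'').graph _).trans (congrArg _
          (origin_hcomp_natAdd G'.graph G''.graph x)))).trans (.trans ?_ (congrArg _
          (origin_hcomp_natAdd (G.hcomp G').graph G''.graph x).symm))
      rcases G''.graph.origin (.inr x) with s | s
      · rfl
      · exact congrArg Sum.inr (e₃ k k' k'' s).symm

theorem cast_mk_hcomp_unit0 (G : DecGraph X k l) :
    cast (Nat.add_zero k) (Nat.add_zero l) (mk (G.hcomp (DecGraph.unitN X 0))) = mk G := by
  refine cast_mk_eq_of_origin _ _ (Equiv.sumEmpty _ _) (Equiv.sumEmpty _ _)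
    (by rintro (v | v); exacts [rfl, isEmptyElim v])
    (by rintro (v | v); exacts [rfl, isEmptyElim v]) ?_
    (by rintro (v | v); exacts [rfl, isEmptyElim v])
  rintro (⟨v | v, i⟩ | o)
  · refine .trans ?_ (congrArg _ (origin_hcomp_inl G.graph
      (DecGraph.unitN X 0).graph ⟨v, i⟩).symm)
    change G.graph.origin (.inl ⟨v, i⟩) = _
    rcases G.graph.origin (.inl ⟨v, i⟩) with s | s <;> rfl
  · exact ((DecGraph.isEmpty_unitN_V X 0).false v).elim
  · obtain ⟨x | x, rfl⟩ := finSumFinEquiv.surjective o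
    · refine .trans ?_ (congrArg _ (origin_hcomp_castAdd G.graph
        (DecGraph.unitN X 0).graph x).symm)
      change G.graph.origin (.inr x) = _
      rcases G.graph.origin (.inr x) with s | s <;> rfl
    · exact x.elim0

theorem cast_mk_unit0_hcomp (G : DecGraph X k l) :
    cast (Nat.zero_add k) (Nat.zero_add l) (mk ((DecGraph.unitN X 0).hcomp G)) = mk G := by
  have e₁ (a : ℕ) (i : Fin a) : Fin.cast (Nat.zero_add a) (Fin.natAdd 0 i) = i :=
    Fin.ext (Nat.zero_add _)
  refine cast_mk_eq_of_origin _ _ (Equiv.emptySum _ _) (Equiv.emptySum _ _)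
    (by rintro (v | v); exacts [isEmptyElim v, rfl])
    (by rintro (v | v); exacts [isEmptyElim v, rfl]) ?_
    (by rintro (v | v); exacts [isEmptyElim v, rfl])
  rintro (⟨v | v, i⟩ | o)
  · exact ((DecGraph.isEmpty_unitN_V X 0).false v).elim
  · refine .trans ?_ (congrArg _ (origin_hcomp_inr (DecGraph.unitN X 0).graph
      G.graph ⟨v, i⟩).symm)
    change G.graph.origin (.inl ⟨v, i⟩) = _
    rcases G.graph.origin (.inl ⟨v, i⟩) with s | s
    · rfl
    · exact congrArg Sum.inr (e₁ k s).symm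
  · obtain ⟨x | x, rfl⟩ := finSumFinEquiv.surjective o
    · exact x.elim0
    · refine .trans ?_ (congrArg _ (origin_hcomp_natAdd (DecGraph.unitN X 0).graph
        G.graph x).symm)
      refine (congrArg (fun i => G.graph.origin (.inr i)) (e₁ l x)).trans ?_
      rcases G.graph.origin (.inr x) with s | s
      · rfl
      · exact congrArg Sum.inr (e₁ k s).symm

/-- An edge arriving in `G''` may have to be traced back through `G'` and then through `G`.
Accordingly `h₁`, `h₂`, `h₃` compare the beginnings of edges of `G`, `G'`, `G''` in the two
composites, and each rests on the preceding one. -/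
theorem mk_vcomp_assoc (G'' : DecGraph X m n) (G' : DecGraph X l m) (G : DecGraph X k l) :
    mk (G''.vcomp (G'.vcomp G)) = mk ((G''.vcomp G').vcomp G) := by
  have hin : ∀ v, (G''.vcomp (G'.vcomp G)).graph.inDeg v =
      ((G''.vcomp G').vcomp G).graph.inDeg (Equiv.sumAssoc _ _ _ v) := by
    rintro ((v | v) | v) <;> rfl
  have hout : ∀ v, (G''.vcomp (G'.vcomp G)).graph.outDeg v =
      ((G''.vcomp G').vcomp G).graph.outDeg (Equiv.sumAssoc _ _ _ v) := by
    rintro ((v | v) | v) <;> rfl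
  have h₁ : ∀ s, G.graph.vcompInl (G''.vcomp G').graph s =
      mapEnds hout id
        ((G'.vcomp G).graph.vcompInl G''.graph (G.graph.vcompInl G'.graph s)) := by
    rintro (s | s) <;> rfl
  have h₂ : ∀ s, G.graph.vcompInr (G''.vcomp G').graph (G'.graph.vcompInl G''.graph s) =
      mapEnds hout id
        ((G'.vcomp G).graph.vcompInl G''.graph (G.graph.vcompInr G'.graph s)) := by
    rintro (s | s)
    · rfl
    · exact h₁ _
  have h₃ : ∀ s, G.graph.vcompInr (G''.vcomp G').graph (G'.graph.vcompInr G''.graph s) =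
      mapEnds hout id
        ((G'.vcomp G).graph.vcompInr G''.graph s) := by
    rintro (s | s)
    · rfl
    · exact (h₂ _).trans (congrArg (fun z => mapEnds hout id ((G'.vcomp G).graph.vcompInl G''.graph z))
        (origin_vcomp_out G.graph G'.graph s).symm)
  refine mk_eq_of_origin (Equiv.sumAssoc _ _ _) (Equiv.sumAssoc _ _ _) hin hout ?_
    (by rintro ((v | v) | v) <;> rfl)
  rintro (⟨(v | v) | v, i⟩ | o)
  · exact (origin_vcomp_inl G.graph (G''.vcomp G').graph ⟨v, i⟩).trans ((h₁ _).trans (congrArg _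
      ((origin_vcomp_inl (G'.vcomp G).graph G''.graph ⟨.inl v, i⟩).trans (congrArg _
      (origin_vcomp_inl G.graph G'.graph ⟨v, i⟩))).symm))
  · exact ((origin_vcomp_inr G.graph (G''.vcomp G').graph ⟨.inl v, i⟩).trans (congrArg _
      (origin_vcomp_inl G'.graph G''.graph ⟨v, i⟩))).trans ((h₂ _).trans (congrArg _
      ((origin_vcomp_inl (G'.vcomp G).graph G''.graph ⟨.inr v, i⟩).trans (congrArg _
      (origin_vcomp_inr G.graph G'.graph ⟨v, i⟩))).symm))
  · exact ((origin_vcomp_inr G.graph (G''.vcomp G').graph ⟨.inr v, i⟩).trans (congrArg _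
      (origin_vcomp_inr G'.graph G''.graph ⟨v, i⟩))).trans ((h₃ _).trans (congrArg _
      (origin_vcomp_inr (G'.vcomp G).graph G''.graph ⟨v, i⟩).symm))
  · exact ((origin_vcomp_out G.graph (G''.vcomp G').graph o).trans (congrArg _
      (origin_vcomp_out G'.graph G''.graph o))).trans ((h₃ _).trans (congrArg _
      (origin_vcomp_out (G'.vcomp G).graph G''.graph o).symm))

theorem mk_vcomp_unitN (G : DecGraph X k l) : mk (G.vcomp (DecGraph.unitN X k)) = mk G := by
  have hin : ∀ v, (G.vcomp (DecGraph.unitN X k)).graph.inDeg v =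
      G.graph.inDeg (Equiv.emptySum _ _ v) := by
    rintro (v | v); exacts [isEmptyElim v, rfl]
  have hout : ∀ v, (G.vcomp (DecGraph.unitN X k)).graph.outDeg v =
      G.graph.outDeg (Equiv.emptySum _ _ v) := by
    rintro (v | v); exacts [isEmptyElim v, rfl]
  have h : ∀ s, s =
      mapEnds hout id
        ((DecGraph.unitN X k).graph.vcompInr G.graph s) := by
    rintro (s | s)
    · rfl
    · exact (congrArg (fun z => mapEnds hout id ((DecGraph.unitN X k).graph.vcompInl G.graph z))
        (DecGraph.origin_unitN X k s)).symm
  refine mk_eq_of_origin (Equiv.emptySum _ _) (Equiv.emptySum _ _) hin hout ?_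
    (by rintro (v | v); exacts [isEmptyElim v, rfl])
  rintro (⟨v | v, i⟩ | o)
  · exact ((DecGraph.isEmpty_unitN_V X k).false v).elim
  · exact (h _).trans (congrArg _
      (origin_vcomp_inr (DecGraph.unitN X k).graph G.graph ⟨v, i⟩).symm)
  · exact (h _).trans (congrArg _
      (origin_vcomp_out (DecGraph.unitN X k).graph G.graph o).symm)

theorem mk_unitN_vcomp (G : DecGraph X k l) : mk ((DecGraph.unitN X l).vcomp G) = mk G := by
  have hin : ∀ v, ((DecGraph.unitN X l).vcomp G).graph.inDeg v =
      G.graph.inDeg (Equiv.sumEmpty _ _ v) := by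
    rintro (v | v); exacts [rfl, isEmptyElim v]
  have hout : ∀ v, ((DecGraph.unitN X l).vcomp G).graph.outDeg v =
      G.graph.outDeg (Equiv.sumEmpty _ _ v) := by
    rintro (v | v); exacts [rfl, isEmptyElim v]
  have h : ∀ s, s =
      mapEnds hout id
        (G.graph.vcompInl (DecGraph.unitN X l).graph s) := by
    rintro (s | s) <;> rfl
  refine mk_eq_of_origin (Equiv.sumEmpty _ _) (Equiv.sumEmpty _ _) hin hout ?_
    (by rintro (v | v); exacts [rfl, isEmptyElim v])
  rintro (⟨v | v, i⟩ | o)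
  · exact (h _).trans (congrArg _
      (origin_vcomp_inl G.graph (DecGraph.unitN X l).graph ⟨v, i⟩).symm)
  · exact ((DecGraph.isEmpty_unitN_V X l).false v).elim
  · exact (h _).trans (congrArg _
      ((origin_vcomp_out G.graph (DecGraph.unitN X l).graph o).trans
      (congrArg _ (DecGraph.origin_unitN X l o))).symm)

/-- The gluing never mixes the two juxtaposed halves. `h₁` and `h₁'` deal with edges traced in `q`
and `q'`; `h₂` and `h₂'` deal with edges traced in `p` and `p'`, which may continue into `q` or
`q'`. -/
theorem mk_hcomp_vcomp_hcomp (p : DecGraph X l m) (p' : DecGraph X l' m') (q : DecGraph X k l)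
    (q' : DecGraph X k' l') :
    mk ((p.hcomp p').vcomp (q.hcomp q')) = mk ((p.vcomp q).hcomp (p'.vcomp q')) := by
  have hin : ∀ v, ((p.hcomp p').vcomp (q.hcomp q')).graph.inDeg v =
      ((p.vcomp q).hcomp (p'.vcomp q')).graph.inDeg (Equiv.sumSumSumComm _ _ _ _ v) := by
    rintro ((v | v) | (v | v)) <;> rfl
  have hout : ∀ v, ((p.hcomp p').vcomp (q.hcomp q')).graph.outDeg v =
      ((p.vcomp q).hcomp (p'.vcomp q')).graph.outDeg (Equiv.sumSumSumComm _ _ _ _ v) := by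
    rintro ((v | v) | (v | v)) <;> rfl
  have h₁ : ∀ s, (p.vcomp q).graph.hcompInl (p'.vcomp q').graph (q.graph.vcompInl p.graph s) =
      mapEnds hout id
        ((q.hcomp q').graph.vcompInl (p.hcomp p').graph (q.graph.hcompInl q'.graph s)) := by
    rintro (s | s) <;> rfl
  have h₁' : ∀ s, (p.vcomp q).graph.hcompInr (p'.vcomp q').graph (q'.graph.vcompInl p'.graph s) =
      mapEnds hout id
        ((q.hcomp q').graph.vcompInl (p.hcomp p').graph (q.graph.hcompInr q'.graph s)) := by
    rintro (s | s) <;> rfl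
  have h₂ : ∀ s, (p.vcomp q).graph.hcompInl (p'.vcomp q').graph (q.graph.vcompInr p.graph s) =
      mapEnds hout id
        ((q.hcomp q').graph.vcompInr (p.hcomp p').graph (p.graph.hcompInl p'.graph s)) := by
    rintro (s | s)
    · rfl
    · exact (h₁ _).trans (congrArg (fun z => mapEnds hout id
        ((q.hcomp q').graph.vcompInl (p.hcomp p').graph z))
        (origin_hcomp_castAdd q.graph q'.graph s).symm)
  have h₂' : ∀ s, (p.vcomp q).graph.hcompInr (p'.vcomp q').graph (q'.graph.vcompInr p'.graph s) =
      mapEnds hout id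
        ((q.hcomp q').graph.vcompInr (p.hcomp p').graph (p.graph.hcompInr p'.graph s)) := by
    rintro (s | s)
    · rfl
    · exact (h₁' _).trans (congrArg (fun z => mapEnds hout id
        ((q.hcomp q').graph.vcompInl (p.hcomp p').graph z))
        (origin_hcomp_natAdd q.graph q'.graph s).symm)
  refine mk_eq_of_origin (Equiv.sumSumSumComm _ _ _ _) (Equiv.sumSumSumComm _ _ _ _) hin hout ?_
    (by rintro ((v | v) | (v | v)) <;> rfl)
  rintro (⟨(v | v) | (v | v), i⟩ | o)
  · exact ((origin_hcomp_inl (p.vcomp q).graph (p'.vcomp q').graph ⟨.inl v, i⟩).trans (congrArg _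
      (origin_vcomp_inl q.graph p.graph ⟨v, i⟩))).trans ((h₁ _).trans (congrArg _
      ((origin_vcomp_inl (q.hcomp q').graph (p.hcomp p').graph ⟨.inl v, i⟩).trans (congrArg _
      (origin_hcomp_inl q.graph q'.graph ⟨v, i⟩))).symm))
  · exact ((origin_hcomp_inr (p.vcomp q).graph (p'.vcomp q').graph ⟨.inl v, i⟩).trans (congrArg _
      (origin_vcomp_inl q'.graph p'.graph ⟨v, i⟩))).trans ((h₁' _).trans (congrArg _
      ((origin_vcomp_inl (q.hcomp q').graph (p.hcomp p').graph ⟨.inr v, i⟩).trans (congrArg _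
      (origin_hcomp_inr q.graph q'.graph ⟨v, i⟩))).symm))
  · exact ((origin_hcomp_inl (p.vcomp q).graph (p'.vcomp q').graph ⟨.inr v, i⟩).trans (congrArg _
      (origin_vcomp_inr q.graph p.graph ⟨v, i⟩))).trans ((h₂ _).trans (congrArg _
      ((origin_vcomp_inr (q.hcomp q').graph (p.hcomp p').graph ⟨.inl v, i⟩).trans (congrArg _
      (origin_hcomp_inl p.graph p'.graph ⟨v, i⟩))).symm))
  · exact ((origin_hcomp_inr (p.vcomp q).graph (p'.vcomp q').graph ⟨.inr v, i⟩).trans (congrArg _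
      (origin_vcomp_inr q'.graph p'.graph ⟨v, i⟩))).trans ((h₂' _).trans (congrArg _
      ((origin_vcomp_inr (q.hcomp q').graph (p.hcomp p').graph ⟨.inr v, i⟩).trans (congrArg _
      (origin_hcomp_inr p.graph p'.graph ⟨v, i⟩))).symm))
  · obtain ⟨x | x, rfl⟩ := finSumFinEquiv.surjective o
    · exact ((origin_hcomp_castAdd (p.vcomp q).graph (p'.vcomp q').graph x).trans (congrArg _
        (origin_vcomp_out q.graph p.graph x))).trans ((h₂ _).trans (congrArg _
        ((origin_vcomp_out (q.hcomp q').graph (p.hcomp p').graph _).trans (congrArg _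
        (origin_hcomp_castAdd p.graph p'.graph x))).symm))
    · exact ((origin_hcomp_natAdd (p.vcomp q).graph (p'.vcomp q').graph x).trans (congrArg _
        (origin_vcomp_out q'.graph p'.graph x))).trans ((h₂' _).trans (congrArg _
        ((origin_vcomp_out (q.hcomp q').graph (p.hcomp p').graph _).trans (congrArg _
        (origin_hcomp_natAdd p.graph p'.graph x))).symm))

/-- An output numbered `i` is glued to an input numbered `j` on the left side when `i = τ⁻¹ j`, and
on the right side when `τ i = j`. -/
theorem mk_vcomp_middle (τ : Equiv.Perm (Fin l)) (p : DecGraph X l m) (q : DecGraph X k l) :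
    mk ((p.ract τ).vcomp q) = mk (p.vcomp (q.lact τ)) := by
  have h₁ : ∀ s, (q.lact τ).graph.vcompInr p.graph s =
      q.graph.vcompInr (p.ract τ).graph (Sum.map id τ.symm s) := by
    rintro (s | s)
    · rfl
    · exact congrArg (q.graph.vcompInl p.graph) ((congrArg (fun i =>
        (q.graph.lact τ).origin (.inr i)) (τ.apply_symm_apply s).symm).trans
        (q.graph.origin_lact τ (.inr (τ.symm s))))
  refine mk_eq_of_origin (Equiv.refl _) (Equiv.refl _) (fun _ => rfl) (fun _ => rfl) ?_
    (fun _ => rfl)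
  intro t
  -- The vertices, and the positions around them, are the same in both graphs, so the maps on ends
  -- and beginnings are identities.
  refine .trans (b := ((p.ract τ).vcomp q).graph.origin t) ?_
    (by rcases ((p.ract τ).vcomp q).graph.origin t with s | s <;> rfl)
  rcases t with ⟨v | v, i⟩ | o
  · refine (origin_vcomp_inl (q.lact τ).graph p.graph ⟨v, i⟩).trans (.trans ?_
      (origin_vcomp_inl q.graph (p.ract τ).graph ⟨v, i⟩).symm)
    exact congrArg (q.graph.vcompInl p.graph) (q.graph.origin_lact τ (.inl ⟨v, i⟩))
  · refine (origin_vcomp_inr (q.lact τ).graph p.graph ⟨v, i⟩).trans (.trans ?_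
      (origin_vcomp_inr q.graph (p.ract τ).graph ⟨v, i⟩).symm)
    exact (h₁ _).trans (congrArg (q.graph.vcompInr (p.ract τ).graph)
      (p.graph.origin_ract τ (.inl ⟨v, i⟩)).symm)
  · refine (origin_vcomp_out (q.lact τ).graph p.graph o).trans (.trans ?_
      (origin_vcomp_out q.graph (p.ract τ).graph o).symm)
    exact (h₁ _).trans (congrArg (q.graph.vcompInr (p.ract τ).graph)
      (p.graph.origin_ract τ (.inr o)).symm)

/-- The two graphs have the same data except for the numbering of the outputs, so they are equal and
not only isomorphic. -/
theorem hcomp_lact_eq (σ : Equiv.Perm (Fin l)) (σ' : Equiv.Perm (Fin l')) (p : DecGraph X k l)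
    (p' : DecGraph X k' l') :
    (p.lact σ).hcomp (p'.lact σ') = (p.hcomp p').lact (permTensor σ σ') := by
  refine congrArg (fun f => (⟨{ p.graph.hcomp p'.graph with outIdx := f },
    DecGraph.sumDec p.dec p'.dec⟩ : DecGraph X (k + k') (l + l'))) ?_
  ext1 x
  rcases x with (x | x) | (x | x)
  · exact congrArg (fun z => finSumFinEquiv (Equiv.sumCongr σ σ' z))
      (finSumFinEquiv.symm_apply_apply (.inl (p.graph.outIdx (.inl x)))).symm
  · exact congrArg (fun z => finSumFinEquiv (Equiv.sumCongr σ σ' z))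
      (finSumFinEquiv.symm_apply_apply (.inr (p'.graph.outIdx (.inl x)))).symm
  · exact congrArg (fun z => finSumFinEquiv (Equiv.sumCongr σ σ' z))
      (finSumFinEquiv.symm_apply_apply (.inl (p.graph.outIdx (.inr x)))).symm
  · exact congrArg (fun z => finSumFinEquiv (Equiv.sumCongr σ σ' z))
      (finSumFinEquiv.symm_apply_apply (.inr (p'.graph.outIdx (.inr x)))).symm

theorem hcomp_ract_eq (τ : Equiv.Perm (Fin k)) (τ' : Equiv.Perm (Fin k')) (p : DecGraph X k l)
    (p' : DecGraph X k' l') :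
    (p.ract τ).hcomp (p'.ract τ') = (p.hcomp p').ract (permTensor τ τ') := by
  refine congrArg (fun f => (⟨{ p.graph.hcomp p'.graph with inIdx := f },
    DecGraph.sumDec p.dec p'.dec⟩ : DecGraph X (k + k') (l + l'))) ?_
  ext1 x
  rcases x with (x | x) | (x | x)
  · exact congrArg (fun z => finSumFinEquiv ((Equiv.sumCongr τ τ').symm z))
      (finSumFinEquiv.symm_apply_apply (.inl (p.graph.inIdx (.inl x)))).symm
  · exact congrArg (fun z => finSumFinEquiv ((Equiv.sumCongr τ τ').symm z))
      (finSumFinEquiv.symm_apply_apply (.inr (p'.graph.inIdx (.inl x)))).symm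
  · exact congrArg (fun z => finSumFinEquiv ((Equiv.sumCongr τ τ').symm z))
      (finSumFinEquiv.symm_apply_apply (.inl (p.graph.inIdx (.inr x)))).symm
  · exact congrArg (fun z => finSumFinEquiv ((Equiv.sumCongr τ τ').symm z))
      (finSumFinEquiv.symm_apply_apply (.inr (p'.graph.inIdx (.inr x)))).symm

/-- Exchanging the two sets of vertices is an isomorphism once inputs and outputs are renumbered by
blocks. The right action renumbers inputs by the inverse permutation, hence the inverse of
`permBlock k k'`. -/
theorem cast_mk_hcomp_comm (p : DecGraph X k l) (p' : DecGraph X k' l') :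
    cast (Nat.add_comm k' k) (Nat.add_comm l' l) (mk (p'.hcomp p)) =
      mk (((p.hcomp p').lact (permBlock l l')).ract (permBlock k k')⁻¹) := by
  set H := ((p.hcomp p').lact (permBlock l l')).ract (permBlock k k')⁻¹ with hH
  have hin : ∀ v, (p'.hcomp p).graph.inDeg v = H.graph.inDeg (Equiv.sumComm _ _ v) := by
    rintro (v | v) <;> rfl
  have hout : ∀ v, (p'.hcomp p).graph.outDeg v = H.graph.outDeg (Equiv.sumComm _ _ v) := by
    rintro (v | v) <;> rfl
  have h₀ : ∀ t, H.graph.origin (Sum.map id (permBlock l l') t) =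
      Sum.map id (permBlock k k') ((p.hcomp p').graph.origin t) := fun t =>
    (((p.hcomp p').lact _).graph.origin_ract _ _).trans
      (congrArg (Sum.map id (permBlock k k')) ((p.hcomp p').graph.origin_lact _ _))
  have h₁ : ∀ s, Sum.map id (permBlock k k') (p.graph.hcompInr p'.graph s) =
      mapEnds hout (Fin.cast (Nat.add_comm k' k)) (p'.graph.hcompInl p.graph s) := by
    rintro (s | s)
    · rfl
    · exact congrArg Sum.inr (permBlock_natAdd s)
  have h₂ : ∀ s, Sum.map id (permBlock k k') (p.graph.hcompInl p'.graph s) =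
      mapEnds hout (Fin.cast (Nat.add_comm k' k)) (p'.graph.hcompInr p.graph s) := by
    rintro (s | s)
    · rfl
    · exact congrArg Sum.inr (permBlock_castAdd s)
  refine cast_mk_eq_of_origin _ _ (Equiv.sumComm _ _) (Equiv.sumComm _ _) hin hout ?_
    (by rintro (v | v) <;> rfl)
  rintro (⟨v | v, i⟩ | o)
  · exact (h₀ (.inl ⟨.inr v, i⟩)).trans ((congrArg _ (origin_hcomp_inr p.graph p'.graph ⟨v, i⟩)).trans
      ((h₁ _).trans (congrArg _ (origin_hcomp_inl p'.graph p.graph ⟨v, i⟩).symm)))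
  · exact (h₀ (.inl ⟨.inl v, i⟩)).trans ((congrArg _ (origin_hcomp_inl p.graph p'.graph ⟨v, i⟩)).trans
      ((h₂ _).trans (congrArg _ (origin_hcomp_inr p'.graph p.graph ⟨v, i⟩).symm)))
  · obtain ⟨x | x, rfl⟩ := finSumFinEquiv.surjective o
    · exact (congrArg (fun z => H.graph.origin (.inr z)) (permBlock_natAdd x).symm).trans
        ((h₀ (.inr (Fin.natAdd l x))).trans
        ((congrArg _ (origin_hcomp_natAdd p.graph p'.graph x)).trans
        ((h₁ _).trans (congrArg _ (origin_hcomp_castAdd p'.graph p.graph x).symm))))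
    · exact (congrArg (fun z => H.graph.origin (.inr z)) (permBlock_castAdd x).symm).trans
        ((h₀ (.inr (Fin.castAdd l' x))).trans
        ((congrArg _ (origin_hcomp_castAdd p.graph p'.graph x)).trans
        ((h₂ _).trans (congrArg _ (origin_hcomp_natAdd p'.graph p.graph x).symm))))

end PGr

/-! ### Extension of the laws to linear combinations of graphs -/

namespace PGr

variable {𝕜 : Type*} [Field 𝕜] {X : SymBimodule 𝕜} {k l m n k' l' m' k'' l'' : ℕ}

/-- Both sides are linear in each argument, so decorated graphs suffice; the other laws are extended
in the same way. -/
theorem cast_hcomp_assoc (x : PGr X k l) (y : PGr X k' l') (z : PGr X k'' l'') :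
    cast (Nat.add_assoc k k' k'') (Nat.add_assoc l l' l'') (hcomp (hcomp x y) z) =
      hcomp x (hcomp y z) := by
  induction x using induction_mk with
  | h0 => simp
  | hadd x x' hx hx' => simp only [map_add, LinearMap.add_apply, hx, hx']
  | hmk a G =>
    simp only [map_smul, LinearMap.smul_apply]
    congr 1
    induction y using induction_mk with
    | h0 => simp
    | hadd x x' hx hx' => simp only [map_add, LinearMap.add_apply, hx, hx']
    | hmk a G' =>
      simp only [map_smul, LinearMap.smul_apply]
      congr 1
      induction z using induction_mk with
      | h0 => simp
      | hadd x x' hx hx' => simp only [map_add, hx, hx']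
      | hmk a G'' =>
        simp only [map_smul, hcomp_mk, cast_mk_hcomp_assoc]

theorem cast_hcomp_unit0 (x : PGr X k l) :
    cast (Nat.add_zero k) (Nat.add_zero l) (hcomp x (mk (DecGraph.unitN X 0))) = x := by
  induction x using induction_mk with
  | h0 => simp
  | hadd x x' hx hx' => simp only [map_add, LinearMap.add_apply, hx, hx']
  | hmk a G => simp only [map_smul, LinearMap.smul_apply, hcomp_mk, cast_mk_hcomp_unit0]

theorem cast_unit0_hcomp (x : PGr X k l) :
    cast (Nat.zero_add k) (Nat.zero_add l) (hcomp (mk (DecGraph.unitN X 0)) x) = x := by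
  induction x using induction_mk with
  | h0 => simp
  | hadd x x' hx hx' => simp only [map_add, hx, hx']
  | hmk a G => simp only [map_smul, hcomp_mk, cast_mk_unit0_hcomp]

theorem vcomp_assoc (x : PGr X m n) (y : PGr X l m) (z : PGr X k l) :
    vcomp x (vcomp y z) = vcomp (vcomp x y) z := by
  induction x using induction_mk with
  | h0 => simp
  | hadd x x' hx hx' => simp only [map_add, LinearMap.add_apply, hx, hx']
  | hmk a G =>
    simp only [map_smul, LinearMap.smul_apply]
    congr 1
    induction y using induction_mk with
    | h0 => simp
    | hadd x x' hx hx' => simp only [map_add, LinearMap.add_apply, hx, hx']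
    | hmk a G' =>
      simp only [map_smul, LinearMap.smul_apply]
      congr 1
      induction z using induction_mk with
      | h0 => simp
      | hadd x x' hx hx' => simp only [map_add, hx, hx']
      | hmk a G'' =>
        simp only [map_smul, vcomp_mk, mk_vcomp_assoc]

theorem vcomp_unitN (x : PGr X k l) : vcomp x (mk (DecGraph.unitN X k)) = x := by
  induction x using induction_mk with
  | h0 => simp
  | hadd x x' hx hx' => simp only [map_add, LinearMap.add_apply, hx, hx']
  | hmk a G => simp only [map_smul, LinearMap.smul_apply, vcomp_mk, mk_vcomp_unitN]

theorem unitN_vcomp (x : PGr X k l) : vcomp (mk (DecGraph.unitN X l)) x = x := by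
  induction x using induction_mk with
  | h0 => simp
  | hadd x x' hx hx' => simp only [map_add, hx, hx']
  | hmk a G => simp only [map_smul, vcomp_mk, mk_unitN_vcomp]

theorem hcomp_vcomp_hcomp (p : PGr X l m) (p' : PGr X l' m') (q : PGr X k l) (q' : PGr X k' l') :
    vcomp (hcomp p p') (hcomp q q') = hcomp (vcomp p q) (vcomp p' q') := by
  induction p using induction_mk with
  | h0 => simp
  | hadd x x' hx hx' => simp only [map_add, LinearMap.add_apply, hx, hx']
  | hmk a P =>
    simp only [map_smul, LinearMap.smul_apply]
    congr 1
    induction p' using induction_mk with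
    | h0 => simp
    | hadd x x' hx hx' => simp only [map_add, LinearMap.add_apply, hx, hx']
    | hmk a P' =>
      simp only [map_smul, LinearMap.smul_apply]
      congr 1
      induction q using induction_mk with
      | h0 => simp
      | hadd x x' hx hx' => simp only [map_add, LinearMap.add_apply, hx, hx']
      | hmk a Q =>
        simp only [map_smul, LinearMap.smul_apply]
        congr 1
        induction q' using induction_mk with
        | h0 => simp
        | hadd x x' hx hx' => simp only [map_add, hx, hx']
        | hmk a Q' => simp only [map_smul, vcomp_mk, hcomp_mk, mk_hcomp_vcomp_hcomp]

theorem lact_vcomp (σ : Equiv.Perm (Fin m)) (p : PGr X l m) (q : PGr X k l) :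
    lact σ (vcomp p q) = vcomp (lact σ p) q := by
  induction p using induction_mk with
  | h0 => simp
  | hadd x x' hx hx' => simp only [map_add, LinearMap.add_apply, hx, hx']
  | hmk a P =>
    simp only [map_smul, LinearMap.smul_apply]
    congr 1
    induction q using induction_mk with
    | h0 => simp
    | hadd x x' hx hx' => simp only [map_add, hx, hx']
    | hmk a Q =>
      simp only [map_smul, vcomp_mk, lact_mk]
      rfl

theorem ract_vcomp (σ : Equiv.Perm (Fin k)) (p : PGr X l m) (q : PGr X k l) :
    ract σ (vcomp p q) = vcomp p (ract σ q) := by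
  induction p using induction_mk with
  | h0 => simp
  | hadd x x' hx hx' => simp only [map_add, LinearMap.add_apply, hx, hx']
  | hmk a P =>
    simp only [map_smul, LinearMap.smul_apply]
    congr 1
    induction q using induction_mk with
    | h0 => simp
    | hadd x x' hx hx' => simp only [map_add, hx, hx']
    | hmk a Q =>
      simp only [map_smul, vcomp_mk, ract_mk]
      rfl

theorem vcomp_middle (τ : Equiv.Perm (Fin l)) (p : PGr X l m) (q : PGr X k l) :
    vcomp (ract τ p) q = vcomp p (lact τ q) := by
  induction p using induction_mk with
  | h0 => simp
  | hadd x x' hx hx' => simp only [map_add, LinearMap.add_apply, hx, hx']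
  | hmk a P =>
    simp only [map_smul, LinearMap.smul_apply]
    congr 1
    induction q using induction_mk with
    | h0 => simp
    | hadd x x' hx hx' => simp only [map_add, hx, hx']
    | hmk a Q => simp only [map_smul, vcomp_mk, ract_mk, lact_mk, mk_vcomp_middle]

theorem hcomp_lact (σ : Equiv.Perm (Fin l)) (σ' : Equiv.Perm (Fin l')) (p : PGr X k l)
    (q : PGr X k' l') : hcomp (lact σ p) (lact σ' q) = lact (permTensor σ σ') (hcomp p q) := by
  induction p using induction_mk with
  | h0 => simp
  | hadd x x' hx hx' => simp only [map_add, LinearMap.add_apply, hx, hx']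
  | hmk a P =>
    simp only [map_smul, LinearMap.smul_apply]
    congr 1
    induction q using induction_mk with
    | h0 => simp
    | hadd x x' hx hx' => simp only [map_add, hx, hx']
    | hmk a Q => simp only [map_smul, hcomp_mk, lact_mk, hcomp_lact_eq]

theorem hcomp_ract (σ : Equiv.Perm (Fin k)) (σ' : Equiv.Perm (Fin k')) (p : PGr X k l)
    (q : PGr X k' l') : hcomp (ract σ p) (ract σ' q) = ract (permTensor σ σ') (hcomp p q) := by
  induction p using induction_mk with
  | h0 => simp
  | hadd x x' hx hx' => simp only [map_add, LinearMap.add_apply, hx, hx']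
  | hmk a P =>
    simp only [map_smul, LinearMap.smul_apply]
    congr 1
    induction q using induction_mk with
    | h0 => simp
    | hadd x x' hx hx' => simp only [map_add, hx, hx']
    | hmk a Q => simp only [map_smul, hcomp_mk, ract_mk, hcomp_ract_eq]

theorem hcomp_comm (p : PGr X k l) (q : PGr X k' l') :
    lact (permBlock l l') (hcomp p q) = ract (permBlock k k')
      (cast (Nat.add_comm k' k) (Nat.add_comm l' l) (hcomp q p)) := by
  induction p using induction_mk with
  | h0 => simp
  | hadd x x' hx hx' => simp only [map_add, LinearMap.add_apply, hx, hx']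
  | hmk a P =>
    simp only [map_smul, LinearMap.smul_apply]
    congr 1
    induction q using induction_mk with
    | h0 => simp
    | hadd x x' hx hx' => simp only [map_add, LinearMap.add_apply, hx, hx']
    | hmk a Q =>
      simp only [map_smul, LinearMap.smul_apply, hcomp_mk, cast_mk_hcomp_comm, lact_mk]
      -- The inverse block permutation supplied by `cast_mk_hcomp_comm` cancels against the right
      -- action.
      rw [← ract_mk, ract_mul, inv_mul_cancel, ract_one]

end PGr

/-! ### The laws of a ProP in the subquotient -/

namespace GammaUp

variable {𝕜 : Type u} [Field 𝕜] {X : SymBimodule.{u, v} 𝕜} {k l m k' l' : ℕ}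

/-- The class of an element of `PGr↑(X)`. -/
noncomputable def ofPGr (x : PGr X k l) (hx : x ∈ PGrUp X k l) : (GammaUp X).carrier k l :=
  Submodule.Quotient.mk (p := (permSubmodule X k l).submoduleOf (PGrUp X k l)) ⟨x, hx⟩

theorem exists_ofPGr (x : (GammaUp X).carrier k l) : ∃ y hy, ofPGr y hy = x := by
  obtain ⟨⟨y, hy⟩, rfl⟩ := Submodule.Quotient.mk_surjective _ x
  exact ⟨y, hy, rfl⟩

theorem ofPGr_congr {x y : PGr X k l} (h : x = y) (hx : x ∈ PGrUp X k l) (hy : y ∈ PGrUp X k l) :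
    ofPGr x hx = ofPGr y hy := by
  subst h; rfl

theorem cast_mem_up (hk : k = k') (hl : l = l') {x : PGr X k l} (hx : x ∈ PGrUp X k l) :
    PGr.cast hk hl x ∈ PGrUp X k' l' := by
  subst hk hl; exact hx

theorem castIdx_ofPGr (hk : k = k') (hl : l = l') (x : PGr X k l) (hx : x ∈ PGrUp X k l) :
    (GammaUp X).castIdx hk hl (ofPGr x hx) = ofPGr (PGr.cast hk hl x) (cast_mem_up hk hl hx) := by
  subst hk hl; rfl

theorem unitN_eq (n : ℕ) : (GammaUp X).unitN n =
    ofPGr (PGr.mk (DecGraph.unitN X n)) (PGr.mk_mem_up (DecGraph.isCycleFree_unitN X n)) := by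
  induction n with
  | zero => rfl
  | succ n ih =>
    rw [PreProP.unitN, ih]
    exact ofPGr_congr (PGr.hcomp_mk _ _) _ _

/-- Every law already holds in `PGr`, without any condition on cycles, so it only has to be read on
representatives. -/
theorem isProP (X : SymBimodule.{u, v} 𝕜) : (GammaUp X).IsProP where
  hcomp_assoc p p' p'' := by
    obtain ⟨p, hp, rfl⟩ := exists_ofPGr p
    obtain ⟨p', hp', rfl⟩ := exists_ofPGr p'
    obtain ⟨p'', hp'', rfl⟩ := exists_ofPGr p''
    exact (castIdx_ofPGr _ _ _ (PGr.hcomp_mem_up (PGr.hcomp_mem_up hp hp') hp'')).trans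
      (ofPGr_congr (PGr.cast_hcomp_assoc p p' p'') _ _)
  hcomp_unit0 p := by
    obtain ⟨p, hp, rfl⟩ := exists_ofPGr p
    exact (castIdx_ofPGr _ _ _ (PGr.hcomp_mem_up hp (PGr.mk_mem_up
      (DecGraph.isCycleFree_unitN X 0)))).trans (ofPGr_congr (PGr.cast_hcomp_unit0 p) _ _)
  unit0_hcomp p := by
    obtain ⟨p, hp, rfl⟩ := exists_ofPGr p
    exact (castIdx_ofPGr _ _ _ (PGr.hcomp_mem_up (PGr.mk_mem_up
      (DecGraph.isCycleFree_unitN X 0)) hp)).trans (ofPGr_congr (PGr.cast_unit0_hcomp p) _ _)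
  vcomp_assoc p q r := by
    obtain ⟨p, hp, rfl⟩ := exists_ofPGr p
    obtain ⟨q, hq, rfl⟩ := exists_ofPGr q
    obtain ⟨r, hr, rfl⟩ := exists_ofPGr r
    exact ofPGr_congr (PGr.vcomp_assoc p q r) _ _
  vcomp_unitN p := by
    obtain ⟨p, hp, rfl⟩ := exists_ofPGr p
    rw [unitN_eq]
    exact ofPGr_congr (PGr.vcomp_unitN p) _ _
  unitN_vcomp p := by
    obtain ⟨p, hp, rfl⟩ := exists_ofPGr p
    rw [unitN_eq]
    exact ofPGr_congr (PGr.unitN_vcomp p) _ _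
  hcomp_vcomp_hcomp p p' q q' := by
    obtain ⟨p, hp, rfl⟩ := exists_ofPGr p
    obtain ⟨p', hp', rfl⟩ := exists_ofPGr p'
    obtain ⟨q, hq, rfl⟩ := exists_ofPGr q
    obtain ⟨q', hq', rfl⟩ := exists_ofPGr q'
    exact ofPGr_congr (PGr.hcomp_vcomp_hcomp p p' q q') _ _
  lact_vcomp σ p q := by
    obtain ⟨p, hp, rfl⟩ := exists_ofPGr p
    obtain ⟨q, hq, rfl⟩ := exists_ofPGr q
    exact ofPGr_congr (PGr.lact_vcomp σ p q) _ _
  ract_vcomp σ p q := by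
    obtain ⟨p, hp, rfl⟩ := exists_ofPGr p
    obtain ⟨q, hq, rfl⟩ := exists_ofPGr q
    exact ofPGr_congr (PGr.ract_vcomp σ p q) _ _
  vcomp_middle σ p q := by
    obtain ⟨p, hp, rfl⟩ := exists_ofPGr p
    obtain ⟨q, hq, rfl⟩ := exists_ofPGr q
    exact ofPGr_congr (PGr.vcomp_middle σ p q) _ _
  hcomp_lact σ σ' p q := by
    obtain ⟨p, hp, rfl⟩ := exists_ofPGr p
    obtain ⟨q, hq, rfl⟩ := exists_ofPGr q
    exact ofPGr_congr (PGr.hcomp_lact σ σ' p q) _ _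
  hcomp_ract σ σ' p q := by
    obtain ⟨p, hp, rfl⟩ := exists_ofPGr p
    obtain ⟨q, hq, rfl⟩ := exists_ofPGr q
    exact ofPGr_congr (PGr.hcomp_ract σ σ' p q) _ _
  hcomp_comm {k l k' l'} p q := by
    obtain ⟨p, hp, rfl⟩ := exists_ofPGr p
    obtain ⟨q, hq, rfl⟩ := exists_ofPGr q
    have h := castIdx_ofPGr (Nat.add_comm k' k) (Nat.add_comm l' l) _ (PGr.hcomp_mem_up hq hp)
    exact (ofPGr_congr (PGr.hcomp_comm p q) _ (PGr.ract_mem_up _ (cast_mem_up _ _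
      (PGr.hcomp_mem_up hq hp)))).trans (congrArg ((GammaUp X).ract (permBlock k k')) h).symm

end GammaUp

/-! ### Values of complete wirings, and their behaviour under concatenation -/

namespace ProP

open SymBimodule

variable {𝕜 : Type*} [Field 𝕜] {P : ProP 𝕜}

theorem injective_inl {V K L : Type} {In Out : V → Type}
    (w : (Σ v, In v) ⊕ L ≃ (Σ v, Out v) ⊕ K) :
    Function.Injective fun t => w (.inl t) :=
  w.injective.comp Sum.inl_injective

section

variable {K L M V : Type} [Finite K] [Finite L] [Finite M] {In Out : V → Type} [∀ v, Finite (In v)]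
  [∀ v, Finite (Out v)]

/-- The element `p` is obtained by applying the operations attached to all the vertices of a wiring,
given by the bijection `w` sending the end of each edge to its beginning. -/
def IsValue (w : (Σ v, In v) ⊕ L ≃ (Σ v, Out v) ⊕ K) (x : ∀ v, P.Comp (In v) (Out v))
    (p : P.Comp K L) : Prop :=
  Reach (fun t => w (.inl t)) x Set.univ L (fun o => w (.inr o)) p

variable {w : (Σ v, In v) ⊕ L ≃ (Σ v, Out v) ⊕ K} {x : ∀ v, P.Comp (In v) (Out v)}

/-- The set of all vertices is initial, and its cut consists of the edges arriving at the global
outputs, so that a state there can be labelled by `L`. -/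
theorem exists_isValue [Finite V] (x : ∀ v, P.Comp (In v) (Out v))
    (hac : ∀ v, ¬ Relation.TransGen (WireAdj fun t => w (.inl t)) v v) : ∃ p, IsValue w x p := by
  obtain ⟨C, _, c, p, h⟩ := Reach.exists_of_isInitial (x := x) (D := Set.univ) (injective_inl w) hac
    (fun _ _ _ _ => Set.mem_univ _)
  obtain ⟨f, hf⟩ := exists_equiv_of_range_eq h.invariants.1
    (w.injective.comp (Sum.inr_injective (α := Σ v, In v) (β := L))) (by
      ext s
      rw [h.invariants.2.1 s]
      constructor
      · rintro ⟨-, h2⟩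
        obtain ⟨t | o, rfl⟩ := w.surjective s
        · exact (h2 t rfl (Set.mem_univ _)).elim
        · exact ⟨o, rfl⟩
      · rintro ⟨o, rfl⟩
        exact ⟨fun _ _ => Set.mem_univ _, fun t ht => by cases w.injective ht⟩)
  exact ⟨_, h.relabel f hf⟩

theorem IsValue.unique [Finite V]
    (hac : ∀ v, ¬ Relation.TransGen (WireAdj fun t => w (.inl t)) v v) {p q : P.Comp K L}
    (hp : IsValue w x p) (hq : IsValue w x q) : q = p := by
  have := Reach.unique (injective_inl w) hac hp hq (Equiv.refl L) (fun _ => rfl)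
  rwa [relabel_refl] at this

/-- `Reach` can rename outputs but not global inputs; a renaming of inputs is obtained by starting
from the identity with renamed outputs. -/
theorem relabel_symm_idt {K K' : Type} [Finite K] [Finite K'] (κ : K ≃ K') :
    P.relabel (Equiv.refl K') κ.symm (P.idt K') = P.relabel κ (Equiv.refl K) (P.idt K) := by
  rw [← relabel_idt κ, relabel_relabel, Equiv.self_trans_symm, Equiv.trans_refl]

theorem comp_relabel_symm_idt {K K' : Type} [Finite K] [Finite K'] (κ : K ≃ K') (p : P.Comp K L) :
    P.comp p (P.relabel (Equiv.refl K') κ.symm (P.idt K')) =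
      P.relabel κ (Equiv.refl L) p := by
  rw [relabel_symm_idt]
  conv_lhs => rw [← P.relabel_refl p, comp_relabel, comp_idt]

/-- The value is invariant under isomorphisms of wirings. -/
theorem IsValue.of_equiv {K' L' V' : Type} [Finite K'] [Finite L'] {In' Out' : V' → Type}
    [∀ v, Finite (In' v)] [∀ v, Finite (Out' v)] {w' : (Σ v, In' v) ⊕ L' ≃ (Σ v, Out' v) ⊕ K'}
    {x' : ∀ v, P.Comp (In' v) (Out' v)} (j : V ≃ V') (a : ∀ v, In v ≃ In' (j v))
    (b : ∀ v, Out v ≃ Out' (j v)) (hx : ∀ v, x' (j v) = P.relabel (a v) (b v) (x v))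
    (κ : K ≃ K') (μ : L ≃ L')
    (h : ∀ t, w' (Sum.map (Equiv.sigmaCongr j a) μ t) =
      Sum.map (Equiv.sigmaCongr j b) κ (w t)) {p : P.Comp K L} (hp : IsValue w x p) :
    IsValue w' x' (P.relabel κ μ p) := by
  have h0 : ∀ s, Sum.elim (fun s : Σ v, Out v => .inl (⟨j s.1, b s.1 s.2⟩ : Σ v, Out' v))
      (fun i => .inr (κ i)) s = Sum.map (Equiv.sigmaCongr j b) κ s := by
    rintro (s | s) <;> rfl
  -- The whole wiring is embedded in the other one, the renaming of the global inputs being put into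
  -- the starting state.
  have h1 := Reach.map' (x' := x') (e' := fun t => w' (.inl t)) j j.injective a b hx
    (fun i => .inr (κ i)) (fun v i => (h (.inl ⟨v, i⟩)).trans (h0 _).symm)
    (fun _ => Set.notMem_empty _) (Reach.base.relabel κ.symm (c' := fun i => .inr (κ i)) (by simp)) hp
  rw [Set.empty_union, Set.image_univ_of_surjective j.surjective, comp_relabel_symm_idt] at h1
  have h2 := h1.relabel μ (c' := fun o => w' (.inr o)) (fun o => (h (.inr o)).trans (h0 _).symm)
  rw [relabel_relabel] at h2
  exact h2

section sum

variable {V₁ V₂ : Type} {In₁ Out₁ : V₁ → Type} {In₂ Out₂ : V₂ → Type} [∀ v, Finite (In₁ v)]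
  [∀ v, Finite (Out₁ v)] [∀ v, Finite (In₂ v)] [∀ v, Finite (Out₂ v)]
  {In Out : V₁ ⊕ V₂ → Type} [∀ v, Finite (In v)] [∀ v, Finite (Out v)]
  {x₁ : ∀ v, P.Comp (In₁ v) (Out₁ v)} {x₂ : ∀ v, P.Comp (In₂ v) (Out₂ v)}
  {x : ∀ v, P.Comp (In v) (Out v)}
  (a₁ : ∀ v, In₁ v ≃ In (.inl v)) (b₁ : ∀ v, Out₁ v ≃ Out (.inl v))
  (a₂ : ∀ v, In₂ v ≃ In (.inr v)) (b₂ : ∀ v, Out₂ v ≃ Out (.inr v))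

theorem univ_eq_union (A B : Type) :
    (∅ ∪ Sum.inl '' Set.univ ∪ Sum.inr '' Set.univ : Set (A ⊕ B)) = Set.univ := by
  ext (a | a) <;> simp

/-- The value of a juxtaposition. -/
theorem IsValue.tensor {K₁ K₂ L₁ L₂ : Type} [Finite K₁] [Finite K₂] [Finite L₁] [Finite L₂]
    {w₁ : (Σ v, In₁ v) ⊕ L₁ ≃ (Σ v, Out₁ v) ⊕ K₁} {w₂ : (Σ v, In₂ v) ⊕ L₂ ≃ (Σ v, Out₂ v) ⊕ K₂}
    {w : (Σ v, In v) ⊕ L ≃ (Σ v, Out v) ⊕ K}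
    (hx₁ : ∀ v, x (.inl v) = P.relabel (a₁ v) (b₁ v) (x₁ v))
    (hx₂ : ∀ v, x (.inr v) = P.relabel (a₂ v) (b₂ v) (x₂ v)) (κ : K₁ ⊕ K₂ ≃ K) (μ : L₁ ⊕ L₂ ≃ L)
    (h₁ : ∀ v i, w (.inl ⟨.inl v, a₁ v i⟩) = Sum.elim (fun s => .inl ⟨.inl s.1, b₁ s.1 s.2⟩)
      (fun i => .inr (κ (.inl i))) (w₁ (.inl ⟨v, i⟩)))
    (h₁' : ∀ o, w (.inr (μ (.inl o))) = Sum.elim (fun s => .inl ⟨.inl s.1, b₁ s.1 s.2⟩)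
      (fun i => .inr (κ (.inl i))) (w₁ (.inr o)))
    (h₂ : ∀ v i, w (.inl ⟨.inr v, a₂ v i⟩) = Sum.elim (fun s => .inl ⟨.inr s.1, b₂ s.1 s.2⟩)
      (fun i => .inr (κ (.inr i))) (w₂ (.inl ⟨v, i⟩)))
    (h₂' : ∀ o, w (.inr (μ (.inr o))) = Sum.elim (fun s => .inl ⟨.inr s.1, b₂ s.1 s.2⟩)
      (fun i => .inr (κ (.inr i))) (w₂ (.inr o)))
    {p₁ : P.Comp K₁ L₁} {p₂ : P.Comp K₂ L₂} (hp₁ : IsValue w₁ x₁ p₁) (hp₂ : IsValue w₂ x₂ p₂) :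
    IsValue w x (P.relabel κ μ (P.tensor p₁ p₂)) := by
  -- The first wiring is evaluated with the inputs `K₂` kept aside, then the second one with the
  -- outputs `L₁` of the first kept aside.
  have k₀ : Reach (fun t => w (.inl t)) x ∅ (K₁ ⊕ K₂)
      (Sum.elim (fun i => .inr (κ (.inl i))) (fun i => .inr (κ (.inr i)))) _ :=
    Reach.base.relabel κ.symm (by
      intro z
      obtain ⟨z, rfl⟩ := κ.surjective z
      rw [Equiv.symm_apply_apply]
      rcases z with z | z <;> rfl)
  have k₁ := Reach.map Sum.inl Sum.inl_injective a₁ b₁ hx₁ _ _ h₁ (fun _ => Set.notMem_empty _)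
    k₀ hp₁
  have k₂ := k₁.relabel (Equiv.sumComm _ _) (c' := Sum.elim (fun i => .inr (κ (.inr i)))
    (fun o => w (.inr (μ (.inl o))))) (by
      rintro (z | z)
      · exact h₁' z
      · rfl)
  have k₃ := Reach.map Sum.inr Sum.inr_injective a₂ b₂ hx₂ _ _ h₂ (by simp) k₂ hp₂
  have k₄ := k₃.relabel ((Equiv.sumComm _ _).trans μ) (c' := fun o => w (.inr o)) (by
      rintro (z | z)
      · exact h₂' z
      · rfl)
  -- The exchanges of summands cancel, and the interchange law merges `id ⊗ p₂` and `p₁ ⊗ id` into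
  -- `p₁ ⊗ p₂`.
  rw [univ_eq_union, ← tensor_comm (P.idt L₁) p₂, comp_relabel, comp_assoc, comp_tensor, idt_comp,
    comp_idt, relabel_relabel, comp_relabel_symm_idt, relabel_relabel] at k₄
  have hμ : (Equiv.refl (L₁ ⊕ L₂)).trans ((Equiv.sumComm L₁ L₂).trans ((Equiv.sumComm L₂ L₁).trans μ))
      = μ := by
    ext z
    rcases z with z | z <;> rfl
  rw [hμ] at k₄
  exact k₄

/-- The value of a composition. -/
theorem IsValue.comp {w₁ : (Σ v, In₁ v) ⊕ M ≃ (Σ v, Out₁ v) ⊕ K}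
    {w₂ : (Σ v, In₂ v) ⊕ L ≃ (Σ v, Out₂ v) ⊕ M} {w : (Σ v, In v) ⊕ L ≃ (Σ v, Out v) ⊕ K}
    (hx₁ : ∀ v, x (.inl v) = P.relabel (a₁ v) (b₁ v) (x₁ v))
    (hx₂ : ∀ v, x (.inr v) = P.relabel (a₂ v) (b₂ v) (x₂ v))
    (h₁ : ∀ v i, w (.inl ⟨.inl v, a₁ v i⟩) = Sum.elim (fun s => .inl ⟨.inl s.1, b₁ s.1 s.2⟩)
      .inr (w₁ (.inl ⟨v, i⟩)))
    (h₂ : ∀ v i, w (.inl ⟨.inr v, a₂ v i⟩) = Sum.elim (fun s => .inl ⟨.inr s.1, b₂ s.1 s.2⟩)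
      (fun i => Sum.elim (fun s => .inl ⟨.inl s.1, b₁ s.1 s.2⟩) .inr (w₁ (.inr i)))
      (w₂ (.inl ⟨v, i⟩)))
    (h₃ : ∀ o, w (.inr o) = Sum.elim (fun s => .inl ⟨.inr s.1, b₂ s.1 s.2⟩)
      (fun i => Sum.elim (fun s => .inl ⟨.inl s.1, b₁ s.1 s.2⟩) .inr (w₁ (.inr i)))
      (w₂ (.inr o)))
    {p₁ : P.Comp K M} {p₂ : P.Comp M L} (hp₁ : IsValue w₁ x₁ p₁) (hp₂ : IsValue w₂ x₂ p₂) :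
    IsValue w x (P.comp p₂ p₁) := by
  -- The state obtained after the vertices of the first wiring has the global inputs of the second
  -- one as its labels.
  have k₁ := Reach.map' Sum.inl Sum.inl_injective a₁ b₁ hx₁ _ h₁ (fun _ => Set.notMem_empty _)
    (Reach.base (e := fun t => w (.inl t)) (x := x)) hp₁
  have k₂ := Reach.map' Sum.inr Sum.inr_injective a₂ b₂ hx₂ _ h₂ (by simp) k₁ hp₂
  rw [univ_eq_union, comp_idt] at k₂
  rw [IsValue, funext h₃]
  exact k₂

end sum

end

end ProP

/-! ## Isomorphisms of wirings of decorated graphs -/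

namespace DecGraph

variable {𝕜 : Type*} [Field 𝕜] {X : SymBimodule 𝕜} {k l m k' l' : ℕ}

/-- Isomorphisms of decorated graphs in which the edges around the vertices may be permuted, the
decorations being acted upon accordingly. -/
structure WireIso (G H : DecGraph X k l) where
  fV : G.graph.V ≃ H.graph.V
  fIn : ∀ v, Fin (G.graph.inDeg v) ≃ Fin (H.graph.inDeg (fV v))
  fOut : ∀ v, Fin (G.graph.outDeg v) ≃ Fin (H.graph.outDeg (fV v))
  origin_map : ∀ t, H.graph.origin (Sum.map (Equiv.sigmaCongr fV fIn) id t) =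
    Sum.map (Equiv.sigmaCongr fV fOut) id (G.graph.origin t)
  dec_map : ∀ v, H.dec (fV v) = X.gact (fIn v) (fOut v) (G.dec v)
  isEmpty_L : IsEmpty G.graph.L ↔ IsEmpty H.graph.L

/-- Isomorphisms of decorated graphs are isomorphisms of wirings. -/
def Iso.toWireIso {G H : DecGraph X k l} (f : G.Iso H) : WireIso G H where
  fV := f.fV
  fIn v := finCongr (f.inDeg_eq v)
  fOut v := finCongr (f.outDeg_eq v)
  origin_map := f.toIso.origin_map
  dec_map v := (f.dec_map v).trans (X.castIdx_eq_gact _ _ _)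
  isEmpty_L := f.fL.isEmpty_congr

/-- Permutations can be moved from the decoration of a vertex to the orders at this vertex. -/
def reorderWireIso (G : PlanarGraph k l) [DecidableEq G.V]
    (d : ∀ v : G.V, X.carrier (G.inDeg v) (G.outDeg v)) (v : G.V)
    (σ : Equiv.Perm (Fin (G.outDeg v))) (τ : Equiv.Perm (Fin (G.inDeg v))) :
    WireIso (⟨G, Function.update d v (X.lact σ (X.ract τ (d v)))⟩ : DecGraph X k l)
      ⟨G.reorder v σ τ, d⟩ where
  fV := Equiv.refl _
  fIn := Pi.mulSingle (M := fun w => Equiv.Perm (Fin (G.inDeg w))) v τ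
  fOut := Pi.mulSingle (M := fun w => Equiv.Perm (Fin (G.outDeg w))) v σ⁻¹
  origin_map t := by
    refine Eq.trans ?_ ((G.origin_reorder v σ τ t).trans ?_)
    · rcases t with t | t <;> rfl
    · rcases G.origin t with t | t <;> rfl
  dec_map w := by
    -- At `v`, the bijections `τ` and `σ⁻¹` undo the action of `σ` and `τ` on the decoration; at the
    -- other vertices they are identities.
    have h : d w = X.gact (Pi.mulSingle (M := fun w => Equiv.Perm (Fin (G.inDeg w))) v τ w)
        (Pi.mulSingle (M := fun w => Equiv.Perm (Fin (G.outDeg w))) v σ⁻¹ w)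
        (Function.update d v (X.lact σ (X.ract τ (d v))) w) := by
      rcases eq_or_ne v w with hw | hw
      · subst hw
        rw [Pi.mulSingle_eq_same, Pi.mulSingle_eq_same, Function.update_self,
          SymBimodule.gact_perm, X.lact_mul, inv_mul_cancel, X.lact_one, X.ract_mul,
          mul_inv_cancel, X.ract_one]
      · rw [Pi.mulSingle_eq_of_ne hw.symm, Pi.mulSingle_eq_of_ne hw.symm,
          Function.update_of_ne hw.symm]
        exact (X.gact_refl _).symm
    exact h
  isEmpty_L := Iff.rfl

namespace WireIso

variable {G H : DecGraph X k l}

theorem adj_iff (f : WireIso G H) {v u : G.graph.V} : H.graph.Adj (f.fV v) (f.fV u) ↔ G.graph.Adj v u := by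
  rw [PlanarGraph.adj_iff, PlanarGraph.adj_iff]
  constructor
  · rintro ⟨i, o, h⟩
    obtain ⟨i, rfl⟩ := (f.fIn u).surjective i
    have h1 := (f.origin_map (.inl ⟨u, i⟩)).symm.trans h
    rcases h2 : G.graph.origin (.inl ⟨u, i⟩) with s | s
    · rw [h2] at h1
      obtain ⟨a, b⟩ := s
      obtain rfl : a = v := f.fV.injective (congrArg Sigma.fst (Sum.inl.inj h1))
      exact ⟨i, b, h2⟩
    · rw [h2] at h1
      cases h1
  · rintro ⟨i, o, h⟩
    replace h : G.graph.origin (.inl ⟨u, i⟩) = .inl ⟨v, o⟩ := h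
    exact ⟨f.fIn u i, f.fOut v o, (f.origin_map (.inl ⟨u, i⟩)).trans (by
      rw [h]
      rfl)⟩

theorem isCycleFree_iff (f : WireIso G H) : H.graph.IsCycleFree ↔ G.graph.IsCycleFree := by
  refine and_congr f.isEmpty_L.symm ⟨fun h v hv => h (f.fV v) ?_, fun h v hv => ?_⟩
  · exact hv.lift f.fV (fun a b hab => f.adj_iff.2 hab)
  · refine h (f.fV.symm v) (hv.lift f.fV.symm (fun a b hab => ?_))
    rwa [Function.onFun, ← f.adj_iff, Equiv.apply_symm_apply, Equiv.apply_symm_apply]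

end WireIso

end DecGraph

namespace PlanarGraph

variable {k l m k' l' : ℕ}

theorem IsCycleFree.not_transGen_wireAdj {G : PlanarGraph k l} (hG : G.IsCycleFree) (v : G.V) :
    ¬ Relation.TransGen (ProP.WireAdj (In := fun v => Fin (G.inDeg v))
      (Out := fun v => Fin (G.outDeg v)) fun t => G.origin (.inl t)) v v := by
  intro hv
  refine hG.2 v (Relation.TransGen.mono ?_ v v hv)
  intro a b
  exact G.adj_iff.2

theorem hcompInl_eq_elim (G : PlanarGraph k l) (G' : PlanarGraph k' l')
    (s : (Σ v, Fin (G.outDeg v)) ⊕ Fin k) : G.hcompInl G' s =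
      Sum.elim (fun s => .inl ⟨.inl s.1, s.2⟩) (fun i => .inr (finSumFinEquiv (.inl i))) s := by
  rcases s with s | s <;> rfl

theorem hcompInr_eq_elim (G : PlanarGraph k l) (G' : PlanarGraph k' l')
    (s : (Σ v, Fin (G'.outDeg v)) ⊕ Fin k') : G.hcompInr G' s =
      Sum.elim (fun s => .inl ⟨.inr s.1, s.2⟩) (fun i => .inr (finSumFinEquiv (.inr i))) s := by
  rcases s with s | s <;> rfl

theorem vcompInl_eq_elim (G : PlanarGraph k l) (G' : PlanarGraph l m)
    (s : (Σ v, Fin (G.outDeg v)) ⊕ Fin k) : G.vcompInl G' s =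
      Sum.elim (fun s => .inl ⟨.inl s.1, s.2⟩) .inr s := by
  rcases s with s | s <;> rfl

theorem vcompInr_eq_elim (G : PlanarGraph k l) (G' : PlanarGraph l m)
    (s : (Σ v, Fin (G'.outDeg v)) ⊕ Fin l) : G.vcompInr G' s =
      Sum.elim (fun s => .inl ⟨.inr s.1, s.2⟩)
        (fun i => Sum.elim (fun s => .inl ⟨.inl s.1, s.2⟩) .inr (G.origin (.inr i))) s := by
  rcases s with s | s
  · rfl
  · exact G.vcompInl_eq_elim G' _

end PlanarGraph

/-! ## Evaluation of decorated graphs in a ProP -/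

namespace DecGraph

variable {𝕜 : Type*} [Field 𝕜] {X : SymBimodule 𝕜} {P : ProP 𝕜} {k l m k' l' : ℕ}

/-- `p` is the composition in `P` of the decorations of the vertices of `G`. -/
def IsValue (φ : X.Hom P.toSymBimodule) (G : DecGraph X k l) (p : P.carrier k l) : Prop :=
  ProP.IsValue G.graph.origin
    (fun v => P.label (Equiv.refl _) (Equiv.refl _) (φ.map _ _ (G.dec v)))
    (P.label (Equiv.refl (Fin k)) (Equiv.refl (Fin l)) p)

variable {φ : X.Hom P.toSymBimodule}

theorem exists_isValue (φ : X.Hom P.toSymBimodule) {G : DecGraph X k l}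
    (hG : G.graph.IsCycleFree) : ∃ p, IsValue φ G p := by
  obtain ⟨p, hp⟩ := ProP.exists_isValue (w := G.graph.origin)
    (fun v => P.label (Equiv.refl _) (Equiv.refl _) (φ.map _ _ (G.dec v)))
    (hG.not_transGen_wireAdj)
  obtain ⟨p, rfl⟩ := SymBimodule.label_surjective (Equiv.refl (Fin k)) (Equiv.refl (Fin l)) p
  exact ⟨p, hp⟩

theorem IsValue.unique {G : DecGraph X k l} (hG : G.graph.IsCycleFree) {p q : P.carrier k l}
    (hp : IsValue φ G p) (hq : IsValue φ G q) : q = p :=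
  SymBimodule.label_injective _ _ (ProP.IsValue.unique
    (hG.not_transGen_wireAdj) hp hq)

/-- The equivariance of `φ` enters here, and makes values compatible with permutations around the
vertices. -/
theorem label_map_gact {a b a' b' : ℕ} (e : Fin a ≃ Fin a') (f : Fin b ≃ Fin b')
    (x : X.carrier a b) :
    P.label (Equiv.refl _) (Equiv.refl _) (φ.map _ _ (X.gact e f x)) =
      P.relabel e f (P.label (Equiv.refl _) (Equiv.refl _) (φ.map _ _ x)) := by
  rw [φ.map_gact, SymBimodule.label_gact, SymBimodule.relabel_label]
  rfl

theorem IsValue.wireIso {G H : DecGraph X k l} (f : WireIso G H) {p : P.carrier k l}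
    (hp : IsValue φ G p) : IsValue φ H p := by
  have h := ProP.IsValue.of_equiv (w' := H.graph.origin)
    (x' := fun v => P.label (Equiv.refl _) (Equiv.refl _) (φ.map _ _ (H.dec v)))
    f.fV f.fIn f.fOut (fun v => by rw [f.dec_map, label_map_gact]) (Equiv.refl _) (Equiv.refl _)
    f.origin_map hp
  rwa [SymBimodule.relabel_refl] at h

theorem IsValue.lact {G : DecGraph X k l} {p : P.carrier k l} (hp : IsValue φ G p)
    (σ : Equiv.Perm (Fin l)) : IsValue φ (G.lact σ) (P.lact σ p) := by
  have h := ProP.IsValue.of_equiv (w' := (G.lact σ).graph.origin)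
    (x' := fun v => P.label (Equiv.refl _) (Equiv.refl _) (φ.map _ _ ((G.lact σ).dec v)))
    (Equiv.refl _) (fun _ => Equiv.refl _) (fun _ => Equiv.refl _)
    (fun v => (SymBimodule.relabel_refl _).symm) (Equiv.refl _) σ (fun t => by
      refine Eq.trans ?_ ((G.graph.origin_lact σ t).trans ?_)
      · rcases t with t | t <;> rfl
      · rcases G.graph.origin t with t | t <;> rfl) hp
  rw [SymBimodule.relabel_label] at h
  rw [IsValue, SymBimodule.lact_eq_gact, SymBimodule.label_gact]
  exact h

theorem IsValue.ract {G : DecGraph X k l} {p : P.carrier k l} (hp : IsValue φ G p)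
    (τ : Equiv.Perm (Fin k)) : IsValue φ (G.ract τ) (P.ract τ p) := by
  have h := ProP.IsValue.of_equiv (w' := (G.ract τ).graph.origin)
    (x' := fun v => P.label (Equiv.refl _) (Equiv.refl _) (φ.map _ _ ((G.ract τ).dec v)))
    (Equiv.refl _) (fun _ => Equiv.refl _) (fun _ => Equiv.refl _)
    (fun v => (SymBimodule.relabel_refl _).symm) τ.symm (Equiv.refl _) (fun t => by
      refine Eq.trans ?_ ((G.graph.origin_ract τ t).trans ?_)
      · rcases t with t | t <;> rfl
      · rcases G.graph.origin t with t | t <;> rfl) hp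
  rw [SymBimodule.relabel_label] at h
  rw [IsValue, SymBimodule.ract_eq_gact, SymBimodule.label_gact]
  exact h

theorem IsValue.hcomp {G : DecGraph X k l} {G' : DecGraph X k' l'} {p : P.carrier k l}
    {p' : P.carrier k' l'} (hp : IsValue φ G p) (hp' : IsValue φ G' p') :
    IsValue φ (G.hcomp G') (P.hcomp p p') := by
  have : ∀ v : G.graph.V ⊕ G'.graph.V, Finite (Fin ((G.hcomp G').graph.inDeg v)) :=
    fun v => Finite.of_fintype (Fin _)
  have : ∀ v : G.graph.V ⊕ G'.graph.V, Finite (Fin ((G.hcomp G').graph.outDeg v)) :=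
    fun v => Finite.of_fintype (Fin _)
  have h := ProP.IsValue.tensor (In := fun v => Fin ((G.hcomp G').graph.inDeg v))
    (Out := fun v => Fin ((G.hcomp G').graph.outDeg v)) (w := (G.hcomp G').graph.origin)
    (x := fun v => P.label (Equiv.refl _) (Equiv.refl _) (φ.map _ _ ((G.hcomp G').dec v)))
    (fun _ => Equiv.refl _) (fun _ => Equiv.refl _) (fun _ => Equiv.refl _) (fun _ => Equiv.refl _)
    (fun v => (SymBimodule.relabel_refl _).symm) (fun v => (SymBimodule.relabel_refl _).symm)
    finSumFinEquiv finSumFinEquiv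
    (fun v i => (PlanarGraph.origin_hcomp_inl G.graph G'.graph ⟨v, i⟩).trans
      (PlanarGraph.hcompInl_eq_elim _ _ _))
    (fun o => (PlanarGraph.origin_hcomp_castAdd G.graph G'.graph o).trans
      (PlanarGraph.hcompInl_eq_elim _ _ _))
    (fun v i => (PlanarGraph.origin_hcomp_inr G.graph G'.graph ⟨v, i⟩).trans
      (PlanarGraph.hcompInr_eq_elim _ _ _))
    (fun o => (PlanarGraph.origin_hcomp_natAdd G.graph G'.graph o).trans
      (PlanarGraph.hcompInr_eq_elim _ _ _)) hp hp'
  rw [ProP.tensor_label, SymBimodule.relabel_label] at h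
  have e (a b : ℕ) : (ProP.sumLabel (Equiv.refl (Fin a)) (Equiv.refl (Fin b))).trans
      finSumFinEquiv = Equiv.refl _ := by
    simp [ProP.sumLabel]
  rwa [e, e] at h

theorem IsValue.vcomp {G' : DecGraph X l m} {G : DecGraph X k l} {p' : P.carrier l m}
    {p : P.carrier k l} (hp' : IsValue φ G' p') (hp : IsValue φ G p) :
    IsValue φ (G'.vcomp G) (P.vcomp p' p) := by
  have : ∀ v : G.graph.V ⊕ G'.graph.V, Finite (Fin ((G'.vcomp G).graph.inDeg v)) :=
    fun v => Finite.of_fintype (Fin _)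
  have : ∀ v : G.graph.V ⊕ G'.graph.V, Finite (Fin ((G'.vcomp G).graph.outDeg v)) :=
    fun v => Finite.of_fintype (Fin _)
  have h := ProP.IsValue.comp (In := fun v => Fin ((G'.vcomp G).graph.inDeg v))
    (Out := fun v => Fin ((G'.vcomp G).graph.outDeg v)) (w := (G'.vcomp G).graph.origin)
    (x := fun v => P.label (Equiv.refl _) (Equiv.refl _) (φ.map _ _ ((G'.vcomp G).dec v)))
    (fun _ => Equiv.refl _) (fun _ => Equiv.refl _) (fun _ => Equiv.refl _) (fun _ => Equiv.refl _)
    (fun v => (SymBimodule.relabel_refl _).symm) (fun v => (SymBimodule.relabel_refl _).symm)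
    (fun v i => (PlanarGraph.origin_vcomp_inl G.graph G'.graph ⟨v, i⟩).trans
      (PlanarGraph.vcompInl_eq_elim _ _ _))
    (fun v i => (PlanarGraph.origin_vcomp_inr G.graph G'.graph ⟨v, i⟩).trans
      (PlanarGraph.vcompInr_eq_elim _ _ _))
    (fun o => (PlanarGraph.origin_vcomp_out G.graph G'.graph o).trans
      (PlanarGraph.vcompInr_eq_elim _ _ _)) hp hp'
  rwa [ProP.comp_label] at h

theorem isValue_unitN (φ : X.Hom P.toSymBimodule) (n : ℕ) : IsValue φ (unitN X n) (P.unitN n) := by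
  have h := ProP.Reach.base (e := fun t => (unitN X n).graph.origin (.inl t))
    (x := fun v => P.label (Equiv.refl _) (Equiv.refl _) (φ.map _ _ ((unitN X n).dec v)))
  rw [← ProP.label_unitN (Equiv.refl (Fin n)),
    Subsingleton.elim (∅ : Set (unitN X n).graph.V) Set.univ,
    ← funext (origin_unitN X n)] at h
  exact h

theorem isValue_unit1 (φ : X.Hom P.toSymBimodule) :
    IsValue φ (⟨PlanarGraph.unit1, fun v => Empty.elim v⟩ : DecGraph X 1 1) P.unit1 := by
  have h := ProP.Reach.base
    (e := fun t => (PlanarGraph.unit1.origin (.inl t)))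
    (x := fun v : PlanarGraph.unit1.V => P.label (Equiv.refl _) (Equiv.refl _)
      (φ.map _ _ ((Empty.elim v : X.carrier (PlanarGraph.unit1.inDeg v)
        (PlanarGraph.unit1.outDeg v)))))
  have h1 : P.unitN 1 = P.unit1 := P.isProP.unit0_hcomp P.unit1
  have h2 : (fun i => PlanarGraph.unit1.origin (.inr i)) = Sum.inr := funext fun i => by
    have := PlanarGraph.unit1.origin_outIdx_inr (0 : Fin 1)
    rw [Subsingleton.elim i (PlanarGraph.unit1.outIdx (.inr (0 : Fin 1))), this]
    exact congrArg Sum.inr (Subsingleton.elim _ _)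
  rw [← ProP.label_unitN (Equiv.refl (Fin 1)), h1,
    @Subsingleton.elim (Set Empty) _ (∅ : Set PlanarGraph.unit1.V) Set.univ, ← h2] at h
  exact h

/-- A single step is needed, with no edge kept aside; the empty summand is then removed by
`tensor_idt_empty`. -/
theorem isValue_corolla (φ : X.Hom P.toSymBimodule) (x : X.carrier k l) :
    IsValue φ ⟨PlanarGraph.corolla k l, fun _ => x⟩ (φ.map k l x) := by
  have h₀ := (ProP.Reach.base (P := P) (In := fun _ : Unit => Fin k) (Out := fun _ : Unit => Fin l)
    (e := fun t => (PlanarGraph.corolla k l).origin (.inl t))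
    (x := fun _ => P.label (Equiv.refl _) (Equiv.refl _) (φ.map k l x))).relabel
    (Equiv.sumEmpty (Fin k) Empty).symm (c' := Sum.elim .inr Empty.elim) (fun _ => rfl)
  have h₁ := (h₀.step (v := ()) (Set.notMem_empty _)
    (fun i => ((PlanarGraph.corolla k l).origin_tgt_inr i).symm)).relabel
    (Equiv.sumEmpty (Fin l) Empty) (c' := fun o => (PlanarGraph.corolla k l).origin (.inr o))
    (by
      rintro (o | o)
      · exact (PlanarGraph.corolla k l).origin_outIdx_inl o
      · exact o.elim)
  rw [← ProP.comp_relabel _ (Equiv.sumEmpty (Fin k) Empty), ProP.tensor_idt_empty,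
    SymBimodule.relabel_relabel, Equiv.symm_trans_self, Equiv.refl_trans, SymBimodule.relabel_refl,
    ProP.comp_idt, show insert () ∅ = (Set.univ : Set Unit) from Set.eq_univ_of_forall
      fun _ => Set.mem_insert _ _] at h₁
  exact h₁

open Classical in
/-- The value of a decorated graph in `P`; it is `0` if the graph has a cycle. -/
noncomputable def eval (φ : X.Hom P.toSymBimodule) (G : DecGraph X k l) : P.carrier k l :=
  if hG : G.graph.IsCycleFree then (exists_isValue φ hG).choose else 0

theorem isValue_eval (φ : X.Hom P.toSymBimodule) {G : DecGraph X k l} (hG : G.graph.IsCycleFree) :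
    IsValue φ G (eval φ G) := by
  rw [eval, dif_pos hG]
  exact (exists_isValue φ hG).choose_spec

theorem IsValue.eval_eq {G : DecGraph X k l} {p : P.carrier k l} (hp : IsValue φ G p)
    (hG : G.graph.IsCycleFree) : eval φ G = p :=
  hp.unique hG (isValue_eval φ hG)

theorem eval_wireIso {G H : DecGraph X k l} (f : WireIso G H) : eval φ G = eval φ H := by
  by_cases hG : G.graph.IsCycleFree
  · exact (((isValue_eval φ hG).wireIso f).eval_eq (f.isCycleFree_iff.2 hG)).symm
  · rw [eval, eval, dif_neg hG, dif_neg fun hH => hG (f.isCycleFree_iff.1 hH)]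

/-- Whether `G` is cycle-free does not depend on the decorations. If it is, `exists_linear` gives a
linear family of values, which by uniqueness is the evaluation; otherwise the evaluation is
constantly `0`. -/
theorem exists_label_eval_update (φ : X.Hom P.toSymBimodule) (G : PlanarGraph k l) [DecidableEq G.V]
    (d : ∀ v : G.V, X.carrier (G.inDeg v) (G.outDeg v)) (v : G.V) :
    ∃ Λ : X.carrier (G.inDeg v) (G.outDeg v) →ₗ[𝕜] P.Comp (Fin k) (Fin l), ∀ z,
      P.label (Equiv.refl _) (Equiv.refl _) (eval φ (⟨G, Function.update d v z⟩ : DecGraph X k l)) =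
        Λ z := by
  by_cases hG : G.IsCycleFree
  · have h := isValue_eval φ (G := ⟨G, d⟩) hG
    obtain ⟨h, -⟩ | ⟨-, Λ, hΛ⟩ := ProP.Reach.exists_linear v h
    · exact (h (Set.mem_univ v)).elim
    · refine ⟨Λ ∘ₗ P.label (Equiv.refl _) (Equiv.refl _) ∘ₗ φ.map _ _, fun z => ?_⟩
      have h1 := isValue_eval φ (G := ⟨G, Function.update d v z⟩) hG
      have h2 := hΛ (P.label (Equiv.refl _) (Equiv.refl _) (φ.map _ _ z))
      refine ProP.IsValue.unique hG.not_transGen_wireAdj ?_ h1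
      -- Changing one decoration and then applying `φ` amounts to changing one operation of the
      -- wiring.
      have h3 := funext fun u => Function.apply_update
        (fun u => P.label (Equiv.refl (Fin (G.inDeg u))) (Equiv.refl (Fin (G.outDeg u))) ∘
          φ.map (G.inDeg u) (G.outDeg u)) d v z u
      exact (congrArg (fun y => ProP.IsValue G.origin y (Λ (P.label (Equiv.refl _) (Equiv.refl _)
        (φ.map _ _ z)))) h3).mpr h2
  · refine ⟨0, fun z => ?_⟩
    rw [eval, dif_neg (by exact hG), map_zero]
    rfl

theorem isMultilinear_eval (φ : X.Hom P.toSymBimodule) :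
    PGr.IsMultilinear (eval (k := k) (l := l) φ) where
  map_add G _ d v x y := by
    obtain ⟨Λ, hΛ⟩ := exists_label_eval_update φ G d v
    refine SymBimodule.label_injective (Equiv.refl _) (Equiv.refl _) ?_
    simp only [map_add, hΛ]
  map_smul G _ d v c x := by
    obtain ⟨Λ, hΛ⟩ := exists_label_eval_update φ G d v
    refine SymBimodule.label_injective (Equiv.refl _) (Equiv.refl _) ?_
    simp only [map_smul, hΛ]
  map_iso f := eval_wireIso f.toWireIso

end DecGraph

/-! ### Linear maps out of `Γ↑(X)`, and the evaluation morphism -/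

namespace GammaUpSpace

variable {𝕜 : Type*} [Field 𝕜] {X : SymBimodule 𝕜} {k l m k' l' : ℕ}

theorem linearMap_ext {M : Type*} [AddCommGroup M] [Module 𝕜 M] {f g : GammaUpSpace X k l →ₗ[𝕜] M}
    (h : ∀ G hG, f (mk G hG) = g (mk G hG)) : f = g := by
  refine Submodule.linearMap_qext _ (LinearMap.ext fun x => ?_)
  obtain ⟨x, hx⟩ := x
  induction hx using Submodule.span_induction with
  | mem x hx =>
    obtain ⟨G, hG, rfl⟩ := hx
    exact h G hG
  | zero => exact (map_zero (f ∘ₗ Submodule.mkQ _)).trans (map_zero (g ∘ₗ Submodule.mkQ _)).symm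
  | add x y hx hy h1 h2 =>
    exact (map_add (f ∘ₗ Submodule.mkQ _) ⟨x, hx⟩ ⟨y, hy⟩).trans
      ((congrArg₂ _ h1 h2).trans (map_add (g ∘ₗ Submodule.mkQ _) ⟨x, hx⟩ ⟨y, hy⟩).symm)
  | smul c x hx h1 =>
    exact (map_smul (f ∘ₗ Submodule.mkQ _) c ⟨x, hx⟩).trans
      ((congrArg _ h1).trans (map_smul (g ∘ₗ Submodule.mkQ _) c ⟨x, hx⟩).symm)

/-- The linear extension of a function of decorated graphs which is linear in each decoration and
invariant under isomorphisms of wirings. -/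
noncomputable def lift {M : Type*} [AddCommGroup M] [Module 𝕜 M] (F : DecGraph X k l → M)
    (hF : PGr.IsMultilinear F) (hF' : ∀ {G H : DecGraph X k l}, G.WireIso H → F G = F H) :
    GammaUpSpace X k l →ₗ[𝕜] M :=
  Submodule.liftQ _ (PGr.lift F hF ∘ₗ (PGrUp X k l).subtype) (by
    -- The linear extension to all graphs kills the whole of `I`, including the relations on graphs
    -- with cycles; no description of `I ∩ PGr↑` by generators is needed.
    have h : permSubmodule X k l ≤ LinearMap.ker (PGr.lift F hF) := by
      refine Submodule.span_le.2 ?_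
      rintro _ ⟨G, d, v, σ, τ⟩
      rw [SetLike.mem_coe, LinearMap.mem_ker, map_sub, PGr.lift_mk, PGr.lift_mk, sub_eq_zero]
      exact (hF' (DecGraph.reorderWireIso G d v σ τ)).symm
    exact fun _ hx => h hx)

@[simp]
theorem lift_mk {M : Type*} [AddCommGroup M] [Module 𝕜 M] (F : DecGraph X k l → M)
    (hF : PGr.IsMultilinear F) (hF' : ∀ {G H : DecGraph X k l}, G.WireIso H → F G = F H)
    (G : DecGraph X k l) (hG : G.graph.IsCycleFree) : lift F hF hF' (mk G hG) = F G :=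
  PGr.lift_mk F hF G

theorem hcomp_mk (G : DecGraph X k l) (hG : G.graph.IsCycleFree) (G' : DecGraph X k' l')
    (hG' : G'.graph.IsCycleFree) :
    hcomp (mk G hG) (mk G' hG') = mk (G.hcomp G') (PlanarGraph.isCycleFree_hcomp hG hG') :=
  congrArg Submodule.Quotient.mk (Subtype.ext (PGr.hcomp_mk G G'))

theorem vcomp_mk (G' : DecGraph X l m) (hG' : G'.graph.IsCycleFree) (G : DecGraph X k l)
    (hG : G.graph.IsCycleFree) :
    vcomp (mk G' hG') (mk G hG) = mk (G'.vcomp G) (PlanarGraph.isCycleFree_vcomp hG' hG) :=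
  congrArg Submodule.Quotient.mk (Subtype.ext (PGr.vcomp_mk G' G))

variable {P : ProP 𝕜}

/-- The linear map sending every decorated graph to its value in `P`. -/
noncomputable def eval (φ : X.Hom P.toSymBimodule) : GammaUpSpace X k l →ₗ[𝕜] P.carrier k l :=
  lift (DecGraph.eval φ) (DecGraph.isMultilinear_eval φ) DecGraph.eval_wireIso

variable (φ : X.Hom P.toSymBimodule)

@[simp]
theorem eval_mk (G : DecGraph X k l) (hG : G.graph.IsCycleFree) :
    eval φ (mk G hG) = DecGraph.eval φ G :=
  lift_mk _ _ _ G hG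

theorem eval_mk_eq_of_isValue {G : DecGraph X k l} {p : P.carrier k l}
    (hp : DecGraph.IsValue φ G p) (hG : G.graph.IsCycleFree) : eval φ (mk G hG) = p :=
  (eval_mk φ G hG).trans (hp.eval_eq hG)

theorem eval_lact (σ : Equiv.Perm (Fin l)) (x : GammaUpSpace X k l) :
    eval φ (lact σ x) = P.lact σ (eval φ x) :=
  DFunLike.congr_fun (linearMap_ext (f := eval φ ∘ₗ lact σ) (g := P.lact σ ∘ₗ eval φ) fun G hG => by
    rw [LinearMap.comp_apply, LinearMap.comp_apply, lact_mk, eval_mk]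
    exact eval_mk_eq_of_isValue φ ((DecGraph.isValue_eval φ hG).lact σ) hG) x

theorem eval_ract (τ : Equiv.Perm (Fin k)) (x : GammaUpSpace X k l) :
    eval φ (ract τ x) = P.ract τ (eval φ x) :=
  DFunLike.congr_fun (linearMap_ext (f := eval φ ∘ₗ ract τ) (g := P.ract τ ∘ₗ eval φ) fun G hG => by
    rw [LinearMap.comp_apply, LinearMap.comp_apply, ract_mk, eval_mk]
    exact eval_mk_eq_of_isValue φ ((DecGraph.isValue_eval φ hG).ract τ) hG) x

theorem eval_hcomp (x : GammaUpSpace X k l) (y : GammaUpSpace X k' l') :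
    eval φ (hcomp x y) = P.hcomp (eval φ x) (eval φ y) := by
  refine DFunLike.congr_fun (DFunLike.congr_fun (linearMap_ext
    (f := hcomp.compr₂ (eval φ)) (g := P.hcomp.compl₁₂ (eval φ) (eval φ)) fun G hG =>
    linearMap_ext fun G' hG' => ?_) x) y
  rw [LinearMap.compr₂_apply, LinearMap.compl₁₂_apply, hcomp_mk, eval_mk, eval_mk]
  exact eval_mk_eq_of_isValue φ
    ((DecGraph.isValue_eval φ hG).hcomp (DecGraph.isValue_eval φ hG'))
    (PlanarGraph.isCycleFree_hcomp hG hG')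

theorem eval_vcomp (x : GammaUpSpace X l m) (y : GammaUpSpace X k l) :
    eval φ (vcomp x y) = P.vcomp (eval φ x) (eval φ y) := by
  refine DFunLike.congr_fun (DFunLike.congr_fun (linearMap_ext
    (f := vcomp.compr₂ (eval φ)) (g := P.vcomp.compl₁₂ (eval φ) (eval φ)) fun G hG =>
    linearMap_ext fun G' hG' => ?_) x) y
  rw [LinearMap.compr₂_apply, LinearMap.compl₁₂_apply, vcomp_mk, eval_mk, eval_mk]
  exact eval_mk_eq_of_isValue φ
    ((DecGraph.isValue_eval φ hG).vcomp (DecGraph.isValue_eval φ hG'))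
    (PlanarGraph.isCycleFree_vcomp hG hG')

theorem eval_corolla (x : X.carrier k l) : eval φ (corolla x) = φ.map k l x :=
  eval_mk_eq_of_isValue φ (DecGraph.isValue_corolla φ x) (PlanarGraph.isCycleFree_corolla k l)

end GammaUpSpace

/-- The ProP `Γ↑(X)`. -/
noncomputable abbrev gammaUpProP {𝕜 : Type u} [Field 𝕜] (X : SymBimodule.{u, v} 𝕜) :
    ProP.{u, max 1 u v} 𝕜 :=
  ⟨GammaUp X, GammaUp.isProP X⟩

/-- The morphism of ProPs extending a morphism of modules. -/
noncomputable def GammaUp.evalHom {𝕜 : Type u} [Field 𝕜] {X : SymBimodule.{u, v} 𝕜}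
    {P : ProP.{u, w} 𝕜} (φ : X.Hom P.toSymBimodule) : ProP.Hom (gammaUpProP X) P where
  map _ _ := GammaUpSpace.eval φ
  map_lact := GammaUpSpace.eval_lact φ
  map_ract := GammaUpSpace.eval_ract φ
  map_hcomp := GammaUpSpace.eval_hcomp φ
  map_vcomp := GammaUpSpace.eval_vcomp φ
  map_unit0 := GammaUpSpace.eval_mk_eq_of_isValue φ (DecGraph.isValue_unitN φ 0)
    (DecGraph.isCycleFree_unitN X 0)
  map_unit1 := GammaUpSpace.eval_mk_eq_of_isValue φ (DecGraph.isValue_unit1 φ)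
    (PlanarGraph.isCycleFree_of_isEmpty_E (inferInstanceAs (IsEmpty Empty))
      (inferInstanceAs (IsEmpty Empty)))

/-! ## Injectivity of `ι` -/

/-- The graph `G` is isomorphic to a corolla, up to permutations around its only vertex `v`. -/
def PlanarGraph.IsCorollaAt {k l : ℕ} (G : PlanarGraph k l) (v : G.V)
    (e : Fin (G.inDeg v) ≃ Fin k) (f : Fin (G.outDeg v) ≃ Fin l) : Prop :=
  -- Loops are not excluded. This is harmless, since only linearity, invariance under `WireIso` and
  -- the value on corollas are needed.
  (∀ u, v = u) ∧ (∀ i, G.origin (.inl ⟨v, i⟩) = .inr (e i)) ∧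
    ∀ o, G.origin (.inr (f o)) = .inl ⟨v, o⟩

namespace DecGraph

variable {𝕜 : Type*} [Field 𝕜] {X : SymBimodule 𝕜} {k l : ℕ}

/-- The graph `G` is, up to permutations, a corolla decorated by `x`. -/
def IsCorollaValue (G : DecGraph X k l) (x : X.carrier k l) : Prop :=
  ∃ v e f, G.graph.IsCorollaAt v e f ∧ X.gact e f (G.dec v) = x

/-- The vertex and the bijections `e` and `f` are determined by `origin`. -/
theorem IsCorollaValue.unique {G : DecGraph X k l} {x y : X.carrier k l} (hx : G.IsCorollaValue x)
    (hy : G.IsCorollaValue y) : x = y := by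
  obtain ⟨v, e, f, ⟨h₁, h₂, h₃⟩, rfl⟩ := hx
  obtain ⟨u, e', f', ⟨-, h₂', h₃'⟩, rfl⟩ := hy
  obtain rfl := h₁ u
  obtain rfl : e = e' := Equiv.ext fun i => Sum.inr_injective ((h₂ i).symm.trans (h₂' i))
  obtain rfl : f = f' := Equiv.ext fun o => Sum.inr_injective
    (G.graph.origin.injective ((h₃ o).trans (h₃' o).symm))
  rfl

theorem WireIso.isCorollaAt_iff {G H : DecGraph X k l} (F : WireIso G H) {v : G.graph.V}
    (e : Fin (H.graph.inDeg (F.fV v)) ≃ Fin k) (f : Fin (H.graph.outDeg (F.fV v)) ≃ Fin l) :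
    H.graph.IsCorollaAt (F.fV v) e f ↔
      G.graph.IsCorollaAt v ((F.fIn v).trans e) ((F.fOut v).trans f) := by
  have hj : Function.Injective
      (Sum.map (Equiv.sigmaCongr F.fV F.fOut :
      (Σ v, Fin (G.graph.outDeg v)) ≃ Σ v, Fin (H.graph.outDeg v)) (id : Fin k → Fin k)) :=
    Sum.map_injective.2 ⟨Equiv.injective _, fun _ _ h => h⟩
  refine and_congr ⟨fun h u => F.fV.injective (h _), fun h u => ?_⟩ (and_congr ?_ ?_)
  · rw [h (F.fV.symm u), Equiv.apply_symm_apply]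
  · rw [← (F.fIn v).forall_congr_right]
    refine forall_congr' fun i => ?_
    rw [← hj.eq_iff, ← F.origin_map]
    rfl
  · rw [← (F.fOut v).forall_congr_right]
    refine forall_congr' fun o => ?_
    rw [← hj.eq_iff, ← F.origin_map]
    rfl

theorem WireIso.isCorollaValue_iff {G H : DecGraph X k l} (F : WireIso G H) (x : X.carrier k l) :
    H.IsCorollaValue x ↔ G.IsCorollaValue x := by
  constructor
  · rintro ⟨v, e, f, h, rfl⟩
    obtain ⟨v, rfl⟩ := F.fV.surjective v
    exact ⟨v, _, _, (F.isCorollaAt_iff e f).1 h, by rw [F.dec_map, X.gact_gact]⟩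
  · rintro ⟨v, e, f, h, rfl⟩
    refine ⟨F.fV v, (F.fIn v).symm.trans e, (F.fOut v).symm.trans f,
      (F.isCorollaAt_iff _ _).2 ?_, ?_⟩
    · rwa [← Equiv.trans_assoc, ← Equiv.trans_assoc, Equiv.self_trans_symm, Equiv.self_trans_symm]
    · rw [F.dec_map, X.gact_gact, ← Equiv.trans_assoc, ← Equiv.trans_assoc, Equiv.self_trans_symm,
        Equiv.self_trans_symm, Equiv.refl_trans, Equiv.refl_trans]

open Classical in
/-- The decoration of a corolla, and `0` for the other graphs. -/
noncomputable def corollaValue (G : DecGraph X k l) : X.carrier k l :=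
  if h : ∃ x, G.IsCorollaValue x then h.choose else 0

theorem IsCorollaValue.corollaValue_eq {G : DecGraph X k l} {x : X.carrier k l}
    (h : G.IsCorollaValue x) : G.corollaValue = x := by
  have h' : ∃ x, G.IsCorollaValue x := ⟨x, h⟩
  rw [corollaValue, dif_pos h']
  exact h'.choose_spec.unique h

theorem corollaValue_wireIso {G H : DecGraph X k l} (F : WireIso G H) :
    G.corollaValue = H.corollaValue := by
  by_cases h : ∃ x, G.IsCorollaValue x
  · obtain ⟨x, hx⟩ := h
    rw [hx.corollaValue_eq, ((F.isCorollaValue_iff x).2 hx).corollaValue_eq]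
  · rw [corollaValue, corollaValue, dif_neg h,
      dif_neg fun h' => h (h'.imp fun x => (F.isCorollaValue_iff x).1)]

/-- Being a corolla is a property of the underlying graph alone. If it holds, the value is the image
of the decoration of the only vertex under `gact`; otherwise it is `0`. -/
theorem exists_corollaValue_update (G : PlanarGraph k l) [DecidableEq G.V]
    (d : ∀ v : G.V, X.carrier (G.inDeg v) (G.outDeg v)) (v : G.V) :
    ∃ Λ : X.carrier (G.inDeg v) (G.outDeg v) →ₗ[𝕜] X.carrier k l, ∀ z,
      (⟨G, Function.update d v z⟩ : DecGraph X k l).corollaValue = Λ z := by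
  by_cases h : ∃ v e f, G.IsCorollaAt v e f
  · obtain ⟨u, e, f, h⟩ := h
    obtain rfl := h.1 v
    refine ⟨X.gact e f, fun z => IsCorollaValue.corollaValue_eq ⟨u, e, f, h, ?_⟩⟩
    exact congrArg (X.gact e f) (Function.update_self u z d)
  · refine ⟨0, fun z => ?_⟩
    rw [corollaValue, dif_neg]
    · rfl
    · rintro ⟨_, v, e, f, h', -⟩
      exact h ⟨v, e, f, h'⟩

theorem isMultilinear_corollaValue :
    PGr.IsMultilinear (corollaValue : DecGraph X k l → X.carrier k l) where
  map_add G _ d v x y := by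
    obtain ⟨Λ, hΛ⟩ := exists_corollaValue_update G d v
    simp only [map_add, hΛ]
  map_smul G _ d v c x := by
    obtain ⟨Λ, hΛ⟩ := exists_corollaValue_update G d v
    simp only [map_smul, hΛ]
  map_iso f := corollaValue_wireIso f.toWireIso

theorem isCorollaValue_corolla (x : X.carrier k l) :
    (⟨PlanarGraph.corolla k l, fun _ => x⟩ : DecGraph X k l).IsCorollaValue x :=
  ⟨(), Equiv.refl _, Equiv.refl _, ⟨fun _ => rfl, (PlanarGraph.corolla k l).origin_tgt_inr,
    (PlanarGraph.corolla k l).origin_outIdx_inl⟩, X.gact_refl x⟩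

end DecGraph

/-- The linear extension of `corollaValue` is a left inverse. -/
theorem iota_injective {𝕜 : Type*} [Field 𝕜] (X : SymBimodule 𝕜) (k l : ℕ) :
    Function.Injective ((iota X).map k l) := by
  refine Function.LeftInverse.injective (g := GammaUpSpace.lift DecGraph.corollaValue
    DecGraph.isMultilinear_corollaValue DecGraph.corollaValue_wireIso) fun x => ?_
  exact (GammaUpSpace.lift_mk _ _ _ _ (PlanarGraph.isCycleFree_corolla k l)).trans (DecGraph.isCorollaValue_corolla x).corollaValue_eq

/-! ## Morphisms of ProPs preserve values -/

namespace ProP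

variable {𝕜 : Type*} [Field 𝕜] {P Q : ProP 𝕜}

theorem Hom.ext_toHom {Φ Ψ : Hom P Q} (h : Φ.toHom = Ψ.toHom) : Φ = Ψ := by
  cases Φ
  cases Ψ
  cases h
  rfl

theorem Hom.map_label (Φ : Hom P Q) {A B : Type} [Finite A] [Finite B] {k l : ℕ} (a : Fin k ≃ A)
    (b : Fin l ≃ B) (p : P.carrier k l) :
    Φ.map _ _ (P.label a b p) = Q.label a b (Φ.map k l p) :=
  Φ.map_gact _ _ _

theorem Hom.map_unitN (Φ : Hom P Q) (n : ℕ) : Φ.map n n (P.unitN n) = Q.unitN n := by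
  induction n with
  | zero => exact Φ.map_unit0
  | succ n ih =>
    rw [PreProP.unitN, PreProP.unitN, Φ.map_hcomp, ih, Φ.map_unit1]

/-- A morphism of ProPs preserves identities, relabellings, tensor products and compositions, which
are all that `Reach` uses. -/
theorem Reach.map_hom (Φ : Hom P Q) {K V C : Type} [Finite K] [Finite C] {In Out : V → Type}
    [∀ v, Finite (In v)] [∀ v, Finite (Out v)] {e : (Σ v, In v) → (Σ v, Out v) ⊕ K}
    {x : ∀ v, P.Comp (In v) (Out v)} {D : Set V} {c : C → (Σ v, Out v) ⊕ K} {p : P.Comp K C}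
    (h : Reach e x D C c p) : Reach e (fun v => Φ.map _ _ (x v)) D C c (Φ.map _ _ p) := by
  induction h with
  | base =>
    have h := Reach.base (P := Q) (e := e) (x := fun v => Φ.map _ _ (x v))
    rwa [idt, ← Φ.map_unitN] at h
  | relabel f hf h ih =>
    have h := ih.relabel f hf
    rwa [SymBimodule.relabel, SymBimodule.label, ← Φ.map_gact] at h
  | step hv hc h ih =>
    have h := ih.step hv hc
    rwa [comp, tensor, idt, SymBimodule.label, ← Φ.map_unitN, ← Φ.map_hcomp, ← Φ.map_gact,
      ← Φ.map_vcomp] at h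

variable {A B C R : Type} [Finite A] [Finite B] [Finite C] [Finite R] {k l m n r : ℕ}

theorem label_lact (a : Fin k ≃ A) (c : Fin l ≃ C) (σ : Equiv.Perm (Fin l)) (y : P.carrier k l) :
    P.label a c (P.lact σ y) = P.label a (σ.trans c) y := by
  rw [SymBimodule.lact_eq_gact, SymBimodule.label_gact, Equiv.refl_trans]

/-- With labels, one step of `Reach` is the composition with `x * I_r`. -/
theorem comp_tensor_label (a : Fin k ≃ A) (b : Fin l ≃ B) (c : Fin m ≃ C) (ρ : Fin r ≃ R)
    (x : P.carrier l m) (y : P.carrier k (l + r)) :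
    P.comp (P.tensor (P.label b c x) (P.idt R)) (P.label a (sumLabel b ρ) y) =
      P.label a (sumLabel c ρ) (P.vcomp (P.hcomp x (P.unitN r)) y) := by
  rw [← label_unitN ρ, tensor_label, comp_label]

end ProP

/-! ## The value of a decorated graph in `Γ↑(X)` -/

namespace DecGraph

variable {𝕜 : Type*} [Field 𝕜] {X : SymBimodule 𝕜} {k l l' : ℕ}

/-- An embedding of `B` as a subgraph of `G` with the same inputs, containing with any vertex all
the paths which arrive at this vertex. -/
structure InitialEmbedding (B : DecGraph X k l') (G : DecGraph X k l) where
  j : B.graph.V → G.graph.V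
  injective : Function.Injective j
  inDeg_eq : ∀ v, B.graph.inDeg v = G.graph.inDeg (j v)
  outDeg_eq : ∀ v, B.graph.outDeg v = G.graph.outDeg (j v)
  dec_eq : ∀ v, G.dec (j v) = X.castIdx (inDeg_eq v) (outDeg_eq v) (B.dec v)
  origin_eq : ∀ v i, G.graph.origin (.inl ⟨j v, Fin.cast (inDeg_eq v) i⟩) =
    Sum.map (fun s => ⟨j s.1, Fin.cast (outDeg_eq s.1) s.2⟩) id (B.graph.origin (.inl ⟨v, i⟩))

/-- The map induced by an embedding on the beginnings of edges. -/
def InitialEmbedding.mapOut {B : DecGraph X k l'} {G : DecGraph X k l} (f : InitialEmbedding B G)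
    (s : (Σ v, Fin (B.graph.outDeg v)) ⊕ Fin k) : (Σ v, Fin (G.graph.outDeg v)) ⊕ Fin k :=
  Sum.map (fun s => ⟨f.j s.1, Fin.cast (f.outDeg_eq s.1) s.2⟩) id s

/-- `y` is the class of the subgraph of `G` with the vertices in `D`, where `c` tells which edges of
`G` are the outputs of this subgraph. -/
def IsInitialClass (G : DecGraph X k l) (D : Set G.graph.V)
    (c : Fin l' → (Σ v, Fin (G.graph.outDeg v)) ⊕ Fin k) (y : GammaUpSpace X k l') : Prop :=
  ∃ (B : DecGraph X k l') (hB : B.graph.IsCycleFree) (f : InitialEmbedding B G),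
    Set.range f.j = D ∧ (∀ i, c i = f.mapOut (B.graph.origin (.inr i))) ∧
      y = GammaUpSpace.mk B hB

variable {G : DecGraph X k l} {D : Set G.graph.V}

theorem isInitialClass_empty (G : DecGraph X k l) :
    IsInitialClass G ∅ .inr (GammaUpSpace.mk (unitN X k) (isCycleFree_unitN X k)) := by
  refine ⟨unitN X k, isCycleFree_unitN X k, ⟨isEmptyElim, isEmptyElim, isEmptyElim, isEmptyElim,
    isEmptyElim, isEmptyElim⟩, Set.range_eq_empty _, fun i => ?_, rfl⟩
  rw [origin_unitN]
  rfl

theorem IsInitialClass.lact {c c' : Fin l' → (Σ v, Fin (G.graph.outDeg v)) ⊕ Fin k}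
    {y : GammaUpSpace X k l'} (h : IsInitialClass G D c y) (σ : Equiv.Perm (Fin l'))
    (hc : ∀ i, c' (σ i) = c i) : IsInitialClass G D c' (GammaUpSpace.lact σ y) := by
  obtain ⟨B, hB, f, hD, hf, rfl⟩ := h
  refine ⟨B.lact σ, hB, ⟨f.j, f.injective, f.inDeg_eq, f.outDeg_eq, f.dec_eq, fun v i => ?_⟩, hD,
    fun i => ?_, GammaUpSpace.lact_mk σ B hB⟩
  · exact (f.origin_eq v i).trans (congrArg (Sum.map _ _) (B.graph.origin_lact σ (.inl ⟨v, i⟩)).symm)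
  · obtain ⟨i, rfl⟩ := σ.surjective i
    rw [hc, hf]
    exact congrArg f.mapOut (B.graph.origin_lact σ (.inr i)).symm

/-- The graph `(corolla * I_r) ∘ B` is the subgraph `B` with one more vertex placed above it.
Sending the new vertex to `v` extends the embedding, because `c` identifies the outputs of `B` glued
to the corolla with the edges entering `v`. -/
theorem IsInitialClass.step {r : ℕ} {v : G.graph.V}
    {c : Fin (G.graph.inDeg v + r) → (Σ v, Fin (G.graph.outDeg v)) ⊕ Fin k}
    {c' : Fin (G.graph.outDeg v + r) → (Σ v, Fin (G.graph.outDeg v)) ⊕ Fin k}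
    {y : GammaUpSpace X k (G.graph.inDeg v + r)} (h : IsInitialClass G D c y) (hv : v ∉ D)
    (hc : ∀ i, c (Fin.castAdd r i) = G.graph.origin (.inl ⟨v, i⟩))
    (hc₁ : ∀ o, c' (Fin.castAdd r o) = .inl ⟨v, o⟩)
    (hc₂ : ∀ i, c' (Fin.natAdd _ i) = c (Fin.natAdd _ i)) :
    IsInitialClass G (insert v D) c' (GammaUpSpace.vcomp (GammaUpSpace.hcomp
      (GammaUpSpace.corolla (G.dec v)) (GammaUpSpace.mk (unitN X r) (isCycleFree_unitN X r))) y) := by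
  obtain ⟨B, hB, f, rfl, hf, rfl⟩ := h
  set S : DecGraph X _ _ := ⟨PlanarGraph.corolla (G.graph.inDeg v) (G.graph.outDeg v),
    fun _ => G.dec v⟩ with hS
  have hS' : S.graph.IsCycleFree := PlanarGraph.isCycleFree_corolla _ _
  have hU := isCycleFree_unitN X r
  have hU' : ∀ z : (unitN X r).graph.V, False := isEmptyElim
  have horig : ∀ i, (S.graph.hcomp (unitN X r).graph).origin (.inl ⟨.inl (), i⟩) =
      .inr (Fin.castAdd r i) := fun i =>
    (PlanarGraph.origin_hcomp_inl S.graph (unitN X r).graph ⟨(), i⟩).trans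
      (congrArg (PlanarGraph.hcompInl _ _) ((PlanarGraph.corolla _ _).origin_tgt_inr i))
  have horig₁ : ∀ o, (S.graph.hcomp (unitN X r).graph).origin (.inr (Fin.castAdd r o)) =
      .inl ⟨.inl (), o⟩ := fun o =>
    (PlanarGraph.origin_hcomp_castAdd S.graph (unitN X r).graph o).trans
      (congrArg (PlanarGraph.hcompInl _ _) ((PlanarGraph.corolla _ _).origin_outIdx_inl o))
  have horig₂ : ∀ i, (S.graph.hcomp (unitN X r).graph).origin (.inr (Fin.natAdd _ i)) =
      .inr (Fin.natAdd _ i) := fun i =>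
    (PlanarGraph.origin_hcomp_natAdd S.graph (unitN X r).graph i).trans
      (congrArg (PlanarGraph.hcompInr _ _) (origin_unitN X r i))
  set T := S.hcomp (unitN X r) with hT
  have hT' : T.graph.IsCycleFree := PlanarGraph.isCycleFree_hcomp hS' hU
  have hin : ∀ u : (T.vcomp B).graph.V, (T.vcomp B).graph.inDeg u = G.graph.inDeg
      ((Sum.elim f.j (Sum.elim (fun _ => v) fun z => (hU' z).elim) :
        B.graph.V ⊕ (Unit ⊕ (unitN X r).graph.V) → G.graph.V) u) := by
    rintro (u | u | u)
    exacts [f.inDeg_eq u, rfl, (hU' u).elim]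
  have hout : ∀ u : (T.vcomp B).graph.V, (T.vcomp B).graph.outDeg u = G.graph.outDeg
      ((Sum.elim f.j (Sum.elim (fun _ => v) fun z => (hU' z).elim) :
        B.graph.V ⊕ (Unit ⊕ (unitN X r).graph.V) → G.graph.V) u) := by
    rintro (u | u | u)
    exacts [f.outDeg_eq u, rfl, (hU' u).elim]
  have hmap : ∀ s, Sum.map (fun s : Σ u, Fin ((T.vcomp B).graph.outDeg u) =>
      (⟨_, Fin.cast (hout s.1) s.2⟩ : Σ u, Fin (G.graph.outDeg u))) id
      (B.graph.vcompInl T.graph s) = f.mapOut s := by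
    rintro (s | s) <;> rfl
  have hmap' : ∀ o : Fin (G.graph.outDeg v), Sum.map
      (fun s : Σ u, Fin ((T.vcomp B).graph.outDeg u) =>
        (⟨_, Fin.cast (hout s.1) s.2⟩ : Σ u, Fin (G.graph.outDeg u))) id
      (B.graph.vcompInr T.graph (.inl ⟨.inl (), o⟩)) = (.inl ⟨v, o⟩ : _ ⊕ Fin k) := fun _ => rfl
  refine ⟨T.vcomp B, PlanarGraph.isCycleFree_vcomp hT' hB, ⟨_, ?_, hin, hout, ?_, ?_⟩, ?_, ?_, ?_⟩
  · rintro (u | u | u) (u' | u' | u') huu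
    · exact congrArg Sum.inl (f.injective huu)
    · exact (hv ⟨u, huu⟩).elim
    · exact (hU' u').elim
    · exact (hv ⟨u', huu.symm⟩).elim
    · rfl
    · exact (hU' u').elim
    · exact (hU' u).elim
    · exact (hU' u).elim
    · exact (hU' u).elim
  · rintro (u | u | u)
    exacts [f.dec_eq u, rfl, (hU' u).elim]
  · rintro (u | u | u) i
    · refine (f.origin_eq u i).trans ?_
      refine Eq.trans ?_ (congrArg (Sum.map _ _)
        (PlanarGraph.origin_vcomp_inl B.graph T.graph ⟨u, i⟩).symm)
      exact (hmap _).symm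
    -- The `i`-th edge entering the new vertex is the `i`-th output of `B`, which `hc` identifies
    -- with the `i`-th edge entering `v` in `G`.
    · refine (hc i).symm.trans ((hf _).trans ?_)
      refine Eq.trans ?_ (congrArg (Sum.map _ _)
        ((PlanarGraph.origin_vcomp_inr B.graph T.graph ⟨.inl (), i⟩).trans
          (congrArg (B.graph.vcompInr T.graph) (horig i))).symm)
      exact (hmap _).symm
    · exact (hU' u).elim
  · ext u
    constructor
    · rintro ⟨u | u | u, rfl⟩
      exacts [.inr ⟨u, rfl⟩, .inl rfl, (hU' u).elim]
    · rintro (rfl | ⟨u, rfl⟩)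
      exacts [⟨.inr (.inl ()), rfl⟩, ⟨.inl u, rfl⟩]
  · intro o
    obtain ⟨o | i, rfl⟩ := finSumFinEquiv.surjective o
    · exact (hc₁ o).trans ((hmap' o).symm.trans (congrArg (Sum.map _ _)
        ((PlanarGraph.origin_vcomp_out B.graph T.graph _).trans
          (congrArg (B.graph.vcompInr T.graph) (horig₁ o))).symm))
    · exact ((hc₂ i).trans ((hf _).trans (hmap _).symm)).trans (congrArg (Sum.map _ _)
        ((PlanarGraph.origin_vcomp_out B.graph T.graph _).trans
          (congrArg (B.graph.vcompInr T.graph) (horig₂ i))).symm)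
  · rw [GammaUpSpace.corolla, GammaUpSpace.hcomp_mk]
    exact GammaUpSpace.vcomp_mk T hT' B hB

/-- An embedding onto all the vertices which also matches the outputs is an isomorphism, by
`mk_eq_of_origin`; there are no loops to compare because both graphs are cycle-free. -/
theorem IsInitialClass.eq_mk {y : GammaUpSpace X k l}
    (h : IsInitialClass G Set.univ (fun o => G.graph.origin (.inr o)) y)
    (hG : G.graph.IsCycleFree) : y = GammaUpSpace.mk G hG := by
  obtain ⟨B, hB, f, hD, hf, rfl⟩ := h
  have := hG.1
  have := hB.1
  refine GammaUpSpace.mk_eq_mk (PGr.mk_eq_of_origin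
    (Equiv.ofBijective f.j ⟨f.injective, Set.range_eq_univ.1 hD⟩) (Equiv.equivOfIsEmpty _ _)
    f.inDeg_eq f.outDeg_eq ?_ f.dec_eq)
  have hs : ∀ s, Sum.map (Equiv.sigmaCongr
      (Equiv.ofBijective f.j ⟨f.injective, Set.range_eq_univ.1 hD⟩)
      fun v => finCongr (f.outDeg_eq v)) id s = f.mapOut s := by
    rintro (s | s) <;> rfl
  rintro (t | o)
  · exact (f.origin_eq t.1 t.2).trans (hs _).symm
  · exact (hf o).trans (hs _).symm

end DecGraph

/-! ### Every graph is its own value in `Γ↑(X)`, and uniqueness of the morphism -/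

namespace DecGraph

variable {𝕜 : Type u} [Field 𝕜] {X : SymBimodule.{u, v} 𝕜} {k l : ℕ}

/-- When the operations are the decorated corollas in `Γ↑(X)`, every partial result is the class of
the subgraph on the vertices already applied. The numbering `f` passes from the labels in `C` to the
numbered outputs of a graph. -/
theorem exists_isInitialClass (G : DecGraph X k l) {D : Set G.graph.V} {C : Type} [Finite C]
    {c : C → (Σ v, Fin (G.graph.outDeg v)) ⊕ Fin k} {p : (gammaUpProP X).Comp (Fin k) C}
    (h : ProP.Reach (fun t => G.graph.origin (.inl t)) (fun v => (gammaUpProP X).label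
      (Equiv.refl _) (Equiv.refl _) (GammaUpSpace.corolla (G.dec v))) D C c p) :
    ∃ (l' : ℕ) (f : Fin l' ≃ C) (y : GammaUpSpace X k l'),
      (gammaUpProP X).label (Equiv.refl _) f y = p ∧ IsInitialClass G D (fun i => c (f i)) y := by
  induction h with
  | base =>
    refine ⟨k, Equiv.refl _, _, ?_, isInitialClass_empty G⟩
    exact (congrArg _ (GammaUp.unitN_eq k).symm).trans (ProP.label_unitN (Equiv.refl (Fin k)))
  | relabel g hg h ih =>
    obtain ⟨l', f, y, rfl, hy⟩ := ih
    refine ⟨l', f.trans g, y, (SymBimodule.relabel_label (Y := (gammaUpProP X).toSymBimodule)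
      (Equiv.refl (Fin k)) f (Equiv.refl (Fin k)) g y).symm, ?_⟩
    simpa only [Equiv.trans_apply, hg] using hy
  | @step D v R _ c p hv hc h ih =>
    obtain ⟨l', f, y, rfl, hy⟩ := ih
    obtain ⟨ρ⟩ : Nonempty (Fin (Nat.card R) ≃ R) := ⟨(Finite.equivFin R).symm⟩
    -- This numbering places the inputs of `v` first, as gluing with `corolla * I_r` requires;
    -- `f.trans g.symm` is the permutation leading to it.
    set g := ProP.sumLabel (Equiv.refl (Fin (G.graph.inDeg v))) ρ with hg
    obtain rfl : l' = G.graph.inDeg v + Nat.card R := Fin.equiv_iff_eq.1 ⟨f.trans g.symm⟩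
    have hy' := (hy.lact (f.trans g.symm) (c' := fun i => c (g i)) (fun i => by simp)).step
      (c' := fun o => Sum.elim (fun o => .inl ⟨v, o⟩) (fun r => c (.inr r))
        (ProP.sumLabel (Equiv.refl (Fin (G.graph.outDeg v))) ρ o)) hv
      (fun i => by simp [hg, ProP.sumLabel, hc]) (fun o => by simp [ProP.sumLabel])
      (fun i => by simp [hg, ProP.sumLabel])
    refine ⟨_, _, _, ?_, hy'⟩
    have h₁ : (gammaUpProP X).label (Equiv.refl _) g (GammaUpSpace.lact (f.trans g.symm) y) =
        (gammaUpProP X).label (Equiv.refl _) f y := by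
      refine (ProP.label_lact (P := gammaUpProP X) (Equiv.refl _) g (f.trans g.symm) y).trans ?_
      rw [Equiv.trans_assoc, Equiv.symm_trans_self, Equiv.trans_refl]
    have h₂ := ProP.comp_tensor_label (P := gammaUpProP X) (Equiv.refl (Fin k))
      (Equiv.refl (Fin (G.graph.inDeg v))) (Equiv.refl (Fin (G.graph.outDeg v))) ρ
      (GammaUpSpace.corolla (G.dec v)) (GammaUpSpace.lact (f.trans g.symm) y)
    rw [GammaUp.unitN_eq] at h₂
    exact h₂.symm.trans (congrArg _ h₁)

/-- The value reached after all the vertices is the class of a subgraph on all the vertices with the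
right outputs, hence of `G`. -/
theorem isValue_mk (G : DecGraph X k l) (hG : G.graph.IsCycleFree) :
    IsValue (P := gammaUpProP X) (iota X) G (GammaUpSpace.mk G hG) := by
  obtain ⟨p, hp⟩ := exists_isValue (P := gammaUpProP X) (iota X) hG
  obtain ⟨l', f, y, hy, h⟩ := exists_isInitialClass G hp
  obtain rfl : l' = l := Fin.equiv_iff_eq.1 ⟨f⟩
  have h' := (h.lact f (c' := fun o => G.graph.origin (.inr o)) fun _ => rfl).eq_mk hG
  have h₁ : p = GammaUpSpace.lact f y := by
    refine SymBimodule.label_injective (Equiv.refl _) (Equiv.refl _) (hy.symm.trans ?_)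
    exact (ProP.label_lact (P := gammaUpProP X) (Equiv.refl _) (Equiv.refl _) f y).symm
  rwa [← h', ← h₁]

theorem IsValue.map_hom {P Q : ProP 𝕜} (Φ : ProP.Hom P Q) {φ : X.Hom P.toSymBimodule}
    {G : DecGraph X k l} {p : P.carrier k l} (h : IsValue φ G p) :
    IsValue (Φ.toHom.comp φ) G (Φ.map k l p) := by
  have h := ProP.Reach.map_hom Φ h
  simp only [ProP.Hom.map_label] at h
  exact h

end DecGraph

/-- Applied to the class of `G`, the morphism `Φ` yields a value of `G` for `Φ ∘ ι`, and values are
unique. -/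
theorem GammaUp.hom_unique {𝕜 : Type u} [Field 𝕜] {X : SymBimodule.{u, v} 𝕜} {P : ProP.{u, w} 𝕜}
    {φ : X.Hom P.toSymBimodule} (Φ : ProP.Hom (gammaUpProP X) P) (h : Φ.toHom.comp (iota X) = φ) :
    Φ = GammaUp.evalHom φ := by
  subst h
  exact ProP.Hom.ext_toHom (SymBimodule.Hom.ext (funext₂ fun k l =>
    GammaUpSpace.linearMap_ext fun G hG => (GammaUpSpace.eval_mk_eq_of_isValue _
      ((DecGraph.isValue_mk G hG).map_hom Φ) hG).symm))

theorem mainTheorem5 {𝕜 : Type u} [Field 𝕜] (X : SymBimodule.{u, v} 𝕜) :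
    ∃ h : (GammaUp X).IsProP,
      (∀ k l : ℕ, Function.Injective ((iota X).map k l)) ∧
      ∀ (P : ProP.{u, w} 𝕜) (φ : X.Hom P.toSymBimodule),
        ∃! Φ : ProP.Hom ⟨GammaUp X, h⟩ P, Φ.toHom.comp (iota X) = φ :=
  ⟨GammaUp.isProP X, iota_injective X, fun _ φ => ⟨GammaUp.evalHom φ,
    SymBimodule.Hom.ext (funext₂ fun _ _ => LinearMap.ext (GammaUpSpace.eval_corolla φ)),
    fun Φ h => GammaUp.hom_unique Φ h⟩⟩
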